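/- Let $n\ge 1$, let $\mathcal H_C,\mathcal H_A$ be complex Hilbert spaces and let $|\psi\rangle\in\mathcal H_C\otimes\mathcal H_A$ be a unit vector. *Measurements.* For each $\mathbf z\in\{1,2,3\}^n$ let $\{\Pi^C_{\mathbf c|\mathbf z}\}_{\mathbf c\in\{\pm1\}^n}$ be a projective measurement on $\mathcal H_C$, and for each $\mathbf x\in\{1,\dots,6\}^n$ let $\{\Pi^A_{\mathbf a|\mathbf x}\}_{\mathbf a\in\{\pm1\}^n}$ be a projective measurement on $\mathcal H_A$. Put $O_{i|\mathbf z}=\sum_{\mathbf c:c_i=1}\Pi^C_{\mathbf c|\mathbf z}-\sum_{\mathbf c:c_i=-1}\Pi^C_{\mathbf c|\mathbf z}$ and $P_{i|\mathbf x}=\sum_{\mathbf a:a_i=1}\Pi^A_{\mathbf a|\mathbf x}-\sum_{\mathbf a:a_i=-1}\Pi^A_{\mathbf a|\mathbf x}$. Let $Z_i,X_i,Y_i$ be the averages $3^{-(n-1)}\sum_{\mathbf z:z_i=s}O_{i|\mathbf z}$ for $s=1,2,3$, and let $D_{zx,i},E_{zx,i},D_{zy,i},E_{zy,i},D_{xy,i},E_{xy,i}$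 be the averages $6^{-(n-1)}\sum_{\mathbf x:x_i=s}P_{i|\mathbf x}$ for $s=1,\dots,6$. Let $$\mathcal B_i=Z_i(D_{zx,i}+E_{zx,i})+X_i(D_{zx,i}-E_{zx,i})+Z_i(D_{zy,i}+E_{zy,i})-Y_i(D_{zy,i}-E_{zy,i})+X_i(D_{xy,i}+E_{xy,i})-Y_i(D_{xy,i}-E_{xy,i}).$$ Alice has two further projective measurements $\{\Pi_{\mathbf a|\lozenge}\}_{\mathbf a\in\{0,1,2,3\}^{\lfloor n/2\rfloor}}$ and $\{\Pi_{\mathbf a|\blacklozenge}\}_{\mathbf a\in\{0,1,2,3\}^{\lfloor (n-1)/2\rfloor}}$; put $S_{l,b}=\sum_{\mathbf a:a_l=b}\Pi_{\mathbf a|\lozenge}$ and $T_{l,b}=\sum_{\mathbf a:a_l=b}\Pi_{\mathbf a|\blacklozenge}$. *Hypotheses.* (i) $\langle\psi|\mathcal B_i|\psi\rangle=6\sqrt2$ for $i=1,\dots,n$. (ii) For $1\le l\le\lfloor n/2\rfloor$ and $b=0,1,2,3$, $\langle\psi|S_{l,b}|\psi\rangle=\frac14$ and $$\big(\langle\psi|Z_{2l-1}Z_{2l}S_{l,b}|\psi\rangle,\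 \langle\psi|X_{2l-1}X_{2l}S_{l,b}|\psi\rangle,\ \langle\psi|Y_{2l-1}Y_{2l}S_{l,b}|\psi\rangle\big)=\tfrac14\epsilon_b,$$ with $\epsilon_0=(1,1,-1)$, $\epsilon_1=(1,-1,1)$, $\epsilon_2=(-1,1,1)$, $\epsilon_3=(-1,-1,-1)$. (iii) For $1\le l\le\lfloor (n-1)/2\rfloor$ the same holds with $T_{l,b}$ in place of $S_{l,b}$ and with the subsystems $2l,2l+1$ in place of $2l-1,2l$. *Conclusion.* Give Charlie an $n$-qubit control register $C''$ and an $n$-qubit extraction register $C'$, and Alice likewise $A'',A'$, all in the state $|0\dots0\rangle$ (jointly written $|00\rangle$), and let $|\Phi\rangle=\bigotimes_{i=1}^n|\Phi^+\rangle^{C_i'A_i'}$, where $|\Phi^+\rangle=\frac1{\sqrt2}(|00\rangle+|11\rangle)$. Call a local unitary $U=U_C\otimes U_A$, with $U_C$ on $\mathcal H_C\otimes C''\otimes C'$ and $U_A$ on $\mathcal H_A\otimes A''\otimes A'$, together with a unit vector of the form $|\xi\rangle=\sum_{q\in\{0,1\}^n}|\xi_q\rangle^{CA}\otimes|q\rangle^{C''}|q\rangle^{A''}$,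 a *Pauli self-test* if for all $j$ $$U[|\psi\rangle|00\rangle]=|\xi\rangle|\Phi\rangle,\quad U[Z_j|\psi\rangle|00\rangle]=|\xi\rangle\,\sigma_z^{C_j'}|\Phi\rangle,\quad U[X_j|\psi\rangle|00\rangle]=|\xi\rangle\,\sigma_x^{C_j'}|\Phi\rangle,\quad U[Y_j|\psi\rangle|00\rangle]=\sigma_z^{C_j''}|\xi\rangle\,\sigma_y^{C_j'}|\Phi\rangle .$$ Then a Pauli self-test exists, and for every Pauli self-test $(U,|\xi\rangle)$ there are $|\xi_0\rangle,|\xi_1\rangle\in\mathcal H_C\otimes\mathcal H_A$ with $\langle\xi_0|\xi_0\rangle+\langle\xi_1|\xi_1\rangle=1$ and $$|\xi\rangle=|\xi_0\rangle\otimes|0\dots0\rangle^{C''}|0\dots0\rangle^{A''}+|\xi_1\rangle\otimes|1\dots1\rangle^{C''}|1\dots1\rangle^{A''}.$$ Consequently Charlie's measurements are self-tested up to a controlled global transposition: there are positive semidefinite operators $M_0,M_1$ on $C''$ with $M_0+M_1=1$ and $\langle0\dots0|M_0|0\dots0\rangle=\langle1\dots1|M_1|1\dots1\rangle=1$ such that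 for all $\mathbf z,\mathbf c$ $$U\big[\Pi^C_{\mathbf c|\mathbf z}|\psi\rangle|00\rangle\big]=\big[M_0\otimes\pi_{\mathbf c|\mathbf z}+M_1\otimes\pi_{\mathbf c|\mathbf z}^T\big]^{C''C'}|\xi\rangle|\Phi\rangle,\qquad \pi_{\mathbf c|\mathbf z}=\bigotimes_{k=1}^n\tfrac12\big(1+c_k\sigma_{z_k}\big),$$ where $\sigma_1,\sigma_2,\sigma_3$ denote $\sigma_z,\sigma_x,\sigma_y$. -/

import Mathlib

open scoped TensorProduct Matrix ComplexOrder

noncomputable section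

/-- The Hilbert-space tensor product `E ⊗ F`: the completion of the algebraic tensor product
with respect to its inner product. -/
abbrev HTensor (E F : Type*) [NormedAddCommGroup E] [InnerProductSpace ℂ E]
    [NormedAddCommGroup F] [InnerProductSpace ℂ F] : Type _ :=
  UniformSpace.Completion (E ⊗[ℂ] F)

/-- The bounded operator `S ⊗ T` between Hilbert-space tensor products. -/
def hmap {E F E' F' : Type*} [NormedAddCommGroup E] [InnerProductSpace ℂ E]
    [NormedAddCommGroup F] [InnerProductSpace ℂ F]
    [NormedAddCommGroup E'] [InnerProductSpace ℂ E']
    [NormedAddCommGroup F'] [InnerProductSpace ℂ F']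
    (S : E →L[ℂ] E') (T : F →L[ℂ] F') : HTensor E F →L[ℂ] HTensor E' F' :=
  (TensorProduct.mapL S T).completion

/-- `S ⊗ 1`: an operator on the left factor. -/
def onLeft {E F : Type*} [NormedAddCommGroup E] [InnerProductSpace ℂ E]
    [NormedAddCommGroup F] [InnerProductSpace ℂ F] (S : E →L[ℂ] E) :
    HTensor E F →L[ℂ] HTensor E F :=
  hmap S (ContinuousLinearMap.id ℂ F)

/-- The local unitary `UC ⊗ UA`. -/
def localUnitary {E F : Type*} [NormedAddCommGroup E] [InnerProductSpace ℂ E]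
    [NormedAddCommGroup F] [InnerProductSpace ℂ F] (UC : E ≃ₗᵢ[ℂ] E) (UA : F ≃ₗᵢ[ℂ] F) :
    HTensor E F →L[ℂ] HTensor E F :=
  hmap (UC : E →L[ℂ] E) (UA : F →L[ℂ] F)

/-- A (finite-outcome) projective measurement: mutually orthogonal self-adjoint projections
summing to the identity. -/
def IsProjMeasurement {H : Type*} [NormedAddCommGroup H] [InnerProductSpace ℂ H] [CompleteSpace H]
    {A : Type*} [Fintype A] (P : A → H →L[ℂ] H) : Prop :=
  (∀ a, IsStarProjection (P a)) ∧ (∀ a b, a ≠ b → P a * P b = 0) ∧ ∑ a, P a = 1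

/-- The observable of the `i`-th output sign of a measurement with outcomes in `{±1}ⁿ`:
the sum of the projectors with `cᵢ = +1` minus the sum of those with `cᵢ = -1`. -/
def signObs {H : Type*} [NormedAddCommGroup H] [InnerProductSpace ℂ H] {n : ℕ}
    (P : (Fin n → ℤˣ) → H →L[ℂ] H) (i : Fin n) : H →L[ℂ] H :=
  (∑ c : Fin n → ℤˣ with c i = 1, P c) - ∑ c : Fin n → ℤˣ with c i = -1, P c

/-- The average of the `i`-th sign observables over all setting vectors `z` with `zᵢ = s`, where
each coordinate of a setting vector takes `k` values. -/
def avgObs {H : Type*} [NormedAddCommGroup H] [InnerProductSpace ℂ H] {n k : ℕ}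
    (P : (Fin n → Fin k) → (Fin n → ℤˣ) → H →L[ℂ] H) (s : Fin k) (i : Fin n) : H →L[ℂ] H :=
  ((k : ℂ) ^ (n - 1))⁻¹ • ∑ z : Fin n → Fin k with z i = s, signObs (P z) i

/-- The triple CHSH Bell operator of the `i`-th subsystem. Charlie's settings `0, 1, 2` are
`Z, X, Y`; Alice's settings `0, …, 5` are `D_zx, E_zx, D_zy, E_zy, D_xy, E_xy`. -/
def tripleCHSH {HC HA : Type*} [NormedAddCommGroup HC] [InnerProductSpace ℂ HC]
    [NormedAddCommGroup HA] [InnerProductSpace ℂ HA] {n : ℕ}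
    (P : (Fin n → Fin 3) → (Fin n → ℤˣ) → HC →L[ℂ] HC)
    (Q : (Fin n → Fin 6) → (Fin n → ℤˣ) → HA →L[ℂ] HA) (i : Fin n) :
    HTensor HC HA →L[ℂ] HTensor HC HA :=
  hmap (avgObs P 0 i) (avgObs Q 0 i + avgObs Q 1 i)
    + hmap (avgObs P 1 i) (avgObs Q 0 i - avgObs Q 1 i)
    + hmap (avgObs P 0 i) (avgObs Q 2 i + avgObs Q 3 i)
    - hmap (avgObs P 2 i) (avgObs Q 2 i - avgObs Q 3 i)
    + hmap (avgObs P 1 i) (avgObs Q 4 i + avgObs Q 5 i)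
    - hmap (avgObs P 2 i) (avgObs Q 4 i - avgObs Q 5 i)

/-- The projector on the outcomes `a` with `a_l = b`, for a measurement with outcomes in
`{0,1,2,3}ᵐ`. -/
def marginalProj {H : Type*} [NormedAddCommGroup H] [InnerProductSpace ℂ H] {m : ℕ}
    (R : (Fin m → Fin 4) → H →L[ℂ] H) (l : Fin m) (b : Fin 4) : H →L[ℂ] H :=
  ∑ a : Fin m → Fin 4 with a l = b, R a

/-- `bellSign b s` is the value of `σ_s ⊗ σ_s` (with `s = 0, 1, 2` for `z, x, y`) on the Bell
state number `b` in the list `Φ⁺, Φ⁻, Ψ⁺, Ψ⁻`. -/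
def bellSign : Fin 4 → Fin 3 → ℂ :=
  ![![1, 1, -1], ![1, -1, 1], ![-1, 1, 1], ![-1, -1, -1]]

/-- The correlations of a Bell-state measurement on subsystems `i, j`: each of the four outcome
projectors `R b` has `⟨R b⟩ = 1/4` and `⟨C_i C_j ⊗ R b⟩ = ± 1/4` for `C = Z, X, Y`. -/
def BellTable {HC HA : Type*} [NormedAddCommGroup HC] [InnerProductSpace ℂ HC]
    [NormedAddCommGroup HA] [InnerProductSpace ℂ HA] {n : ℕ} (ψ : HTensor HC HA)
    (P : (Fin n → Fin 3) → (Fin n → ℤˣ) → HC →L[ℂ] HC) (R : Fin 4 → HA →L[ℂ] HA)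
    (i j : Fin n) : Prop :=
  ∀ b : Fin 4, inner ℂ ψ (hmap (1 : HC →L[ℂ] HC) (R b) ψ) = 1 / 4 ∧
    ∀ s : Fin 3, inner ℂ ψ (hmap (avgObs P s i * avgObs P s j) (R b) ψ) = bellSign b s / 4

/-- `E ⊗ (ℂ²)^{⊗n}`, written as the `E`-valued families indexed by the computational basis. -/
abbrev Reg (n : ℕ) (E : Type*) [NormedAddCommGroup E] [InnerProductSpace ℂ E] : Type _ :=
  PiLp 2 (fun _ : Fin n → Fin 2 => E)

/-- `x ↦ x ⊗ |q⟩`. -/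
def ket {n : ℕ} {E : Type*} [NormedAddCommGroup E] [InnerProductSpace ℂ E]
    (q : Fin n → Fin 2) : E →L[ℂ] Reg n E :=
  (PiLp.continuousLinearEquiv 2 ℂ (fun _ : Fin n → Fin 2 => E)).symm.toContinuousLinearMap ∘L
    ContinuousLinearMap.single ℂ (fun _ : Fin n → Fin 2 => E) q

/-- `1 ⊗ ⟨q|`. -/
def bra {n : ℕ} {E : Type*} [NormedAddCommGroup E] [InnerProductSpace ℂ E]
    (q : Fin n → Fin 2) : Reg n E →L[ℂ] E :=
  PiLp.proj 2 (fun _ : Fin n → Fin 2 => E) q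

/-- `1 ⊗ M`: a matrix acting on the register. -/
def regOp {n : ℕ} {E : Type*} [NormedAddCommGroup E] [InnerProductSpace ℂ E]
    (M : Matrix (Fin n → Fin 2) (Fin n → Fin 2) ℂ) : Reg n E →L[ℂ] Reg n E :=
  ∑ r, ∑ s, M r s • (ket r ∘L bra s)

/-- `T ⊗ 1`: an operator that does not touch the register. -/
def regLift {n : ℕ} {E : Type*} [NormedAddCommGroup E] [InnerProductSpace ℂ E]
    (T : E →L[ℂ] E) : Reg n E →L[ℂ] Reg n E :=
  ∑ r, ket r ∘L T ∘L bra r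

/-- The tensor product `⨂ₖ Mₖ` of single-qubit matrices. -/
def tensorMat {n : ℕ} (M : Fin n → Matrix (Fin 2) (Fin 2) ℂ) :
    Matrix (Fin n → Fin 2) (Fin n → Fin 2) ℂ :=
  Matrix.of fun r s => ∏ k, M k (r k) (s k)

/-- The matrix `M` acting on the `j`-th qubit. -/
def site {n : ℕ} (j : Fin n) (M : Matrix (Fin 2) (Fin 2) ℂ) :
    Matrix (Fin n → Fin 2) (Fin n → Fin 2) ℂ :=
  tensorMat (Function.update (fun _ => 1) j M)

/-- The Pauli matrices in the order `σ_z, σ_x, σ_y`. -/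
def pauli : Fin 3 → Matrix (Fin 2) (Fin 2) ℂ :=
  ![!![1, 0; 0, -1], !![0, 1; 1, 0], !![0, -Complex.I; Complex.I, 0]]

/-- `⨂ₖ (1 + cₖ σ_{zₖ}) / 2`: the target projector for settings `z` and outcomes `c`. -/
def pauliProj {n : ℕ} (z : Fin n → Fin 3) (c : Fin n → ℤˣ) :
    Matrix (Fin n → Fin 2) (Fin n → Fin 2) ℂ :=
  tensorMat fun k => (1 / 2 : ℂ) • (1 + (((c k : ℤˣ) : ℤ) : ℂ) • pauli (z k))

/-- `ψ ⊗ |0…0⟩`, with two registers of `n` qubits in the state `|0…0⟩` added on either side: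
first the control register (`C''`, `A''`) and then the extraction register (`C'`, `A'`). -/
def withAncillas {HC HA : Type*} [NormedAddCommGroup HC] [InnerProductSpace ℂ HC]
    [NormedAddCommGroup HA] [InnerProductSpace ℂ HA] (n : ℕ) (ψ : HTensor HC HA) :
    HTensor (Reg n (Reg n HC)) (Reg n (Reg n HA)) :=
  hmap ((ket 0 : Reg n HC →L[ℂ] Reg n (Reg n HC)) ∘L ket 0)
    ((ket 0 : Reg n HA →L[ℂ] Reg n (Reg n HA)) ∘L ket 0) ψ

/-- `ξ ⊗ |Φ⁺⟩^{⊗n}`, with `|Φ⁺⟩^{⊗n} = 2^{-n/2} ∑ₚ |p⟩|p⟩`. -/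
def withPhi {E F : Type*} [NormedAddCommGroup E] [InnerProductSpace ℂ E]
    [NormedAddCommGroup F] [InnerProductSpace ℂ F] {n : ℕ} (ξ : HTensor E F) :
    HTensor (Reg n E) (Reg n F) :=
  (((Real.sqrt 2 : ℝ) : ℂ) ^ n)⁻¹ • ∑ p : Fin n → Fin 2, hmap (ket p) (ket p) ξ

/-- The relations of the parallel Pauli self-test: the local unitary `U = UC ⊗ UA` maps
`ψ ⊗ |00⟩` to `ξ ⊗ Φ`, where `Φ = |Φ⁺⟩^{⊗n}`, the state `Z_j ψ ⊗ |00⟩` to `ξ ⊗ σ_z Φ`,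
`X_j ψ ⊗ |00⟩` to `ξ ⊗ σ_x Φ`, and `Y_j ψ ⊗ |00⟩` to `σ_z ξ ⊗ σ_y Φ`, with the first `σ_z` on the
`j`-th control qubit and the other Pauli matrices on the `j`-th extraction qubit of Charlie;
the normalized junk state is `ξ = ∑_q ξ_q ⊗ |q q⟩`. -/
structure PauliSelfTest {HC HA : Type*} [NormedAddCommGroup HC] [InnerProductSpace ℂ HC]
    [NormedAddCommGroup HA] [InnerProductSpace ℂ HA] {n : ℕ} (ψ : HTensor HC HA)
    (P : (Fin n → Fin 3) → (Fin n → ℤˣ) → HC →L[ℂ] HC)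
    (UC : Reg n (Reg n HC) ≃ₗᵢ[ℂ] Reg n (Reg n HC))
    (UA : Reg n (Reg n HA) ≃ₗᵢ[ℂ] Reg n (Reg n HA))
    (ξ : HTensor (Reg n HC) (Reg n HA)) : Prop where
  norm_junk : ‖ξ‖ = 1
  junk_form : ∃ ξq : (Fin n → Fin 2) → HTensor HC HA, ξ = ∑ q, hmap (ket q) (ket q) (ξq q)
  state : localUnitary UC UA (withAncillas n ψ) = withPhi ξ
  obsZ : ∀ j, localUnitary UC UA (withAncillas n (onLeft (avgObs P 0 j) ψ)) =
    onLeft (regOp (site j (pauli 0))) (withPhi ξ)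
  obsX : ∀ j, localUnitary UC UA (withAncillas n (onLeft (avgObs P 1 j) ψ)) =
    onLeft (regOp (site j (pauli 1))) (withPhi ξ)
  obsY : ∀ j, localUnitary UC UA (withAncillas n (onLeft (avgObs P 2 j) ψ)) =
    onLeft (regOp (site j (pauli 2))) (withPhi (onLeft (regOp (site j (pauli 0))) ξ))

/-- `1 ⊗ [M₀ ⊗ M + M₁ ⊗ Mᵀ]`: the matrix `M` acts on the extraction register, or its transpose
does, controlled by the operators `M₀, M₁` on the control register. -/
def ctrlTranspose {n : ℕ} {E : Type*} [NormedAddCommGroup E] [InnerProductSpace ℂ E]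
    (M₀ M₁ M : Matrix (Fin n → Fin 2) (Fin n → Fin 2) ℂ) :
    Reg n (Reg n E) →L[ℂ] Reg n (Reg n E) :=
  regOp M ∘L regLift (regOp M₀) + regOp Mᵀ ∘L regLift (regOp M₁)

end

/-! Each of the three CHSH expressions in `tripleCHSH` is at most `2√2`, so the value `6√2`
saturates all of them. The sum-of-squares form of Tsirelson's bound (`chsh_le`) then gives, on `ψ`,
that Charlie's averages have norm one and anticommute, and that Alice can imitate each of them. A
unit vector that averages vectors of the unit ball equals each of them, so every single observable
`signObs (P z) i` acts on `ψ` as the average for `z i`. Observables of different subsystems can thus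
be read off one projective measurement, where they commute.

All of these relations hold only on `ψ`. They become operator identities on the space `reachable ψ`
of vectors `(1 ⊗ T)ψ`: the `mirrored` operators of Charlie map it to itself, and two of them that
agree on `ψ` agree on all of it, since they commute with Alice's operators. There the averages
satisfy the exact Pauli relations (`BellRelations.pauliRelations`). The remaining freedom is the
central involution `J = iXZY` of each subsystem, the `chirality`, which is `1` for the Pauli
matrices and `-1` for their transposes; `Y = iXZJ` recovers the third observable.

Existence: the swap circuit measures `J` into the control register and `Z` into the extraction
register, then applies the word in `X` named by the extraction register. Its Kraus operators turn
right multiplication by `Z`, `X`, `J` into Pauli matrices on the registers. Alice's circuit acts on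
`ψ` as the reversed Kraus operators of Charlie, and the product with them
(`PauliRelations.swap_mul_rev`) is diagonal in both register labels and independent of the
extraction label, which produces `ξ ⊗ Φ`. The circuit needs unitaries, and a Cayley transform
supplies them without changing the action on `ψ`.

Junk state: in any Pauli self-test the relations on `ψ` extend to reachable vectors, so `J_j`
corresponds to `σ_z` on the `j`-th control qubit. In each outcome of a Bell measurement the signs of
`XX`, `ZZ`, `YY` multiply to `-1`, whence `J_i J_j ψ = ψ` for neighbours
(`BellRelations.chirality_of_bellTable`). The two measurements of Alice cover all neighbouring
pairs, so only the constant control strings survive. On `0…0` Charlie's observables are the Pauli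
matrices and on `1…1` their transposes; multiplying spectral projectors gives the statement on joint
outcomes. -/

noncomputable section

/-! ### Operators on Hilbert-space tensor products -/

section HTensor

variable {E F E' F' E'' F'' : Type*}
  [NormedAddCommGroup E] [InnerProductSpace ℂ E] [NormedAddCommGroup F] [InnerProductSpace ℂ F]
  [NormedAddCommGroup E'] [InnerProductSpace ℂ E'] [NormedAddCommGroup F'] [InnerProductSpace ℂ F']
  [NormedAddCommGroup E''] [InnerProductSpace ℂ E'']
  [NormedAddCommGroup F''] [InnerProductSpace ℂ F'']

lemma hmap_coe (S : E →L[ℂ] E') (T : F →L[ℂ] F') (t : E ⊗[ℂ] F) :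
    hmap S T (t : HTensor E F) = ((TensorProduct.mapL S T t : E' ⊗[ℂ] F') : HTensor E' F') :=
  ContinuousLinearMap.completion_apply_coe _ _

lemma HTensor.clm_ext {G : Type*} [NormedAddCommGroup G] [NormedSpace ℂ G]
    {f g : HTensor E F →L[ℂ] G} (h : ∀ t : E ⊗[ℂ] F, f t = g t) : f = g := by
  ext x
  induction x using UniformSpace.Completion.induction_on with
  | hp => exact isClosed_eq f.continuous g.continuous
  | ih t => exact h t

lemma hmap_comp (S' : E' →L[ℂ] E'') (T' : F' →L[ℂ] F'') (S : E →L[ℂ] E') (T : F →L[ℂ] F') :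
    hmap (S' ∘L S) (T' ∘L T) = hmap S' T' ∘L hmap S T := by
  apply HTensor.clm_ext
  intro t
  rw [ContinuousLinearMap.comp_apply, hmap_coe, hmap_coe, hmap_coe, TensorProduct.mapL_comp]
  rfl

lemma hmap_comp_apply (S' : E' →L[ℂ] E'') (T' : F' →L[ℂ] F'') (S : E →L[ℂ] E') (T : F →L[ℂ] F')
    (x : HTensor E F) : hmap (S' ∘L S) (T' ∘L T) x = hmap S' T' (hmap S T x) := by
  rw [hmap_comp]; rfl

/-- `hmap` as a bilinear map. -/
def hmapBilin : (E →L[ℂ] E') →ₗ[ℂ] (F →L[ℂ] F') →ₗ[ℂ] (HTensor E F →L[ℂ] HTensor E' F') :=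
  LinearMap.mk₂ ℂ hmap
    (fun S S' T => HTensor.clm_ext fun t => by
      rw [add_apply, hmap_coe, hmap_coe, hmap_coe, TensorProduct.mapL_add_left,
        add_apply, UniformSpace.Completion.coe_add])
    (fun c S T => HTensor.clm_ext fun t => by
      rw [smul_apply, hmap_coe, hmap_coe, TensorProduct.mapL_smul_left,
        smul_apply, UniformSpace.Completion.coe_smul])
    (fun S T T' => HTensor.clm_ext fun t => by
      rw [add_apply, hmap_coe, hmap_coe, hmap_coe, TensorProduct.mapL_add_right,
        add_apply, UniformSpace.Completion.coe_add])
    (fun c S T => HTensor.clm_ext fun t => by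
      rw [smul_apply, hmap_coe, hmap_coe, TensorProduct.mapL_smul_right,
        smul_apply, UniformSpace.Completion.coe_smul])

lemma hmapBilin_apply (S : E →L[ℂ] E') (T : F →L[ℂ] F') : hmapBilin S T = hmap S T := rfl

lemma hmap_sum_left {ι : Type*} (s : Finset ι) (S : ι → E →L[ℂ] E') (T : F →L[ℂ] F') :
    hmap (∑ i ∈ s, S i) T = ∑ i ∈ s, hmap (S i) T := by
  simp only [← hmapBilin_apply, map_sum, LinearMap.sum_apply]

lemma hmap_sum_right {ι : Type*} (s : Finset ι) (S : E →L[ℂ] E') (T : ι → F →L[ℂ] F') :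
    hmap S (∑ i ∈ s, T i) = ∑ i ∈ s, hmap S (T i) := by
  simp only [← hmapBilin_apply, map_sum]

lemma hmap_zero_left (T : F →L[ℂ] F') : hmap (0 : E →L[ℂ] E') T = 0 := by
  simp only [← hmapBilin_apply, map_zero, LinearMap.zero_apply]

lemma hmap_smul_left (c : ℂ) (S : E →L[ℂ] E') (T : F →L[ℂ] F') :
    hmap (c • S) T = c • hmap S T := by
  simp only [← hmapBilin_apply, map_smul, LinearMap.smul_apply]

lemma hmap_one_one : hmap (1 : E →L[ℂ] E) (1 : F →L[ℂ] F) = 1 := by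
  apply HTensor.clm_ext
  intro t
  rw [hmap_coe]
  erw [TensorProduct.mapL_id_id]
  rfl

lemma inner_hmap_left [CompleteSpace E] [CompleteSpace F] [CompleteSpace E'] [CompleteSpace F']
    (S : E →L[ℂ] E') (T : F →L[ℂ] F') (x : HTensor E F) (y : HTensor E' F') :
    inner ℂ (hmap S T x) y = inner ℂ x (hmap S.adjoint T.adjoint y) := by
  induction x, y using UniformSpace.Completion.induction_on₂ with
  | hp => exact isClosed_eq (by fun_prop) (by fun_prop)
  | ih s t =>
    rw [hmap_coe, hmap_coe, UniformSpace.Completion.inner_coe, UniformSpace.Completion.inner_coe]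
    induction s with
    | zero => simp
    | add s s' hs hs' => rw [map_add, inner_add_left, inner_add_left, hs, hs']
    | tmul a b =>
      induction t with
      | zero => simp
      | add s s' hs hs' => rw [map_add, inner_add_right, inner_add_right, hs, hs']
      | tmul c d =>
        rw [TensorProduct.mapL_tmul, TensorProduct.mapL_tmul, TensorProduct.inner_tmul,
          TensorProduct.inner_tmul, ContinuousLinearMap.adjoint_inner_right,
          ContinuousLinearMap.adjoint_inner_right]

lemma adjoint_hmap [CompleteSpace E] [CompleteSpace F] [CompleteSpace E'] [CompleteSpace F']
    (S : E →L[ℂ] E') (T : F →L[ℂ] F') :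
    (hmap S T).adjoint = hmap S.adjoint T.adjoint := by
  symm
  rw [ContinuousLinearMap.eq_adjoint_iff]
  intro x y
  rw [inner_hmap_left, ContinuousLinearMap.adjoint_adjoint, ContinuousLinearMap.adjoint_adjoint]

lemma hmap_mul (S S' : E →L[ℂ] E) (T T' : F →L[ℂ] F) :
    hmap (S * S') (T * T') = hmap S T * hmap S' T' :=
  hmap_comp S T S' T'

lemma hmap_mul_one (S S' : E →L[ℂ] E) :
    hmap (S * S') (1 : F →L[ℂ] F) = hmap S 1 * hmap S' 1 := by
  rw [← hmap_mul, mul_one]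

lemma hmap_one_mul (T T' : F →L[ℂ] F) :
    hmap (1 : E →L[ℂ] E) (T * T') = hmap 1 T * hmap 1 T' := by
  rw [← hmap_mul, mul_one]

lemma star_hmap [CompleteSpace E] [CompleteSpace F] (S : E →L[ℂ] E) (T : F →L[ℂ] F) :
    star (hmap S T) = hmap (star S) (star T) :=
  adjoint_hmap S T

/-- `S ↦ S ⊗ 1` as a homomorphism of star algebras. -/
def leftHom (E F : Type*) [NormedAddCommGroup E] [InnerProductSpace ℂ E] [CompleteSpace E]
    [NormedAddCommGroup F] [InnerProductSpace ℂ F] [CompleteSpace F] :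
    (E →L[ℂ] E) →⋆ₐ[ℂ] (HTensor E F →L[ℂ] HTensor E F) where
  toAlgHom := AlgHom.ofLinearMap (hmapBilin.flip 1) hmap_one_one hmap_mul_one
  map_star' S := by
    have h := star_hmap S (1 : F →L[ℂ] F)
    rw [star_one] at h
    exact h.symm

/-- `T ↦ 1 ⊗ T` as a homomorphism of star algebras. -/
def rightHom (E F : Type*) [NormedAddCommGroup E] [InnerProductSpace ℂ E] [CompleteSpace E]
    [NormedAddCommGroup F] [InnerProductSpace ℂ F] [CompleteSpace F] :
    (F →L[ℂ] F) →⋆ₐ[ℂ] (HTensor E F →L[ℂ] HTensor E F) where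
  toAlgHom := AlgHom.ofLinearMap (hmapBilin 1) hmap_one_one hmap_one_mul
  map_star' T := by
    have h := star_hmap (1 : E →L[ℂ] E) T
    rw [star_one] at h
    exact h.symm

variable [CompleteSpace E] [CompleteSpace F]

lemma leftHom_apply (S : E →L[ℂ] E) : leftHom E F S = hmap S 1 := rfl

lemma rightHom_apply (T : F →L[ℂ] F) : rightHom E F T = hmap 1 T := rfl

lemma onLeft_eq_leftHom (S : E →L[ℂ] E) : (onLeft S : HTensor E F →L[ℂ] _) = leftHom E F S := rfl

lemma hmap_eq_leftHom_rightHom (S : E →L[ℂ] E) (T : F →L[ℂ] F) (x : HTensor E F) :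
    hmap S T x = leftHom E F S (rightHom E F T x) := by
  rw [leftHom_apply, rightHom_apply, ← hmap_comp_apply]; rfl

lemma hmap_eq_rightHom_leftHom (S : E →L[ℂ] E) (T : F →L[ℂ] F) (x : HTensor E F) :
    hmap S T x = rightHom E F T (leftHom E F S x) := by
  rw [leftHom_apply, rightHom_apply, ← hmap_comp_apply]; rfl

lemma leftHom_rightHom_comm (S : E →L[ℂ] E) (T : F →L[ℂ] F) (x : HTensor E F) :
    leftHom E F S (rightHom E F T x) = rightHom E F T (leftHom E F S x) := by
  rw [← hmap_eq_leftHom_rightHom, hmap_eq_rightHom_leftHom]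

lemma norm_hmap_of_isometry [CompleteSpace E'] [CompleteSpace F']
    {S : E →L[ℂ] E'} {T : F →L[ℂ] F'} (hS : S.adjoint ∘L S = 1) (hT : T.adjoint ∘L T = 1)
    (x : HTensor E F) : ‖hmap S T x‖ = ‖x‖ := by
  rw [@norm_eq_sqrt_re_inner ℂ, @norm_eq_sqrt_re_inner ℂ _ _ _ _ x, inner_hmap_left,
    ← hmap_comp_apply, hS, hT, hmap_one_one, one_apply_eq_self]

end HTensor

/-! ### Equality cases in Hilbert space and Tsirelson's bound -/

section HilbertSpace

variable {H : Type*} [NormedAddCommGroup H] [InnerProductSpace ℂ H]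

lemma norm_sub_sq_re (x y : H) :
    ‖x - y‖ ^ 2 = ‖x‖ ^ 2 - 2 * (inner ℂ x y).re + ‖y‖ ^ 2 := by
  simpa using @norm_sub_sq ℂ H _ _ _ x y

/-- The equality case of Cauchy–Schwarz in the unit ball: expanding `‖x - y‖²` bounds it by `0`. All
rigidity below comes from here or from a sum of squares. -/
lemma eq_of_re_inner_eq_one {x y : H} (hx : ‖x‖ ≤ 1) (hy : ‖y‖ ≤ 1)
    (h : 1 ≤ (inner ℂ x y).re) : x = y := by
  have h1 := norm_sub_sq_re x y
  have h2 : ‖x - y‖ ^ 2 = 0 := by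
    have := sq_nonneg ‖x - y‖
    nlinarith [norm_nonneg x, norm_nonneg y]
  exact sub_eq_zero.1 (norm_eq_zero.1 (pow_eq_zero_iff two_ne_zero |>.1 h2))

/-- If the average of vectors of the unit ball is a unit vector, then they are all equal. -/
lemma eq_average_of_norm_eq_one {ι : Type*} {s : Finset ι} {v : ι → H} {m : H}
    (hv : ∀ i ∈ s, ‖v i‖ ≤ 1) (hm : ‖m‖ = 1) (hs : (s.card : ℂ) • m = ∑ i ∈ s, v i) :
    ∀ i ∈ s, v i = m := by
  have hle : ∀ i ∈ s, (inner ℂ m (v i)).re ≤ 1 := fun i hi =>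
    (Complex.re_le_norm _).trans <| (norm_inner_le_norm _ _).trans <| by
      rw [hm, one_mul]; exact hv i hi
  -- Pairing with `m` turns the average into real numbers at most `1` whose mean is `1`, so each of
  -- them equals `1`.
  have hsum : ∑ i ∈ s, (inner ℂ m (v i)).re = ∑ i ∈ s, (1 : ℝ) := by
    rw [← Complex.re_sum, ← inner_sum, ← hs, inner_smul_right, inner_self_eq_norm_sq_to_K, hm]
    simp
  intro i hi
  exact (eq_of_re_inner_eq_one hm.le (hv i hi)
    ((Finset.sum_eq_sum_iff_of_le hle).1 hsum i hi).ge).symm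

/-- A selfadjoint contraction squares to the identity on the vectors whose norm it preserves. -/
lemma apply_apply_of_norm_eq [CompleteSpace H] {T : H →L[ℂ] H} (hT : star T = T)
    (hle : ∀ v, ‖T v‖ ≤ ‖v‖) {v : H} (hv : ‖v‖ = 1) (h : ‖T v‖ = 1) : T (T v) = v := by
  refine eq_of_re_inner_eq_one ((hle _).trans h.le) hv.le ?_
  rw [← ContinuousLinearMap.adjoint_inner_right, ← ContinuousLinearMap.star_eq_adjoint, hT,
    inner_self_eq_norm_sq_to_K, h]
  simp

/-- The Tsirelson bound for vectors of the unit ball. -/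
lemma chsh_le {Z X D E : H} (hZ : ‖Z‖ ≤ 1) (hX : ‖X‖ ≤ 1) (hD : ‖D‖ ≤ 1) (hE : ‖E‖ ≤ 1) :
    (inner ℂ Z (D + E)).re + (inner ℂ X (D - E)).re ≤ 2 * √2 ∧
    (2 * √2 ≤ (inner ℂ Z (D + E)).re + (inner ℂ X (D - E)).re →
      ((√2 : ℝ) : ℂ) • D = Z + X ∧ ((√2 : ℝ) : ℂ) • E = Z - X ∧ ‖Z‖ = 1 ∧ ‖X‖ = 1 ∧
        ‖D‖ = 1 ∧ ‖E‖ = 1) := by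
  have hs : √2 * √2 = 2 := Real.mul_self_sqrt (by norm_num)
  have hs0 : 0 < √2 := by positivity
  have h1 := norm_sub_sq_re (((√2 : ℝ) : ℂ) • D) (Z + X)
  have h2 := norm_sub_sq_re (((√2 : ℝ) : ℂ) • E) (Z - X)
  have h3 : ‖Z + X‖ ^ 2 = ‖Z‖ ^ 2 + 2 * (inner ℂ Z X).re + ‖X‖ ^ 2 := by
    simpa using @norm_add_sq ℂ H _ _ _ Z X
  have h4 := norm_sub_sq_re Z X
  have hn : ∀ v : H, ‖((√2 : ℝ) : ℂ) • v‖ ^ 2 = 2 * ‖v‖ ^ 2 := fun v => by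
    rw [norm_smul, Complex.norm_real, Real.norm_of_nonneg hs0.le, mul_pow, sq √2, hs]
  have hre : ∀ v w : H, (inner ℂ (((√2 : ℝ) : ℂ) • v) w).re = √2 * (inner ℂ w v).re := by
    intro v w
    rw [inner_smul_left, Complex.conj_ofReal, Complex.re_ofReal_mul]
    exact congr_arg _ (inner_re_symm (𝕜 := ℂ) v w)
  rw [hn, hre, inner_add_left, Complex.add_re] at h1
  rw [hn, hre, inner_sub_left, Complex.sub_re] at h2
  have hval : (inner ℂ Z (D + E)).re + (inner ℂ X (D - E)).re =
      (inner ℂ Z D).re + (inner ℂ X D).re + (inner ℂ Z E).re - (inner ℂ X E).re := by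
    rw [inner_add_right, inner_sub_right, Complex.add_re, Complex.sub_re]; ring
  set val := (inner ℂ Z (D + E)).re + (inner ℂ X (D - E)).re with hvald
  -- The sum-of-squares certificate. The right side is at most `8 - 2√2 val`, so `val ≤ 2√2`; at
  -- equality both squares vanish and all four norms must be `1`.
  have hsos : ‖((√2 : ℝ) : ℂ) • D - (Z + X)‖ ^ 2 + ‖((√2 : ℝ) : ℂ) • E - (Z - X)‖ ^ 2 =
      2 * (‖D‖ ^ 2 + ‖E‖ ^ 2 + ‖Z‖ ^ 2 + ‖X‖ ^ 2) - 2 * √2 * val := by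
    rw [hval, h1, h2, h3, h4]; ring
  have sq_le : ∀ {v : H}, ‖v‖ ≤ 1 → ‖v‖ ^ 2 ≤ 1 := fun h => pow_le_one₀ (norm_nonneg _) h
  have a1 := sq_nonneg ‖((√2 : ℝ) : ℂ) • D - (Z + X)‖
  have a2 := sq_nonneg ‖((√2 : ℝ) : ℂ) • E - (Z - X)‖
  have bZ := sq_le hZ
  have bX := sq_le hX
  have bD := sq_le hD
  have bE := sq_le hE
  constructor
  · by_contra! hlt
    have := mul_lt_mul_of_pos_left hlt hs0
    nlinarith
  · intro hge
    have hge' := mul_le_mul_of_nonneg_left hge hs0.le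
    have hge'' : 4 ≤ √2 * val := by nlinarith
    have c1 : ‖((√2 : ℝ) : ℂ) • D - (Z + X)‖ ^ 2 = 0 := by linarith
    have c2 : ‖((√2 : ℝ) : ℂ) • E - (Z - X)‖ ^ 2 = 0 := by linarith
    have sq_one : ∀ {v : H}, ‖v‖ ^ 2 = 1 → ‖v‖ = 1 := fun h =>
      (pow_eq_one_iff_of_nonneg (norm_nonneg _) two_ne_zero).1 h
    exact ⟨sub_eq_zero.1 (norm_eq_zero.1 (pow_eq_zero_iff two_ne_zero |>.1 c1)),
      sub_eq_zero.1 (norm_eq_zero.1 (pow_eq_zero_iff two_ne_zero |>.1 c2)),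
      sq_one (by linarith), sq_one (by linarith), sq_one (by linarith), sq_one (by linarith)⟩

end HilbertSpace

/-! ### Functional calculus of a projective measurement -/

section Measurement

variable {H : Type*} [NormedAddCommGroup H] [InnerProductSpace ℂ H] [CompleteSpace H]
  {A : Type*} [Fintype A] [DecidableEq A] {P : A → H →L[ℂ] H}

lemma IsProjMeasurement.mul_eq (hP : IsProjMeasurement P) (a b : A) :
    P a * P b = if a = b then P a else 0 := by
  split_ifs with h
  · rw [← h]; exact (hP.1 a).1
  · exact hP.2.1 a b h

/-- The functional calculus of a projective measurement, `f ↦ ∑ a, f a • P a`. -/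
def IsProjMeasurement.functional (hP : IsProjMeasurement P) : (A → ℂ) →ₐ[ℂ] (H →L[ℂ] H) :=
  AlgHom.ofLinearMap (Fintype.linearCombination ℂ P)
    (by simpa [Fintype.linearCombination_apply] using hP.2.2)
    (fun f g => by
      simp only [Fintype.linearCombination_apply, Finset.sum_mul, Finset.mul_sum, smul_mul_smul_comm,
        hP.mul_eq, smul_ite, smul_zero, Pi.mul_apply]
      refine Finset.sum_congr rfl fun a _ => ?_
      simp)

lemma IsProjMeasurement.functional_apply (hP : IsProjMeasurement P) (f : A → ℂ) :
    hP.functional f = ∑ a, f a • P a := rfl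

lemma IsProjMeasurement.functional_single (hP : IsProjMeasurement P) (a : A) :
    hP.functional (Pi.single a 1) = P a := by
  rw [hP.functional_apply, Finset.sum_eq_single a] <;> simp +contextual

lemma IsProjMeasurement.star_functional (hP : IsProjMeasurement P) (f : A → ℂ) :
    star (hP.functional f) = hP.functional (star f) := by
  simp only [hP.functional_apply, star_sum, star_smul, Pi.star_apply]
  exact Finset.sum_congr rfl fun a _ => by rw [(hP.1 a).2.star_eq]

lemma IsProjMeasurement.functional_indicator (hP : IsProjMeasurement P) (p : A → Prop)
    [DecidablePred p] : hP.functional (fun a => if p a then 1 else 0) = ∑ a with p a, P a := by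
  simp [hP.functional_apply, Finset.sum_filter, ite_smul]

end Measurement

/-! ### Averages over setting vectors -/

section Averages

lemma card_filter_apply_eq {n k : ℕ} (i : Fin n) (s : Fin k) :
    (Finset.univ.filter fun z : Fin n → Fin k => z i = s).card = k ^ (n - 1) := by
  have : (Finset.univ.filter fun z : Fin n → Fin k => z i = s) =
      Fintype.piFinset (Function.update (fun _ => Finset.univ) i ({s} : Finset (Fin k))) := by
    ext z
    simp only [Finset.mem_filter, Finset.mem_univ, true_and, Fintype.mem_piFinset]
    constructor
    · rintro rfl j
      by_cases h : j = i
      · subst h; simp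
      · simp [h]
    · intro h
      simpa using h i
  rw [this, Fintype.card_piFinset, ← Finset.mul_prod_erase _ _ (Finset.mem_univ i)]
  simp only [Function.update_self, Finset.card_singleton, one_mul]
  rw [Finset.prod_congr rfl (g := fun _ => k)]
  · simp
  · intro j hj
    simp [Function.update_of_ne (Finset.ne_of_mem_erase hj)]

lemma card_smul_avgObs {H : Type*} [NormedAddCommGroup H] [InnerProductSpace ℂ H] {n k : ℕ}
    {P : (Fin n → Fin k) → (Fin n → ℤˣ) → H →L[ℂ] H} (s : Fin k) (i : Fin n) :
    ((Finset.univ.filter fun z : Fin n → Fin k => z i = s).card : ℂ) • avgObs P s i =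
      ∑ z : Fin n → Fin k with z i = s, signObs (P z) i := by
  rw [card_filter_apply_eq, avgObs, smul_smul, Nat.cast_pow, mul_inv_cancel₀, one_smul]
  exact pow_ne_zero _ (Nat.cast_ne_zero.2 (Fin.pos s).ne')

end Averages

/-! ### Sign observables and their averages -/

section Observables

variable {H : Type*} [NormedAddCommGroup H] [InnerProductSpace ℂ H] [CompleteSpace H] {n : ℕ}

lemma IsProjMeasurement.signObs_eq {P : (Fin n → ℤˣ) → H →L[ℂ] H} (hP : IsProjMeasurement P)
    (i : Fin n) : signObs P i = hP.functional fun c => (((c i : ℤˣ) : ℤ) : ℂ) := by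
  rw [signObs, ← hP.functional_indicator, ← hP.functional_indicator, ← map_sub]
  congr 1
  ext c
  rcases Int.units_eq_one_or (c i) with h | h <;> simp [h]

lemma IsProjMeasurement.star_signObs {P : (Fin n → ℤˣ) → H →L[ℂ] H} (hP : IsProjMeasurement P)
    (i : Fin n) : star (signObs P i) = signObs P i := by
  rw [hP.signObs_eq, hP.star_functional]
  congr 1
  ext c
  simp

lemma IsProjMeasurement.signObs_mul_self {P : (Fin n → ℤˣ) → H →L[ℂ] H} (hP : IsProjMeasurement P)
    (i : Fin n) : signObs P i * signObs P i = 1 := by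
  rw [hP.signObs_eq, ← map_mul, ← map_one hP.functional]
  congr 1
  ext c
  rcases Int.units_eq_one_or (c i) with h | h <;> simp [h]

lemma IsProjMeasurement.signObs_comm {P : (Fin n → ℤˣ) → H →L[ℂ] H} (hP : IsProjMeasurement P)
    (i j : Fin n) : signObs P i * signObs P j = signObs P j * signObs P i := by
  rw [hP.signObs_eq, hP.signObs_eq, ← map_mul, ← map_mul, mul_comm]

/-- A joint outcome projector is the product of the spectral projectors of the sign observables. -/
lemma IsProjMeasurement.eq_prod_signObs {P : (Fin n → ℤˣ) → H →L[ℂ] H} (hP : IsProjMeasurement P)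
    (c : Fin n → ℤˣ) : P c = ((List.finRange n).map fun k =>
      (1 / 2 : ℂ) • (1 + (((c k : ℤˣ) : ℤ) : ℂ) • signObs P k)).prod := by
  have : (fun k => (1 / 2 : ℂ) • (1 + (((c k : ℤˣ) : ℤ) : ℂ) • signObs P k)) =
      fun k => hP.functional ((1 / 2 : ℂ) • (1 + (((c k : ℤˣ) : ℤ) : ℂ) •
        fun a : Fin n → ℤˣ => (((a k : ℤˣ) : ℤ) : ℂ))) := by
    ext1 k
    rw [map_smul, map_add, map_one, map_smul, ← hP.signObs_eq]
  -- Both sides now lie in the functional calculus, which leaves the scalar identity that the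
  -- indicator of `c` at `a` is `∏ₖ (1 + cₖ aₖ) / 2`.
  rw [this, ← hP.functional_single c, ← Function.comp_def hP.functional, ← List.map_map,
    ← map_list_prod, ← Fin.prod_univ_def]
  congr 1
  ext a
  rw [Finset.prod_apply]
  by_cases h : a = c
  · subst h
    rw [Pi.single_eq_same, eq_comm]
    refine Finset.prod_eq_one fun k _ => ?_
    rcases Int.units_eq_one_or (a k) with h | h <;> simp [h] <;> norm_num
  · rw [Pi.single_eq_of_ne h, eq_comm]
    obtain ⟨k, hk⟩ := Function.ne_iff.1 h
    refine Finset.prod_eq_zero (Finset.mem_univ k) ?_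
    rcases Int.units_eq_one_or (a k) with h | h <;> rcases Int.units_eq_one_or (c k) with h' | h' <;>
      simp_all

variable {k : ℕ} {P : (Fin n → Fin k) → (Fin n → ℤˣ) → H →L[ℂ] H}

lemma star_avgObs (hP : ∀ z, IsProjMeasurement (P z)) (s : Fin k) (i : Fin n) :
    star (avgObs P s i) = avgObs P s i := by
  simp only [avgObs, star_smul, star_sum, (hP _).star_signObs]
  simp

variable {G : Type*} [NormedAddCommGroup G] [InnerProductSpace ℂ G] [CompleteSpace G]
  (φ : (H →L[ℂ] H) →⋆ₐ[ℂ] (G →L[ℂ] G))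

/-- Stated for an arbitrary star homomorphism `φ`, as are the next two, so that one proof serves
both tensor factors. -/
lemma norm_map_apply_of_mul_self {S : H →L[ℂ] H} (hs : star S = S) (h1 : S * S = 1) (v : G) :
    ‖φ S v‖ = ‖v‖ := by
  have : inner ℂ (φ S v) (φ S v) = inner ℂ v v := by
    rw [← ContinuousLinearMap.adjoint_inner_right, ← ContinuousLinearMap.star_eq_adjoint,
      ← map_star, hs, ← mul_apply_eq_comp, ← map_mul, h1, map_one,
      one_apply_eq_self]
  rw [@norm_eq_sqrt_re_inner ℂ, this, ← @norm_eq_sqrt_re_inner ℂ]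

lemma norm_map_avgObs_le (hP : ∀ z, IsProjMeasurement (P z)) (s : Fin k) (i : Fin n) (v : G) :
    ‖φ (avgObs P s i) v‖ ≤ ‖v‖ := by
  set t := Finset.univ.filter fun z : Fin n → Fin k => z i = s with ht
  have h := congr_arg (fun T => ‖φ T v‖) (card_smul_avgObs (P := P) s i)
  simp only [map_smul, map_sum, smul_apply, sum_apply, norm_smul, Complex.norm_natCast] at h
  have hpos : 0 < (t.card : ℝ) := by
    rw [ht, card_filter_apply_eq]
    exact_mod_cast pow_pos (Fin.pos s) _
  have h2 : (t.card : ℝ) * ‖φ (avgObs P s i) v‖ ≤ t.card * ‖v‖ := by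
    rw [h, ← nsmul_eq_mul, ← Finset.sum_const]
    exact norm_sum_le_of_le _ fun z _ =>
      (norm_map_apply_of_mul_self φ ((hP z).star_signObs i) ((hP z).signObs_mul_self i) v).le
  exact le_of_mul_le_mul_left h2 hpos

/-- The average of unit vectors has norm one here, which forces all of them to coincide: the
settings of the other subsystems do not matter on `v`. -/
lemma map_signObs_apply_eq (hP : ∀ z, IsProjMeasurement (P z)) (z : Fin n → Fin k) (i : Fin n)
    {v : G} (hv : ‖v‖ = 1) (h : ‖φ (avgObs P (z i) i) v‖ = 1) :
    φ (signObs (P z) i) v = φ (avgObs P (z i) i) v := by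
  refine eq_average_of_norm_eq_one
    (s := Finset.univ.filter fun w : Fin n → Fin k => w i = z i)
    (v := fun w => φ (signObs (P w) i) v) (fun w _ => ?_) h ?_ z (by simp)
  · rw [norm_map_apply_of_mul_self φ ((hP w).star_signObs i) ((hP w).signObs_mul_self i), hv]
  · rw [← smul_apply, ← map_smul, card_smul_avgObs, map_sum, sum_apply]

end Observables

/-! ### Characters of the group of bit strings -/

section SignCharacter

variable {n : ℕ}

/-- The bicharacter `(-1)^(p · r)` of `(ℤ/2)ⁿ`. -/
def signChar (p r : Fin n → Fin 2) : ℂ := ∏ k, (-1) ^ ((p k : ℕ) * (r k : ℕ))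

lemma signChar_comm (p r : Fin n → Fin 2) : signChar p r = signChar r p := by
  simp only [signChar, mul_comm]

lemma signChar_add (p r s : Fin n → Fin 2) :
    signChar p (r + s) = signChar p r * signChar p s := by
  simp only [signChar, ← Finset.prod_mul_distrib]
  refine Finset.prod_congr rfl fun k _ => ?_
  rw [Pi.add_apply]
  generalize p k = a; generalize r k = b; generalize s k = c
  fin_cases a <;> fin_cases b <;> fin_cases c <;> simp

lemma signChar_single (p : Fin n → Fin 2) (j : Fin n) :
    signChar p (Pi.single j 1) = (-1) ^ (p j : ℕ) := by
  rw [signChar, Finset.prod_eq_single j]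
  · simp
  · intro k _ hk; simp [hk]
  · simp

lemma signChar_mul_self (p r : Fin n → Fin 2) : signChar p r * signChar p r = 1 := by
  rw [signChar, ← Finset.prod_mul_distrib]
  refine Finset.prod_eq_one fun k _ => ?_
  rw [← mul_pow]; simp

lemma star_signChar (p r : Fin n → Fin 2) : star (signChar p r) = signChar p r := by
  simp [signChar]

lemma sum_signChar_mul (p q : Fin n → Fin 2) :
    ∑ r, signChar p r * signChar q r = if p = q then (2 : ℂ) ^ n else 0 := by
  have h : ∀ r, signChar p r * signChar q r =
      ∏ k, (-1 : ℂ) ^ ((p k : ℕ) * (r k : ℕ)) * (-1) ^ ((q k : ℕ) * (r k : ℕ)) := fun r => by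
    rw [signChar, signChar, Finset.prod_mul_distrib]
  simp only [h]
  rw [← Fintype.piFinset_univ,
    Finset.sum_prod_piFinset Finset.univ fun k (b : Fin 2) => (-1 : ℂ) ^ ((p k : ℕ) * (b : ℕ)) *
      (-1) ^ ((q k : ℕ) * (b : ℕ))]
  have h2 : ∀ k, ∑ b : Fin 2, (-1 : ℂ) ^ ((p k : ℕ) * (b : ℕ)) * (-1) ^ ((q k : ℕ) * (b : ℕ)) =
      if p k = q k then 2 else 0 := fun k => by
    generalize p k = a; generalize q k = b
    fin_cases a <;> fin_cases b <;> norm_num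
  simp only [h2]
  split_ifs with hpq
  · subst hpq; simp
  · obtain ⟨k, hk⟩ := Function.ne_iff.1 hpq
    exact Finset.prod_eq_zero (Finset.mem_univ k) (if_neg hk)

lemma Fin2Fun.add_self (s : Fin n → Fin 2) : s + s = 0 := by
  ext k
  rw [Pi.add_apply]
  generalize s k = a
  fin_cases a <;> rfl

lemma Fin2Fun.add_add_cancel (r s : Fin n → Fin 2) : r + s + s = r := by
  rw [add_assoc, Fin2Fun.add_self, add_zero]

end SignCharacter

/-! ### Ordered words in commuting or anticommuting families -/

section Words

variable {n : ℕ} {A : Type*} [Ring A]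

/-- The ordered product of the `a k` with `r k = 1`. -/
def wordPow (a : Fin n → A) (r : Fin n → Fin 2) : A :=
  ((List.finRange n).map fun k => a k ^ (r k : ℕ)).prod

lemma wordPow_single (a : Fin n → A) (j : Fin n) : wordPow a (Pi.single j 1) = a j := by
  rw [wordPow, List.prod_map_eq_pow_single j, List.count_eq_one_of_mem (List.nodup_finRange n)
    (List.mem_finRange j)]
  · simp
  · intro k hk _
    simp [hk]

lemma list_prod_map_mul_of_commute {ι : Type*} {f g : ι → A} (h : ∀ i j, Commute (f i) (g j))
    (l : List ι) : (l.map fun i => f i * g i).prod = (l.map f).prod * (l.map g).prod := by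
  induction l with
  | nil => simp
  | cons i l ih =>
    simp only [List.map_cons, List.prod_cons, ih]
    have : Commute (l.map f).prod (g i) := by
      refine Commute.list_prod_left _ _ fun y hy => ?_
      obtain ⟨j, _, rfl⟩ := List.mem_map.1 hy
      exact h j i
    rw [mul_assoc, mul_assoc, ← mul_assoc (g i), ← this.eq, mul_assoc]

lemma wordPow_add {a : Fin n → A} (hsq : ∀ k, a k * a k = 1) (hc : ∀ j k, Commute (a j) (a k))
    (r s : Fin n → Fin 2) : wordPow a (r + s) = wordPow a r * wordPow a s := by
  rw [wordPow, wordPow, wordPow, ← list_prod_map_mul_of_commute fun i j => (hc i j).pow_pow _ _]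
  congr 2
  ext1 k
  rw [Pi.add_apply]
  generalize r k = b; generalize s k = c
  fin_cases b <;> fin_cases c <;> simp [hsq]

lemma wordPow_commute {a b : Fin n → A} (h : ∀ j k, Commute (a j) (b k)) (s r : Fin n → Fin 2) :
    Commute (wordPow a s) (wordPow b r) := by
  refine Commute.list_prod_left _ _ fun y hy => Commute.list_prod_right _ _ fun z hz => ?_
  obtain ⟨j, _, rfl⟩ := List.mem_map.1 hy
  obtain ⟨k, _, rfl⟩ := List.mem_map.1 hz
  exact (h j k).pow_pow _ _

lemma map_wordPow {B : Type*} [Ring B] (φ : A →+* B) (a : Fin n → A)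
    (r : Fin n → Fin 2) : φ (wordPow a r) = wordPow (fun k => φ (a k)) r := by
  simp [wordPow, map_list_prod, Function.comp_def]

end Words

/-! ### Joint spectral projectors by Fourier inversion -/

section SpectralProjectors

variable {n : ℕ} {A : Type*} [Ring A] [Algebra ℂ A]

/-- The joint spectral projector of a representation `u` of `(ℤ/2)ⁿ` for the character `p`. -/
def specProj (u : (Fin n → Fin 2) → A) (p : Fin n → Fin 2) : A :=
  ((2 : ℂ) ^ n)⁻¹ • ∑ r, signChar p r • u r

lemma mul_specProj {u : (Fin n → Fin 2) → A} (hu : ∀ r s, u (r + s) = u r * u s)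
    (s p : Fin n → Fin 2) : u s * specProj u p = signChar p s • specProj u p := by
  rw [specProj, mul_smul_comm, smul_comm]
  congr 1
  rw [Finset.mul_sum, Finset.smul_sum]
  refine Fintype.sum_equiv (Equiv.addRight s) _ _ fun r => ?_
  rw [Equiv.coe_addRight, mul_smul_comm, ← hu, signChar_add, smul_smul, add_comm s r]
  congr 1
  rw [mul_comm, mul_assoc, signChar_mul_self, mul_one]

lemma specProj_mul_specProj {u : (Fin n → Fin 2) → A} (hu : ∀ r s, u (r + s) = u r * u s)
    (p q : Fin n → Fin 2) :
    specProj u p * specProj u q = if p = q then specProj u p else 0 := by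
  conv_lhs => rw [specProj]
  rw [smul_mul_assoc, Finset.sum_mul]
  simp only [smul_mul_assoc, mul_specProj hu, smul_smul]
  rw [← Finset.sum_smul, sum_signChar_mul, smul_smul]
  split_ifs with h
  · rw [inv_mul_cancel₀ (by positivity), one_smul, h]
  · simp

/-- An element that commutes with `u` up to the character `s` moves the spectral label `p` to `p +
s`, as `σ_x` flips the eigenvalue of `σ_z`. -/
lemma mul_specProj_of_twist {x : A} {u : (Fin n → Fin 2) → A} {s : Fin n → Fin 2}
    (h : ∀ r, x * u r = signChar s r • (u r * x)) (p : Fin n → Fin 2) :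
    x * specProj u p = specProj u (p + s) * x := by
  simp only [specProj, mul_smul_comm, smul_mul_assoc, Finset.mul_sum, Finset.sum_mul, h, smul_smul]
  congr 1
  refine Finset.sum_congr rfl fun r _ => ?_
  rw [signChar_comm (p + s), signChar_add, signChar_comm r, signChar_comm r]

lemma mul_specProj_of_commute {x : A} {u : (Fin n → Fin 2) → A}
    (h : ∀ r, Commute x (u r)) (p : Fin n → Fin 2) : Commute x (specProj u p) := by
  simp only [Commute, SemiconjBy, specProj, mul_smul_comm, smul_mul_assoc, Finset.mul_sum,
    Finset.sum_mul, (h _).eq]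

lemma map_specProj {B : Type*} [Ring B] [Algebra ℂ B] (φ : A →ₐ[ℂ] B) (u : (Fin n → Fin 2) → A)
    (p : Fin n → Fin 2) : φ (specProj u p) = specProj (fun r => φ (u r)) p := by
  simp [specProj, map_sum]

lemma list_prod_map_mul_of_twist {ι : Type*} {f : ι → A} {b : A} {c : ι → ℂ}
    (h : ∀ i, f i * b = c i • (b * f i)) (l : List ι) :
    (l.map f).prod * b = (l.map c).prod • (b * (l.map f).prod) := by
  induction l with
  | nil => simp
  | cons i l ih =>
    simp only [List.map_cons, List.prod_cons]
    rw [mul_assoc, ih, mul_smul_comm, ← mul_assoc, h, smul_mul_assoc, smul_smul, mul_assoc,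
      mul_comm (c i)]

lemma mul_list_prod_map_of_twist {ι : Type*} {f : ι → A} {b : A} {c : ι → ℂ}
    (h : ∀ i, b * f i = c i • (f i * b)) (l : List ι) :
    b * (l.map f).prod = (l.map c).prod • ((l.map f).prod * b) := by
  induction l with
  | nil => simp
  | cons i l ih =>
    simp only [List.map_cons, List.prod_cons]
    rw [← mul_assoc, h, smul_mul_assoc, mul_assoc, ih, mul_smul_comm, smul_smul, mul_assoc]

/-- Only equal indices contribute a sign, one for each `k` with `s k = r k = 1`. This is the Weyl
commutation relation that feeds `mul_specProj_of_twist`. -/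
lemma wordPow_twist {a b : Fin n → A} (hne : ∀ j k, j ≠ k → a j * b k = b k * a j)
    (heq : ∀ j, a j * b j = -(b j * a j)) (s r : Fin n → Fin 2) :
    wordPow a s * wordPow b r = signChar s r • (wordPow b r * wordPow a s) := by
  have h1 : ∀ k j, a k ^ (s k : ℕ) * b j ^ (r j : ℕ) =
      (if k = j then (-1 : ℂ) ^ ((s j : ℕ) * (r j : ℕ)) else 1) •
        (b j ^ (r j : ℕ) * a k ^ (s k : ℕ)) := by
    intro k j
    split_ifs with h
    · subst h
      generalize s k = u; generalize r k = v
      fin_cases u <;> fin_cases v <;> simp [heq]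
    · rw [one_smul]
      exact (show Commute (a k) (b j) from hne k j h).pow_pow _ _
  have h2 : ∀ j, wordPow a s * b j ^ (r j : ℕ) =
      (-1 : ℂ) ^ ((s j : ℕ) * (r j : ℕ)) • (b j ^ (r j : ℕ) * wordPow a s) := by
    intro j
    rw [wordPow, list_prod_map_mul_of_twist (h1 · j), ← Fin.prod_univ_def]
    simp
  conv_lhs => rw [wordPow.eq_def b]
  rw [mul_list_prod_map_of_twist h2, ← Fin.prod_univ_def]
  rfl

end SpectralProjectors

/-! ### Pauli relations, chirality and the swap operators -/

section PauliRelations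

variable {n : ℕ} {A : Type*} [Ring A]

/-- Families `c 0, c 1, c 2` of `n` involutions each, anticommuting at the same index and commuting
at different ones, in the role of `Z, X, Y`. -/
structure PauliRelations (c : Fin 3 → Fin n → A) : Prop where
  mul_self : ∀ s i, c s i * c s i = 1
  anticomm : ∀ s t i, s ≠ t → c s i * c t i = -(c t i * c s i)
  comm : ∀ s t i j, i ≠ j → c s i * c t j = c t j * c s i

variable {c : Fin 3 → Fin n → A}

/-- Moving `X` or `Z` through `XZY` costs two sign changes or none, never a single net sign; the
square reduces to `ZYZY = -1`. -/
lemma PauliRelations.triple_relations (hc : PauliRelations c) (i : Fin n) :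
    let t := c 1 i * c 0 i * c 2 i
    t * c 1 i = c 1 i * t ∧ t * c 0 i = c 0 i * t ∧ t * t = -1 := by
  have zx := hc.anticomm 0 1 i (by decide)
  have yx := hc.anticomm 2 1 i (by decide)
  have yz := hc.anticomm 2 0 i (by decide)
  have zx' : ∀ w, c 0 i * (c 1 i * w) = -(c 1 i * (c 0 i * w)) := fun w => by
    rw [← mul_assoc, zx, neg_mul, mul_assoc]
  have yx' : ∀ w, c 2 i * (c 1 i * w) = -(c 1 i * (c 2 i * w)) := fun w => by
    rw [← mul_assoc, yx, neg_mul, mul_assoc]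
  have yz' : ∀ w, c 2 i * (c 0 i * w) = -(c 0 i * (c 2 i * w)) := fun w => by
    rw [← mul_assoc, yz, neg_mul, mul_assoc]
  have sq : ∀ s w, c s i * (c s i * w) = w := fun s w => by rw [← mul_assoc, hc.mul_self, one_mul]
  intro t
  refine ⟨?_, ?_, ?_⟩ <;>
    simp only [t, mul_assoc, yx, yz, zx', yx', yz', sq, hc.mul_self, mul_neg, neg_neg, mul_one]

lemma PauliRelations.wordPow_mul_self_add (hc : PauliRelations c) (s : Fin 3)
    (p q : Fin n → Fin 2) : wordPow (c s) (p + q) = wordPow (c s) p * wordPow (c s) q := by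
  refine wordPow_add (hc.mul_self s) (fun j k => ?_) p q
  by_cases h : j = k
  · rw [h]
  · exact hc.comm s s j k h

variable [Algebra ℂ A]

/-- The operator `i X Z Y` that distinguishes the two inequivalent representations of the
Pauli relations. -/
def chirality (c : Fin 3 → Fin n → A) (i : Fin n) : A := Complex.I • (c 1 i * c 0 i * c 2 i)

/-- Since `(XZ)² = -1`, multiplying `J = iXZY` by `iXZ` returns `Y`. The swap operators involve only
`Z`, `X`, `J`, and this identity carries their behaviour over to `Y`. -/
lemma PauliRelations.eq_smul_chirality (hc : PauliRelations c) (i : Fin n) :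
    c 2 i = Complex.I • (c 1 i * c 0 i * chirality c i) := by
  have h1 := hc.anticomm 1 0 i (by decide)
  rw [chirality, mul_smul_comm, smul_smul, Complex.I_mul_I]
  have h : c 1 i * c 0 i * (c 1 i * c 0 i) = -1 := by
    rw [mul_assoc, ← mul_assoc (c 0 i), ← neg_eq_iff_eq_neg.2 h1, neg_mul, mul_neg, mul_assoc,
      hc.mul_self, mul_one, hc.mul_self]
  rw [← mul_assoc, h]
  simp

lemma PauliRelations.chirality_commute (hc : PauliRelations c) (i j : Fin n) :
    Commute (chirality c i) (c 0 j) ∧ Commute (chirality c i) (c 1 j) ∧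
      Commute (chirality c i) (chirality c j) := by
  obtain ⟨hx, hz, _⟩ := hc.triple_relations i
  by_cases h : i = j
  · subst h
    exact ⟨Commute.smul_left hz _, Commute.smul_left hx _, Commute.refl _⟩
  · have hcomm : ∀ t, Commute (c 1 i * c 0 i * c 2 i) (c t j) := fun t =>
      ((show Commute _ _ from hc.comm 1 t i j h).mul_left (hc.comm 0 t i j h)).mul_left
        (hc.comm 2 t i j h)
    exact ⟨(hcomm 0).smul_left _, (hcomm 1).smul_left _,
      ((((hcomm 1).mul_right (hcomm 0)).mul_right (hcomm 2)).smul_right _).smul_left _⟩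

lemma PauliRelations.chirality_mul_self (hc : PauliRelations c) (i : Fin n) :
    chirality c i * chirality c i = 1 := by
  rw [chirality, smul_mul_smul_comm, Complex.I_mul_I, (hc.triple_relations i).2.2]
  simp

/-- The Kraus operators of the swap isometry: the component that leaves the extraction register in
`p` and the control register in `q`. -/
def swapOp (z x j : (Fin n → Fin 2) → A) (p q : Fin n → Fin 2) : A :=
  x p * specProj z p * specProj j q

/-- The Kraus operators `swapOp` with the factors in the opposite order. -/
def swapOpRev (z x j : (Fin n → Fin 2) → A) (p q : Fin n → Fin 2) : A :=
  specProj j q * specProj z p * x p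

lemma PauliRelations.wordPow_chirality_add (hc : PauliRelations c) (p q : Fin n → Fin 2) :
    wordPow (chirality c) (p + q) = wordPow (chirality c) p * wordPow (chirality c) q :=
  wordPow_add hc.chirality_mul_self (fun i j => (hc.chirality_commute i j).2.2) p q

lemma PauliRelations.wordPow_one_mul_specProj (hc : PauliRelations c) (s p : Fin n → Fin 2) :
    wordPow (c 1) s * specProj (wordPow (c 0)) p =
      specProj (wordPow (c 0)) (p + s) * wordPow (c 1) s :=
  mul_specProj_of_twist (fun r => wordPow_twist (fun j k h => hc.comm 1 0 j k h)
    (fun j => hc.anticomm 1 0 j (by decide)) s r) p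

lemma PauliRelations.commute_specProj_chirality (hc : PauliRelations c) (s q : Fin n → Fin 2) :
    Commute (wordPow (c 0) s) (specProj (wordPow (chirality c)) q) ∧
      Commute (wordPow (c 1) s) (specProj (wordPow (chirality c)) q) :=
  ⟨mul_specProj_of_commute
      (fun r => wordPow_commute (fun j k => (hc.chirality_commute k j).1.symm) s r) q,
    mul_specProj_of_commute
      (fun r => wordPow_commute (fun j k => (hc.chirality_commute k j).2.1.symm) s r) q⟩

/-- The swap Kraus operators of a family satisfying the Pauli relations. -/
abbrev PauliRelations.swap (_ : PauliRelations c) (p q : Fin n → Fin 2) : A :=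
  swapOp (wordPow (c 0)) (wordPow (c 1)) (wordPow (chirality c)) p q

lemma specProj_mul {u : (Fin n → Fin 2) → A} (hu : ∀ r s, u (r + s) = u r * u s)
    (s p : Fin n → Fin 2) : specProj u p * u s = signChar p s • specProj u p := by
  rw [← mul_specProj hu]
  refine (mul_specProj_of_commute (fun r => ?_) p).eq.symm
  rw [Commute, SemiconjBy, ← hu, ← hu, add_comm]

/-- This and the next two lemmas are the algebraic content of the swap: right multiplication by `Z`,
`X`, `J` only changes the labels `p, q` or produces a sign read from them. -/
lemma PauliRelations.swap_mul_zero (hc : PauliRelations c) (p q : Fin n → Fin 2) (k : Fin n) :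
    hc.swap p q * c 0 k = (-1 : ℂ) ^ (p k : ℕ) • hc.swap p q := by
  rw [← wordPow_single (c 0) k, swap, swapOp, mul_assoc,
    ← (hc.commute_specProj_chirality _ q).1.eq, ← mul_assoc, mul_assoc (wordPow _ p),
    specProj_mul (hc.wordPow_mul_self_add 0), signChar_single, mul_smul_comm, smul_mul_assoc]

lemma PauliRelations.swap_mul_one (hc : PauliRelations c) (p q : Fin n → Fin 2) (k : Fin n) :
    hc.swap p q * c 1 k = hc.swap (p + Pi.single k 1) q := by
  conv_lhs => rw [← wordPow_single (c 1) k]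
  rw [swap, swapOp, mul_assoc,
    ← (hc.commute_specProj_chirality _ q).2.eq, ← mul_assoc, mul_assoc (wordPow _ p),
    ← Fin2Fun.add_add_cancel p (Pi.single k 1), ← hc.wordPow_one_mul_specProj,
    Fin2Fun.add_add_cancel, ← mul_assoc, ← hc.wordPow_mul_self_add, swap, swapOp]

lemma PauliRelations.swap_mul_chirality (hc : PauliRelations c) (p q : Fin n → Fin 2)
    (k : Fin n) : hc.swap p q * chirality c k = (-1 : ℂ) ^ (q k : ℕ) • hc.swap p q := by
  rw [← wordPow_single (chirality c) k, swap, swapOp, mul_assoc,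
    specProj_mul hc.wordPow_chirality_add, signChar_single, mul_smul_comm]

/-- Orthogonality of the spectral projectors kills unequal labels. For equal ones, moving `X^p`
through the `Z`-projector shifts its label from `p` to `p + p = 0`, and the two copies of `X^p`
cancel. That the result no longer depends on `p` is what makes the extracted state maximally
entangled. -/
lemma PauliRelations.swap_mul_rev (hc : PauliRelations c) (p q p' q' : Fin n → Fin 2) :
    hc.swap p q * swapOpRev (wordPow (c 0)) (wordPow (c 1)) (wordPow (chirality c)) p' q' =
      if p = p' ∧ q = q' then specProj (wordPow (chirality c)) q * specProj (wordPow (c 0)) 0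
      else 0 := by
  have e1 : hc.swap p q * swapOpRev (wordPow (c 0)) (wordPow (c 1)) (wordPow (chirality c)) p' q' =
      wordPow (c 1) p * specProj (wordPow (c 0)) p *
        (specProj (wordPow (chirality c)) q * specProj (wordPow (chirality c)) q') *
        specProj (wordPow (c 0)) p' * wordPow (c 1) p' := by
    rw [swap, swapOp, swapOpRev]; simp only [mul_assoc]
  have hjz : Commute (specProj (wordPow (c 0)) p') (specProj (wordPow (chirality c)) q) :=
    (mul_specProj_of_commute (fun r => (hc.commute_specProj_chirality r q).1.symm) p').symm
  rw [e1, specProj_mul_specProj hc.wordPow_chirality_add]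
  by_cases hq : q = q'
  · rw [if_pos hq, mul_assoc _ _ (specProj (wordPow (c 0)) p'), ← hjz.eq, ← mul_assoc,
      mul_assoc (wordPow _ p), specProj_mul_specProj (hc.wordPow_mul_self_add 0)]
    by_cases hp : p = p'
    · subst hp
      have hxx : wordPow (c 1) p * wordPow (c 1) p = 1 := by
        rw [← hc.wordPow_mul_self_add, Fin2Fun.add_self]; simp [wordPow]
      rw [if_pos rfl, if_pos ⟨rfl, hq⟩, hc.wordPow_one_mul_specProj, Fin2Fun.add_self,
        mul_assoc, mul_assoc, ← (hc.commute_specProj_chirality p q).2.eq, ← mul_assoc (wordPow _ p),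
        hxx, one_mul]
      exact mul_specProj_of_commute (fun r => (hc.commute_specProj_chirality r q).1.symm) 0 |>.eq.symm
    · rw [if_neg hp, if_neg fun h => hp h.1]; simp
  · rw [if_neg hq, if_neg fun h => hq h.2]; simp

end PauliRelations

/-! ### Tensor products of single-qubit matrices -/

section TensorMat

variable {n : ℕ}

lemma tensorMat_mul (M N : Fin n → Matrix (Fin 2) (Fin 2) ℂ) :
    tensorMat M * tensorMat N = tensorMat fun k => M k * N k := by
  ext r s
  simp only [tensorMat, Matrix.mul_apply, Matrix.of_apply, ← Finset.prod_mul_distrib]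
  rw [← Fintype.piFinset_univ,
    Finset.sum_prod_piFinset Finset.univ fun k (b : Fin 2) => M k (r k) b * N k b (s k)]

lemma tensorMat_one : tensorMat (fun _ : Fin n => 1) = 1 := by
  ext r s
  simp only [tensorMat, Matrix.of_apply, Matrix.one_apply, Finset.prod_ite_zero, funext_iff]
  simp

lemma tensorMat_transpose (M : Fin n → Matrix (Fin 2) (Fin 2) ℂ) :
    (tensorMat M)ᵀ = tensorMat fun k => (M k)ᵀ := rfl

lemma site_apply (j : Fin n) (M : Matrix (Fin 2) (Fin 2) ℂ) (r s : Fin n → Fin 2) :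
    site j M r s = M (r j) (s j) * ∏ k ∈ Finset.univ.erase j, (1 : Matrix _ _ ℂ) (r k) (s k) := by
  rw [site, tensorMat, Matrix.of_apply, ← Finset.mul_prod_erase _ _ (Finset.mem_univ j),
    Function.update_self]
  congr 1
  refine Finset.prod_congr rfl fun k hk => ?_
  rw [Function.update_of_ne (Finset.ne_of_mem_erase hk)]

lemma site_add (j : Fin n) (M N : Matrix (Fin 2) (Fin 2) ℂ) :
    site j (M + N) = site j M + site j N := by
  ext r s
  simp only [site_apply, Matrix.add_apply, add_mul]

lemma site_smul (j : Fin n) (c : ℂ) (M : Matrix (Fin 2) (Fin 2) ℂ) :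
    site j (c • M) = c • site j M := by
  ext r s
  simp only [site_apply, Matrix.smul_apply, smul_mul_assoc]

lemma site_one (j : Fin n) : site j 1 = 1 := by
  rw [site, ← tensorMat_one]
  congr 1
  exact Function.update_eq_self j _

lemma site_mul_tensorMat (j : Fin n) (M : Matrix (Fin 2) (Fin 2) ℂ)
    (N : Fin n → Matrix (Fin 2) (Fin 2) ℂ) :
    site j M * tensorMat N = tensorMat (Function.update N j (M * N j)) := by
  rw [site, tensorMat_mul]
  congr 1
  ext1 k
  by_cases h : k = j
  · subst h; simp
  · simp [h]

lemma site_mul (j : Fin n) (M N : Matrix (Fin 2) (Fin 2) ℂ) :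
    site j (M * N) = site j M * site j N := by
  rw [site.eq_def j N, site_mul_tensorMat, site]
  simp

lemma list_prod_site (N : Fin n → Matrix (Fin 2) (Fin 2) ℂ) (l : List (Fin n)) (hl : l.Nodup) :
    (l.map fun k => site k (N k)).prod = tensorMat fun k => if k ∈ l then N k else 1 := by
  induction l with
  | nil => simp [tensorMat_one]
  | cons i l ih =>
    rw [List.nodup_cons] at hl
    rw [List.map_cons, List.prod_cons, ih hl.2, site_mul_tensorMat]
    congr 1
    ext1 k
    by_cases h : k = i
    · subst h; simp [hl.1]
    · simp [h]

/-- Puts a tensor product in the same ordered form as `IsProjMeasurement.eq_prod_signObs`, so that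
the two can be compared factor by factor. -/
lemma tensorMat_eq_list_prod (N : Fin n → Matrix (Fin 2) (Fin 2) ℂ) :
    tensorMat N = ((List.finRange n).map fun k => site k (N k)).prod := by
  rw [list_prod_site _ _ (List.nodup_finRange n)]
  simp

lemma site_pauli_zero (j : Fin n) (r s : Fin n → Fin 2) :
    site j (pauli 0) r s = if r = s then (-1) ^ (s j : ℕ) else 0 := by
  have h : ∀ k, Function.update (fun _ => (1 : Matrix (Fin 2) (Fin 2) ℂ)) j (pauli 0) k (r k) (s k) =
      if r k = s k then (if k = j then (-1) ^ (s k : ℕ) else 1) else 0 := by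
    intro k
    by_cases h : k = j
    · subst h
      rw [Function.update_self, if_pos rfl]
      generalize r k = a; generalize s k = b
      fin_cases a <;> fin_cases b <;> simp [pauli]
    · rw [Function.update_of_ne h, if_neg h, Matrix.one_apply]
  simp only [site, tensorMat, Matrix.of_apply, h, Finset.prod_ite_zero, funext_iff]
  simp

lemma site_pauli_one (j : Fin n) (r s : Fin n → Fin 2) :
    site j (pauli 1) r s = if r = s + Pi.single j 1 then 1 else 0 := by
  have h : ∀ k, Function.update (fun _ => (1 : Matrix (Fin 2) (Fin 2) ℂ)) j (pauli 1) k (r k) (s k) =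
      if r k = (s + Pi.single j 1 : Fin n → Fin 2) k then 1 else 0 := by
    intro k
    rw [Pi.add_apply]
    by_cases h : k = j
    · subst h
      rw [Function.update_self, Pi.single_eq_same]
      generalize r k = a; generalize s k = b
      fin_cases a <;> fin_cases b <;> simp [pauli]
    · rw [Function.update_of_ne h, Pi.single_eq_of_ne h, add_zero, Matrix.one_apply]
  simp only [site, tensorMat, Matrix.of_apply, h, Finset.prod_ite_zero, funext_iff]
  simp

lemma pauli_two : pauli 2 = Complex.I • (pauli 1 * pauli 0) := by
  ext a b
  fin_cases a <;> fin_cases b <;> simp [pauli]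

/-- The matrix of the Hadamard gate on every qubit. -/
def hadamard (n : ℕ) : Matrix (Fin n → Fin 2) (Fin n → Fin 2) ℂ :=
  Matrix.of fun p r => (((√2 : ℝ) : ℂ) ^ n)⁻¹ * signChar p r

lemma sqrt_two_pow_mul_self (n : ℕ) :
    (((√2 : ℝ) : ℂ) ^ n)⁻¹ * (((√2 : ℝ) : ℂ) ^ n)⁻¹ = ((2 : ℂ) ^ n)⁻¹ := by
  rw [← mul_inv, ← mul_pow, ← Complex.ofReal_mul, Real.mul_self_sqrt (by norm_num)]
  simp

lemma hadamard_conjTranspose (n : ℕ) : (hadamard n)ᴴ = hadamard n := by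
  ext p r
  rw [Matrix.conjTranspose_apply, hadamard, Matrix.of_apply, Matrix.of_apply, star_mul',
    star_signChar, signChar_comm]
  simp

lemma hadamard_mul_self (n : ℕ) : hadamard n * hadamard n = 1 := by
  ext p r
  rw [Matrix.mul_apply]
  have h : ∀ s, hadamard n p s * hadamard n s r =
      ((2 : ℂ) ^ n)⁻¹ * (signChar p s * signChar r s) := fun s => by
    rw [hadamard, Matrix.of_apply, Matrix.of_apply, ← sqrt_two_pow_mul_self, signChar_comm s r]
    ring
  simp only [h, ← Finset.mul_sum, sum_signChar_mul, Matrix.one_apply]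
  split_ifs <;> simp

end TensorMat

/-! ### Register operators and the swap circuit -/

section Registers

variable {n : ℕ} {E : Type*} [NormedAddCommGroup E] [InnerProductSpace ℂ E]

lemma bra_ket (q r : Fin n → Fin 2) (v : E) : bra q (ket r v) = if q = r then v else 0 := by
  change (Pi.single r v : (Fin n → Fin 2) → E) q = _
  rw [Pi.single_apply]

lemma bra_comp_ket (q r : Fin n → Fin 2) :
    (bra q : Reg n E →L[ℂ] E) ∘L ket r = if q = r then 1 else 0 := by
  ext v
  rw [ContinuousLinearMap.comp_apply, bra_ket]
  split_ifs <;> rfl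

lemma Reg.ext {x y : Reg n E} (h : ∀ q, bra q x = bra q y) : x = y := by
  ext q
  exact h q

lemma bra_regOp (M : Matrix (Fin n → Fin 2) (Fin n → Fin 2) ℂ) (r : Fin n → Fin 2)
    (x : Reg n E) : bra r (regOp M x) = ∑ s, M r s • bra s x := by
  simp only [regOp, sum_apply, smul_apply, ContinuousLinearMap.comp_apply, map_sum, map_smul,
    bra_ket, smul_ite, smul_zero]
  rw [Finset.sum_eq_single r]
  · simp
  · intro b _ hb; simp [hb.symm]
  · simp

lemma regOp_mul (M N : Matrix (Fin n → Fin 2) (Fin n → Fin 2) ℂ) :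
    (regOp (M * N) : Reg n E →L[ℂ] Reg n E) = regOp M * regOp N := by
  ext1 x
  refine Reg.ext fun q => ?_
  rw [mul_apply_eq_comp]
  simp only [bra_regOp, Matrix.mul_apply, Finset.sum_smul, Finset.smul_sum, smul_smul]
  exact Finset.sum_comm

lemma regOp_one : (regOp 1 : Reg n E →L[ℂ] Reg n E) = 1 := by
  ext1 x
  refine Reg.ext fun q => ?_
  simp [bra_regOp, Matrix.one_apply, ite_smul]

lemma regOp_add (M N : Matrix (Fin n → Fin 2) (Fin n → Fin 2) ℂ) :
    (regOp (M + N) : Reg n E →L[ℂ] Reg n E) = regOp M + regOp N := by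
  ext1 x
  refine Reg.ext fun q => ?_
  simp [bra_regOp, add_smul, Finset.sum_add_distrib]

lemma regOp_smul (c : ℂ) (M : Matrix (Fin n → Fin 2) (Fin n → Fin 2) ℂ) :
    (regOp (c • M) : Reg n E →L[ℂ] Reg n E) = c • regOp M := by
  ext1 x
  refine Reg.ext fun q => ?_
  simp [bra_regOp, Finset.smul_sum, smul_smul]

lemma regOp_ket (M : Matrix (Fin n → Fin 2) (Fin n → Fin 2) ℂ) (s : Fin n → Fin 2) (v : E) :
    regOp M (ket s v) = ∑ r, M r s • ket r v := by
  refine Reg.ext fun q => ?_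
  simp [bra_regOp, map_sum, bra_ket, smul_ite]

lemma regOp_site_pauli_zero_ket (j : Fin n) (s : Fin n → Fin 2) (v : E) :
    regOp (site j (pauli 0)) (ket s v) = (-1 : ℂ) ^ (s j : ℕ) • ket s v := by
  simp [regOp_ket, site_pauli_zero, ite_smul]

lemma regOp_site_pauli_one_ket (j : Fin n) (s : Fin n → Fin 2) (v : E) :
    regOp (site j (pauli 1)) (ket s v) = ket (s + Pi.single j 1) v := by
  simp [regOp_ket, site_pauli_one, ite_smul]

/-- `∑ r, |r⟩⟨r| ⊗ W r`: the operator `W`, controlled by the register. -/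
def ctrlOp (W : (Fin n → Fin 2) → E →L[ℂ] E) : Reg n E →L[ℂ] Reg n E :=
  ∑ r, ket r ∘L W r ∘L bra r

lemma bra_ctrlOp (W : (Fin n → Fin 2) → E →L[ℂ] E) (q : Fin n → Fin 2) (x : Reg n E) :
    bra q (ctrlOp W x) = W q (bra q x) := by
  simp [ctrlOp, sum_apply, map_sum, bra_ket]

lemma ctrlOp_mul (V W : (Fin n → Fin 2) → E →L[ℂ] E) : ctrlOp V * ctrlOp W = ctrlOp (V * W) := by
  ext1 x
  refine Reg.ext fun q => ?_
  simp [bra_ctrlOp, mul_apply_eq_comp]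

lemma ctrlOp_one : ctrlOp (1 : (Fin n → Fin 2) → E →L[ℂ] E) = 1 := by
  ext1 x
  refine Reg.ext fun q => ?_
  simp [bra_ctrlOp]

lemma ctrlOp_ket (W : (Fin n → Fin 2) → E →L[ℂ] E) (q : Fin n → Fin 2) (v : E) :
    ctrlOp W (ket q v) = ket q (W q v) := by
  refine Reg.ext fun r => ?_
  rw [bra_ctrlOp, bra_ket, bra_ket]
  split_ifs with h
  · rw [h]
  · simp

lemma regLift_eq_ctrlOp (T : E →L[ℂ] E) : (regLift T : Reg n E →L[ℂ] Reg n E) = ctrlOp fun _ => T :=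
  rfl

lemma regLift_ket (T : E →L[ℂ] E) (q : Fin n → Fin 2) (v : E) :
    regLift T (ket q v) = ket q (T v) := by
  rw [regLift_eq_ctrlOp, ctrlOp_ket]

lemma regOp_regLift_comm (M : Matrix (Fin n → Fin 2) (Fin n → Fin 2) ℂ) (T : E →L[ℂ] E) :
    (regOp M : Reg n E →L[ℂ] Reg n E) * regLift T = regLift T * regOp M := by
  ext1 x
  refine Reg.ext fun q => ?_
  simp [regLift_eq_ctrlOp, bra_ctrlOp, bra_regOp, mul_apply_eq_comp, map_sum]

lemma inner_eq_sum_bra (x y : Reg n E) : inner ℂ x y = ∑ q, inner ℂ (bra q x) (bra q y) :=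
  PiLp.inner_apply x y

/-- The phase-estimation circuit: Hadamard gates on the register, the controlled operators `a`,
Hadamard gates. -/
def phaseGate (a : (Fin n → Fin 2) → E →L[ℂ] E) : Reg n E →L[ℂ] Reg n E :=
  regOp (hadamard n) * ctrlOp a * regOp (hadamard n)

/-- The first Hadamard layer prepares the uniform superposition, the controlled operators write `a
r`, and the second layer is the Fourier sum defining `specProj`. No relation among the `a r` is
needed. -/
lemma phaseGate_ket_zero (a : (Fin n → Fin 2) → E →L[ℂ] E) (v : E) :
    phaseGate a (ket 0 v) = ∑ p, ket p (specProj a p v) := by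
  refine Reg.ext fun p => ?_
  have h0 : ∀ s, hadamard n s 0 = (((√2 : ℝ) : ℂ) ^ n)⁻¹ := fun s => by
    simp [hadamard, signChar]
  rw [phaseGate, mul_apply_eq_comp, mul_apply_eq_comp, bra_regOp, map_sum]
  simp only [bra_ctrlOp, bra_regOp, bra_ket]
  simp only [smul_ite, smul_zero, Finset.sum_ite_eq', Finset.sum_ite_eq, Finset.mem_univ, if_true,
    h0, map_smul, smul_smul, specProj, smul_apply, sum_apply, Finset.smul_sum]
  refine Finset.sum_congr rfl fun r _ => ?_
  rw [hadamard, Matrix.of_apply, mul_right_comm, sqrt_two_pow_mul_self]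

lemma specProj_regLift_ket (a : (Fin n → Fin 2) → E →L[ℂ] E) (p q : Fin n → Fin 2) (v : E) :
    specProj (fun r => (regLift (a r) : Reg n E →L[ℂ] Reg n E)) p (ket q v) =
      ket q (specProj a p v) := by
  simp only [specProj, smul_apply, sum_apply, regLift_ket, map_smul, map_sum]

variable [CompleteSpace E]

lemma adjoint_ket (q : Fin n → Fin 2) :
    (ket q : E →L[ℂ] Reg n E).adjoint = bra q := by
  symm
  rw [ContinuousLinearMap.eq_adjoint_iff]
  intro x v
  rw [inner_eq_sum_bra, Finset.sum_eq_single q]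
  · rw [bra_ket, if_pos rfl]
  · intro r _ hr; rw [bra_ket, if_neg hr, inner_zero_right]
  · simp

lemma star_regOp (M : Matrix (Fin n → Fin 2) (Fin n → Fin 2) ℂ) :
    star (regOp M : Reg n E →L[ℂ] Reg n E) = regOp Mᴴ := by
  rw [ContinuousLinearMap.star_eq_adjoint, eq_comm, ContinuousLinearMap.eq_adjoint_iff]
  intro x y
  simp only [inner_eq_sum_bra, bra_regOp, sum_inner, inner_sum, inner_smul_left, inner_smul_right,
    Matrix.conjTranspose_apply, RCLike.star_def, RingHomCompTriple.comp_apply, RingHom.id_apply]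
  exact Finset.sum_comm

lemma star_ctrlOp (W : (Fin n → Fin 2) → E →L[ℂ] E) : star (ctrlOp W) = ctrlOp (star W) := by
  rw [ContinuousLinearMap.star_eq_adjoint, eq_comm, ContinuousLinearMap.eq_adjoint_iff]
  intro x y
  simp only [inner_eq_sum_bra, bra_ctrlOp, Pi.star_apply, ContinuousLinearMap.star_eq_adjoint,
    ContinuousLinearMap.adjoint_inner_left]

lemma ctrlOp_mem_unitary {W : (Fin n → Fin 2) → E →L[ℂ] E}
    (hW : ∀ r, W r ∈ unitary (E →L[ℂ] E)) : ctrlOp W ∈ unitary (Reg n E →L[ℂ] Reg n E) := by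
  rw [Unitary.mem_iff, star_ctrlOp, ctrlOp_mul, ctrlOp_mul, ← ctrlOp_one]
  exact ⟨congr_arg _ (funext fun r => Unitary.star_mul_self_of_mem (hW r)),
    congr_arg _ (funext fun r => Unitary.mul_star_self_of_mem (hW r))⟩

lemma regOp_hadamard_mem_unitary :
    regOp (hadamard n) ∈ unitary (Reg n E →L[ℂ] Reg n E) := by
  rw [Unitary.mem_iff, star_regOp, hadamard_conjTranspose, ← regOp_mul, hadamard_mul_self, regOp_one]
  exact ⟨rfl, rfl⟩

lemma phaseGate_mem_unitary {a : (Fin n → Fin 2) → E →L[ℂ] E}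
    (ha : ∀ r, a r ∈ unitary (E →L[ℂ] E)) : phaseGate a ∈ unitary (Reg n E →L[ℂ] Reg n E) :=
  mul_mem (mul_mem regOp_hadamard_mem_unitary (ctrlOp_mem_unitary ha)) regOp_hadamard_mem_unitary

/-- The swap circuit: the local unitary that extracts `n` qubits and `n` control bits. -/
lemma exists_swapUnitary {z x j : (Fin n → Fin 2) → E →L[ℂ] E}
    (hz : ∀ r, z r ∈ unitary (E →L[ℂ] E)) (hx : ∀ r, x r ∈ unitary (E →L[ℂ] E))
    (hj : ∀ r, j r ∈ unitary (E →L[ℂ] E)) :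
    ∃ U : Reg n (Reg n E) ≃ₗᵢ[ℂ] Reg n (Reg n E),
      (U : Reg n (Reg n E) →L[ℂ] Reg n (Reg n E)) ∘L (ket 0 ∘L ket 0) =
        ∑ s : (Fin n → Fin 2) × (Fin n → Fin 2), (ket s.1 ∘L ket s.2) ∘L swapOp z x j s.1 s.2 := by
  have lift : ∀ {T : E →L[ℂ] E}, T ∈ unitary (E →L[ℂ] E) →
      (regLift T : Reg n E →L[ℂ] Reg n E) ∈ unitary _ := fun hT => ctrlOp_mem_unitary fun _ => hT
  -- Read from right to left: phase estimation of `j` on the inner (control) register, of `z` on the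
  -- outer (extraction) register, then `x p` controlled by the latter. Only unitarity of the single
  -- operators enters.
  have hV : ctrlOp (fun p => (regLift (x p) : Reg n E →L[ℂ] Reg n E)) *
      phaseGate (fun r => regLift (z r)) * regLift (phaseGate j) ∈
        unitary (Reg n (Reg n E) →L[ℂ] Reg n (Reg n E)) :=
    mul_mem (mul_mem (ctrlOp_mem_unitary fun p => lift (hx p))
      (phaseGate_mem_unitary fun r => lift (hz r)))
      (ctrlOp_mem_unitary fun _ => phaseGate_mem_unitary hj)
  refine ⟨Unitary.linearIsometryEquiv ⟨_, hV⟩, ?_⟩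
  rw [Unitary.coe_linearIsometryEquiv_apply]
  ext1 v
  simp only [ContinuousLinearMap.comp_apply, mul_apply_eq_comp, regLift_ket, phaseGate_ket_zero,
    map_sum, specProj_regLift_ket, ctrlOp_ket, sum_apply, swapOp, Fintype.sum_prod_type]
  exact Finset.sum_comm

end Registers

/-! ### Unitary replacement by the Cayley transform -/

section Cayley

variable {H : Type*} [NormedAddCommGroup H] [InnerProductSpace ℂ H] [CompleteSpace H]

/-- The Cayley transform of a selfadjoint operator. -/
lemma exists_cayley {a : H →L[ℂ] H} (ha : star a = a) :
    ∃ w ∈ unitary (H →L[ℂ] H), IsUnit (a + Complex.I • 1) ∧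
      (a + Complex.I • 1) * w = Complex.I • a + 1 := by
  -- Otherwise `-i` would lie in the real spectrum of `a`.
  have hu : IsUnit (a + Complex.I • 1) := by
    by_contra h
    have := IsSelfAdjoint.mem_spectrum_eq_re (show IsSelfAdjoint a from ha)
      (z := -Complex.I) (spectrum.mem_iff.2 fun h' => h ?_)
    · simp at this
    · rw [Algebra.algebraMap_eq_smul_one, neg_smul, ← neg_add', IsUnit.neg_iff, add_comm] at h'
      exact h'
  obtain ⟨d, hd⟩ := hu
  have sd : star (d : H →L[ℂ] H) = a - Complex.I • 1 := by
    rw [hd, star_add, star_smul, ha]; simp [sub_eq_add_neg]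
  have hc : Commute (d : H →L[ℂ] H) (star d : (H →L[ℂ] H)ˣ) := by
    rw [Units.coe_star, sd, hd]
    have h1 : Commute a (Complex.I • (1 : H →L[ℂ] H)) := (Commute.one_right a).smul_right _
    exact ((Commute.refl a).sub_right h1).add_left
      (h1.symm.sub_right (Commute.refl _))
  have hc1 : Commute (↑d⁻¹ : H →L[ℂ] H) (star d : (H →L[ℂ] H)ˣ) := hc.units_inv_left
  -- The transform is `i(a - i)(a + i)⁻¹`, normalized by the factor `i` so that the values `±1` of
  -- `a` are kept.
  refine ⟨Complex.I • ((star d : (H →L[ℂ] H)ˣ) * ↑d⁻¹ : H →L[ℂ] H), ?_, ⟨d, hd⟩, ?_⟩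
  · have hs : star (Complex.I • ((star d : (H →L[ℂ] H)ˣ) * ↑d⁻¹ : H →L[ℂ] H)) =
        (-Complex.I) • ((↑(star d)⁻¹ : H →L[ℂ] H) * d) := by
      rw [star_smul, star_mul, ← Units.coe_star_inv, Units.coe_star, star_star]; simp
    rw [Unitary.mem_iff, hs, smul_mul_smul_comm, smul_mul_smul_comm]
    constructor
    · rw [mul_assoc, ← mul_assoc (d : H →L[ℂ] H), hc.eq, mul_assoc, Units.mul_inv, mul_one,
        Units.inv_mul]
      simp
    · rw [← hc1.eq, mul_assoc, ← mul_assoc (↑(star d) : H →L[ℂ] H), Units.mul_inv, one_mul,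
        Units.inv_mul]
      simp
  · rw [← hd, mul_smul_comm, ← hc1.eq, Units.mul_inv_cancel_left, Units.coe_star, sd, smul_sub,
      smul_smul]
    simp

/-- A selfadjoint operator can be replaced by a unitary without changing its action on a vector on
which it squares to the identity. -/
lemma exists_unitary_apply_eq {G : Type*} [NormedAddCommGroup G] [InnerProductSpace ℂ G]
    [CompleteSpace G] (φ : (H →L[ℂ] H) →⋆ₐ[ℂ] (G →L[ℂ] G)) {a : H →L[ℂ] H} (ha : star a = a)
    {v : G} (hv : φ a (φ a v) = v) : ∃ w ∈ unitary (H →L[ℂ] H), φ w v = φ a v := by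
  obtain ⟨w, hw, ⟨d, hd⟩, h⟩ := exists_cayley ha
  refine ⟨w, hw, ?_⟩
  -- With `a²v = v`, both `(a + i)w v = (ia + 1)v` and `(a + i)a v` equal `v + i a v`; then the
  -- invertible `a + i` is cancelled.
  have h1 : φ d (φ w v) = φ d (φ a v) := by
    rw [← mul_apply_eq_comp, ← map_mul, hd, h]
    simp [add_apply, hv, add_comm]
  have h2 := congr_arg (φ (↑d⁻¹ : H →L[ℂ] H)) h1
  simpa only [← mul_apply_eq_comp, ← map_mul, Units.inv_mul, Units.inv_mul_cancel_left] using h2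

end Cayley

/-! ### Mirrored operators and reachable vectors -/

section Mirror

variable {HC HA : Type*} [NormedAddCommGroup HC] [InnerProductSpace ℂ HC] [CompleteSpace HC]
  [NormedAddCommGroup HA] [InnerProductSpace ℂ HA] [CompleteSpace HA]

/-- The vectors that operators of the second party can reach from `ψ`. -/
def reachable (ψ : HTensor HC HA) : Submodule ℂ (HTensor HC HA) where
  carrier := {v | ∃ T, rightHom HC HA T ψ = v}
  add_mem' := by
    rintro _ _ ⟨T, rfl⟩ ⟨T', rfl⟩
    exact ⟨T + T', by rw [map_add, add_apply]⟩
  zero_mem' := ⟨0, by rw [map_zero, zero_apply]⟩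
  smul_mem' := by
    rintro c _ ⟨T, rfl⟩
    exact ⟨c • T, by rw [map_smul, smul_apply]⟩

variable {ψ : HTensor HC HA}

lemma self_mem_reachable : ψ ∈ reachable ψ := ⟨1, by rw [map_one, one_apply_eq_self]⟩

/-- On the state `ψ`, the operator `S` of the first party acts as `T` of the second party does. -/
def Mirror (ψ : HTensor HC HA) (S : HC →L[ℂ] HC) (T : HA →L[ℂ] HA) : Prop :=
  leftHom HC HA S ψ = rightHom HC HA T ψ

/-- The order reverses on Alice's side: `S'` is replaced first, and its substitute is commuted out
past `S` before `S` meets `ψ`. -/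
lemma Mirror.mul {S S' : HC →L[ℂ] HC} {T T' : HA →L[ℂ] HA} (h : Mirror ψ S T)
    (h' : Mirror ψ S' T') : Mirror ψ (S * S') (T' * T) := by
  rw [Mirror, map_mul, map_mul, mul_apply_eq_comp, mul_apply_eq_comp, h', leftHom_rightHom_comm, h]

lemma Mirror.one : Mirror ψ 1 1 := by rw [Mirror, map_one, map_one]

lemma Mirror.smul {S : HC →L[ℂ] HC} {T : HA →L[ℂ] HA} (c : ℂ) (h : Mirror ψ S T) :
    Mirror ψ (c • S) (c • T) := by
  rw [Mirror, map_smul, map_smul, smul_apply, smul_apply, h]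

lemma Mirror.sum {ι : Type*} {s : Finset ι} {S : ι → HC →L[ℂ] HC} {T : ι → HA →L[ℂ] HA}
    (h : ∀ i ∈ s, Mirror ψ (S i) (T i)) : Mirror ψ (∑ i ∈ s, S i) (∑ i ∈ s, T i) := by
  rw [Mirror, map_sum, map_sum, sum_apply, sum_apply]
  exact Finset.sum_congr rfl h

lemma Mirror.pow {S : HC →L[ℂ] HC} {T : HA →L[ℂ] HA} (h : Mirror ψ S T) (m : ℕ) :
    Mirror ψ (S ^ m) (T ^ m) := by
  induction m with
  | zero => simpa using Mirror.one
  | succ m ih => rw [pow_succ, pow_succ']; exact ih.mul h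

lemma Mirror.list_prod {ι : Type*} {S : ι → HC →L[ℂ] HC} {T : ι → HA →L[ℂ] HA}
    (h : ∀ i, Mirror ψ (S i) (T i)) (l : List ι) :
    Mirror ψ (l.map S).prod (l.map T).reverse.prod := by
  induction l with
  | nil => exact Mirror.one
  | cons i l ih =>
    rw [List.map_cons, List.map_cons, List.prod_cons, List.reverse_cons, List.prod_append,
      List.prod_singleton]
    exact (h i).mul ih

/-- `wordPow` with the factors in the opposite order. -/
def wordPowRev {n : ℕ} {A : Type*} [Ring A] (a : Fin n → A) (r : Fin n → Fin 2) : A :=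
  ((List.finRange n).map fun k => a k ^ (r k : ℕ)).reverse.prod

lemma Mirror.wordPow {n : ℕ} {S : Fin n → HC →L[ℂ] HC} {T : Fin n → HA →L[ℂ] HA}
    (h : ∀ i, Mirror ψ (S i) (T i)) (r : Fin n → Fin 2) :
    Mirror ψ (wordPow S r) (wordPowRev T r) :=
  Mirror.list_prod (fun i => (h i).pow _) _

lemma Mirror.specProj {n : ℕ} {S : (Fin n → Fin 2) → HC →L[ℂ] HC}
    {T : (Fin n → Fin 2) → HA →L[ℂ] HA} (h : ∀ r, Mirror ψ (S r) (T r)) (p : Fin n → Fin 2) :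
    Mirror ψ (specProj S p) (specProj T p) :=
  (Mirror.sum fun r _ => (h r).smul _).smul _

/-- Because mirroring reverses products, Alice's circuit in the ordinary order imitates Charlie's
reversed Kraus operators, the factor required by `PauliRelations.swap_mul_rev`. -/
lemma Mirror.swapOpRev {n : ℕ} {z x j : (Fin n → Fin 2) → HC →L[ℂ] HC}
    {z' x' j' : (Fin n → Fin 2) → HA →L[ℂ] HA} (hz : ∀ r, Mirror ψ (z r) (z' r))
    (hx : ∀ r, Mirror ψ (x r) (x' r)) (hj : ∀ r, Mirror ψ (j r) (j' r)) (p q : Fin n → Fin 2) :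
    Mirror ψ (swapOpRev z x j p q) (swapOp z' x' j' p q) := by
  have := ((specProj hj q).mul (specProj hz p)).mul (hx p)
  rwa [← mul_assoc] at this

/-- The operators of the first party whose action on `ψ` the second party can imitate. -/
def mirrored (ψ : HTensor HC HA) : Subalgebra ℂ (HC →L[ℂ] HC) where
  carrier := {S | ∃ T, Mirror ψ S T}
  mul_mem' := by
    rintro _ _ ⟨T, h⟩ ⟨T', h'⟩
    exact ⟨_, h.mul h'⟩
  add_mem' := by
    rintro S S' ⟨T, h⟩ ⟨T', h'⟩
    exact ⟨T + T', by rw [Mirror, map_add, map_add, add_apply, add_apply, h, h']⟩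
  algebraMap_mem' c := ⟨c • 1, by
    rw [Algebra.algebraMap_eq_smul_one]; exact Mirror.one.smul c⟩

lemma leftHom_apply_mem_reachable {S : HC →L[ℂ] HC} (hS : S ∈ mirrored ψ) {v : HTensor HC HA}
    (hv : v ∈ reachable ψ) : leftHom HC HA S v ∈ reachable ψ := by
  obtain ⟨T, h⟩ := hS
  obtain ⟨T', rfl⟩ := hv
  exact ⟨T' * T, by rw [leftHom_rightHom_comm, h, map_mul, mul_apply_eq_comp]⟩

/-- The mirrored operators act on the reachable vectors. -/
def mirrorRep (ψ : HTensor HC HA) : mirrored ψ →ₐ[ℂ] Module.End ℂ (reachable ψ) :=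
  AlgHom.ofLinearMap
    { toFun := fun S => (leftHom HC HA (S : HC →L[ℂ] HC)).toLinearMap.restrict
        fun _ hv => leftHom_apply_mem_reachable S.2 hv
      map_add' := fun S S' => by
        ext v
        simp [map_add]
      map_smul' := fun c S => by
        ext v
        simp [map_smul] }
    (by ext v; simp)
    (fun S S' => by ext v; simp [map_mul])

lemma mirrorRep_apply (S : mirrored ψ) (v : reachable ψ) :
    (mirrorRep ψ S v : HTensor HC HA) = leftHom HC HA (S : HC →L[ℂ] HC) v := rfl

/-- Operators that agree on `ψ` agree on all reachable vectors. -/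
lemma mirrorRep_eq {S S' : mirrored ψ}
    (h : leftHom HC HA (S : HC →L[ℂ] HC) ψ = leftHom HC HA (S' : HC →L[ℂ] HC) ψ) :
    mirrorRep ψ S = mirrorRep ψ S' := by
  ext ⟨v, T, rfl⟩
  simp only [mirrorRep_apply, leftHom_rightHom_comm, h]

end Mirror

/-! ### From maximal violation to the Pauli relations -/

section BellViolation

variable {HC HA : Type*} [NormedAddCommGroup HC] [InnerProductSpace ℂ HC] [CompleteSpace HC]
  [NormedAddCommGroup HA] [InnerProductSpace ℂ HA] [CompleteSpace HA] {ψ : HTensor HC HA}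

lemma inner_hmap_of_star_eq {S : HC →L[ℂ] HC} (hS : star S = S) (T : HA →L[ℂ] HA) :
    inner ℂ ψ (hmap S T ψ) = inner ℂ (leftHom HC HA S ψ) (rightHom HC HA T ψ) := by
  rw [hmap_eq_leftHom_rightHom, ← ContinuousLinearMap.adjoint_inner_left,
    ← ContinuousLinearMap.star_eq_adjoint, ← map_star, hS]

/-- Anticommutation and mirrored operators from the vector relations of a maximal CHSH violation. -/
lemma chsh_relations {A B : HC →L[ℂ] HC} {D E : HA →L[ℂ] HA}
    (hA : leftHom HC HA A (leftHom HC HA A ψ) = ψ) (hB : leftHom HC HA B (leftHom HC HA B ψ) = ψ)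
    (hD : rightHom HC HA D (rightHom HC HA D ψ) = ψ)
    (h1 : ((√2 : ℝ) : ℂ) • rightHom HC HA D ψ = leftHom HC HA A ψ + leftHom HC HA B ψ)
    (h2 : ((√2 : ℝ) : ℂ) • rightHom HC HA E ψ = leftHom HC HA A ψ - leftHom HC HA B ψ) :
    leftHom HC HA (A * B) ψ = -leftHom HC HA (B * A) ψ ∧
      Mirror ψ A (((√2 : ℝ) : ℂ)⁻¹ • (D + E)) ∧ Mirror ψ B (((√2 : ℝ) : ℂ)⁻¹ • (D - E)) := by
  have hs : ((√2 : ℝ) : ℂ) * ((√2 : ℝ) : ℂ) = 2 := by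
    rw [← Complex.ofReal_mul, Real.mul_self_sqrt (by norm_num)]; simp
  have hs0 : ((√2 : ℝ) : ℂ) ≠ 0 := fun h => by simp [h] at hs
  refine ⟨?_, ?_, ?_⟩
  · have h3 : (2 : ℂ) • ψ = leftHom HC HA A (leftHom HC HA A ψ + leftHom HC HA B ψ) +
        leftHom HC HA B (leftHom HC HA A ψ + leftHom HC HA B ψ) := by
      rw [← h1, map_smul, map_smul, leftHom_rightHom_comm, leftHom_rightHom_comm, ← smul_add,
        ← map_add, ← h1, map_smul, smul_smul, hs, hD]
    rw [map_add, map_add, hA, hB, two_smul] at h3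
    rw [map_mul, map_mul, mul_apply_eq_comp, mul_apply_eq_comp, eq_neg_iff_add_eq_zero]
    have h4 : ψ + ψ + (leftHom HC HA A (leftHom HC HA B ψ) + leftHom HC HA B (leftHom HC HA A ψ)) =
        ψ + ψ + 0 := by
      rw [add_zero]
      conv_rhs => rw [h3]
      abel
    exact add_left_cancel h4
  · have h5 : ((√2 : ℝ) : ℂ) • (rightHom HC HA D ψ + rightHom HC HA E ψ) =
        (2 : ℂ) • leftHom HC HA A ψ := by
      rw [smul_add, h1, h2, two_smul]; abel
    rw [Mirror, map_smul, map_add, smul_apply, add_apply, eq_inv_smul_iff₀ hs0]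
    rw [← smul_right_inj hs0, smul_smul, hs, h5]
  · have h5 : ((√2 : ℝ) : ℂ) • (rightHom HC HA D ψ - rightHom HC HA E ψ) =
        (2 : ℂ) • leftHom HC HA B ψ := by
      rw [smul_sub, h1, h2, two_smul]; abel
    rw [Mirror, map_smul, map_sub, smul_apply, sub_apply, eq_inv_smul_iff₀ hs0]
    rw [← smul_right_inj hs0, smul_smul, hs, h5]

variable {n : ℕ} {P : (Fin n → Fin 3) → (Fin n → ℤˣ) → HC →L[ℂ] HC}
  {Q : (Fin n → Fin 6) → (Fin n → ℤˣ) → HA →L[ℂ] HA}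

lemma chsh_relations_of_saturated (hψ : ‖ψ‖ = 1) {A B : HC →L[ℂ] HC} {D E : HA →L[ℂ] HA}
    (sA : star A = A) (sB : star B = B) (sD : star D = D) (sE : star E = E)
    (cA : ∀ v, ‖leftHom HC HA A v‖ ≤ ‖v‖) (cB : ∀ v, ‖leftHom HC HA B v‖ ≤ ‖v‖)
    (cD : ∀ v, ‖rightHom HC HA D v‖ ≤ ‖v‖) (cE : ∀ v, ‖rightHom HC HA E v‖ ≤ ‖v‖) :
    (inner ℂ ψ (hmap A (D + E) ψ)).re + (inner ℂ ψ (hmap B (D - E) ψ)).re ≤ 2 * √2 ∧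
    (2 * √2 ≤ (inner ℂ ψ (hmap A (D + E) ψ)).re + (inner ℂ ψ (hmap B (D - E) ψ)).re →
      (‖leftHom HC HA A ψ‖ = 1 ∧ ‖leftHom HC HA B ψ‖ = 1) ∧
      leftHom HC HA (A * B) ψ = -leftHom HC HA (B * A) ψ ∧
      (∃ T, star T = T ∧ Mirror ψ A T) ∧ ∃ T, star T = T ∧ Mirror ψ B T) := by
  rw [inner_hmap_of_star_eq sA, inner_hmap_of_star_eq sB, map_add, map_sub, add_apply, sub_apply]
  obtain ⟨hle, heq⟩ := chsh_le ((cA ψ).trans hψ.le) ((cB ψ).trans hψ.le) ((cD ψ).trans hψ.le)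
    ((cE ψ).trans hψ.le)
  refine ⟨hle, fun hge => ?_⟩
  obtain ⟨h1, h2, nA, nB, nD, -⟩ := heq hge
  obtain ⟨hac, mA, mB⟩ := chsh_relations
    (apply_apply_of_norm_eq (by rw [← map_star, sA]) cA hψ nA)
    (apply_apply_of_norm_eq (by rw [← map_star, sB]) cB hψ nB)
    (apply_apply_of_norm_eq (by rw [← map_star, sD]) cD hψ nD) h1 h2
  exact ⟨⟨nA, nB⟩, hac, ⟨_, by rw [star_smul, star_add, sD, sE]; simp, mA⟩,
    ⟨_, by rw [star_smul, star_sub, sD, sE]; simp, mB⟩⟩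

/-- What a maximal violation of the triple CHSH inequality in every subsystem says about Charlie's
averaged observables. -/
structure BellRelations (ψ : HTensor HC HA)
    (P : (Fin n → Fin 3) → (Fin n → ℤˣ) → HC →L[ℂ] HC) : Prop where
  norm_eq : ∀ s i, ‖leftHom HC HA (avgObs P s i) ψ‖ = 1
  anticomm : ∀ s t i, s ≠ t → leftHom HC HA (avgObs P s i * avgObs P t i) ψ =
    -leftHom HC HA (avgObs P t i * avgObs P s i) ψ
  exists_mirror : ∀ s i, ∃ T, star T = T ∧ Mirror ψ (avgObs P s i) T

lemma bellRelations_of_tripleCHSH (hψ : ‖ψ‖ = 1) (hP : ∀ z, IsProjMeasurement (P z))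
    (hQ : ∀ x, IsProjMeasurement (Q x))
    (hBell : ∀ i, inner ℂ ψ (tripleCHSH P Q i ψ) = ((6 * √2 : ℝ) : ℂ)) : BellRelations ψ P := by
  have key : ∀ i, (∀ s, ‖leftHom HC HA (avgObs P s i) ψ‖ = 1) ∧
      (∀ s t, s ≠ t → leftHom HC HA (avgObs P s i * avgObs P t i) ψ =
        -leftHom HC HA (avgObs P t i * avgObs P s i) ψ) ∧
      ∀ s, ∃ T, star T = T ∧ Mirror ψ (avgObs P s i) T := by
    intro i
    have sC : ∀ s, star (avgObs P s i) = avgObs P s i := fun s => star_avgObs hP s i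
    have sN : star (-avgObs P 2 i) = -avgObs P 2 i := by rw [star_neg, sC]
    have sQ : ∀ s, star (avgObs Q s i) = avgObs Q s i := fun s => star_avgObs hQ s i
    have cC : ∀ s v, ‖leftHom HC HA (avgObs P s i) v‖ ≤ ‖v‖ := fun s v =>
      norm_map_avgObs_le _ hP s i v
    have cN : ∀ v, ‖leftHom HC HA (-avgObs P 2 i) v‖ ≤ ‖v‖ := fun v => by
      rw [map_neg, neg_apply, norm_neg]; exact cC 2 v
    have cQ : ∀ s v, ‖rightHom HC HA (avgObs Q s i) v‖ ≤ ‖v‖ := fun s v =>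
      norm_map_avgObs_le _ hQ s i v
    obtain ⟨l1, e1⟩ := chsh_relations_of_saturated hψ (sC 0) (sC 1) (sQ 0) (sQ 1) (cC 0) (cC 1)
      (cQ 0) (cQ 1)
    -- The Bell operator contains `Y` with a minus sign, so the other two inequalities are applied
    -- to `-Y`; the sign is undone below.
    obtain ⟨l2, e2⟩ := chsh_relations_of_saturated hψ (sC 0) sN (sQ 2) (sQ 3) (cC 0) cN
      (cQ 2) (cQ 3)
    obtain ⟨l3, e3⟩ := chsh_relations_of_saturated hψ (sC 1) sN (sQ 4) (sQ 5) (cC 1) cN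
      (cQ 4) (cQ 5)
    have hneg : ∀ T : HA →L[ℂ] HA, hmap (-avgObs P 2 i) T = -hmap (avgObs P 2 i) T := fun T => by
      rw [← hmapBilin_apply, map_neg]; rfl
    have hsum := congr_arg Complex.re (hBell i)
    simp only [tripleCHSH, add_apply, sub_apply, inner_add_right, inner_sub_right, Complex.add_re,
      Complex.sub_re, Complex.ofReal_re] at hsum
    simp only [hneg, neg_apply, inner_neg_right, Complex.neg_re] at l2 e2 l3 e3
    -- The total is `6√2` and the other two summands are at most `2√2` each, so this one is
    -- saturated; likewise for the next two.
    obtain ⟨⟨n0, n1⟩, ac01, m0, m1⟩ := e1 (by linarith)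
    obtain ⟨⟨-, n2⟩, ac02, -, m2⟩ := e2 (by linarith)
    obtain ⟨-, ac12, -, -⟩ := e3 (by linarith)
    rw [map_neg, neg_apply, norm_neg] at n2
    rw [mul_neg, neg_mul, map_neg, map_neg, neg_apply, neg_apply, neg_inj] at ac02 ac12
    obtain ⟨T, sT, hT⟩ := m2
    have m2' : Mirror ψ (avgObs P 2 i) (-T) := by
      rw [Mirror, map_neg, neg_apply] at hT ⊢
      rw [← hT, neg_neg]
    refine ⟨?_, ?_, ?_⟩
    · intro s
      fin_cases s
      exacts [n0, n1, n2]
    · intro s t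
      fin_cases s <;> fin_cases t <;> intro hst
      · exact absurd rfl hst
      · exact ac01
      · exact ac02
      · exact neg_eq_iff_eq_neg.1 ac01.symm
      · exact absurd rfl hst
      · exact ac12
      · exact neg_eq_iff_eq_neg.1 ac02.symm
      · exact neg_eq_iff_eq_neg.1 ac12.symm
      · exact absurd rfl hst
    · intro s
      fin_cases s
      exacts [m0, m1, ⟨-T, by rw [star_neg, sT], m2'⟩]
  exact ⟨fun s i => (key i).1 s, fun s t i => (key i).2.1 s t, fun s i => (key i).2.2 s⟩

namespace BellRelations

lemma avgObs_mem (h : BellRelations ψ P) (s : Fin 3) (i : Fin n) :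
    avgObs P s i ∈ mirrored ψ :=
  let ⟨T, hT⟩ := h.exists_mirror s i
  ⟨T, hT.2⟩

/-- The action of Charlie's averaged observables on the reachable vectors. -/
def obs (h : BellRelations ψ P) (s : Fin 3) (i : Fin n) : Module.End ℂ (reachable ψ) :=
  mirrorRep ψ ⟨avgObs P s i, h.avgObs_mem s i⟩

lemma avgObs_apply_apply (h : BellRelations ψ P) (hψ : ‖ψ‖ = 1)
    (hP : ∀ z, IsProjMeasurement (P z)) (s : Fin 3) (i : Fin n) :
    leftHom HC HA (avgObs P s i) (leftHom HC HA (avgObs P s i) ψ) = ψ :=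
  apply_apply_of_norm_eq (by rw [← map_star, star_avgObs hP]) (norm_map_avgObs_le _ hP s i) hψ
    (h.norm_eq s i)

lemma signObs_apply (h : BellRelations ψ P) (hψ : ‖ψ‖ = 1) (hP : ∀ z, IsProjMeasurement (P z))
    (z : Fin n → Fin 3) (i : Fin n) :
    leftHom HC HA (signObs (P z) i) ψ = leftHom HC HA (avgObs P (z i) i) ψ :=
  map_signObs_apply_eq _ hP z i hψ (h.norm_eq _ i)

lemma signObs_mem (h : BellRelations ψ P) (hψ : ‖ψ‖ = 1) (hP : ∀ z, IsProjMeasurement (P z))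
    (z : Fin n → Fin 3) (i : Fin n) : signObs (P z) i ∈ mirrored ψ := by
  obtain ⟨T, hT⟩ := h.avgObs_mem (z i) i
  exact ⟨T, (h.signObs_apply hψ hP z i).trans hT⟩

lemma mirrorRep_signObs (h : BellRelations ψ P) (hψ : ‖ψ‖ = 1)
    (hP : ∀ z, IsProjMeasurement (P z)) (z : Fin n → Fin 3) (i : Fin n) :
    mirrorRep ψ ⟨signObs (P z) i, h.signObs_mem hψ hP z i⟩ = h.obs (z i) i :=
  mirrorRep_eq (h.signObs_apply hψ hP z i)

/-- Charlie's averaged observables satisfy the Pauli relations on the reachable vectors. -/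
lemma pauliRelations (h : BellRelations ψ P) (hψ : ‖ψ‖ = 1) (hP : ∀ z, IsProjMeasurement (P z)) :
    PauliRelations h.obs where
  mul_self s i := by
    rw [obs, ← map_mul, ← map_one (mirrorRep ψ)]
    refine mirrorRep_eq ?_
    simpa [map_mul] using h.avgObs_apply_apply hψ hP s i
  anticomm s t i hst := by
    rw [obs, obs, ← map_mul, ← map_mul, ← map_neg]
    refine mirrorRep_eq ?_
    simpa [map_mul, map_neg] using h.anticomm s t i hst
  comm s t i j hij := by
    -- A setting vector with `s` at `i` and `t` at `j` yields both observables from one projective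
    -- measurement, where they commute as operators.
    have e1 : (Function.update (fun _ => s) j t : Fin n → Fin 3) i = s := by simp [hij]
    have e2 : (Function.update (fun _ => s) j t : Fin n → Fin 3) j = t := by simp
    have h1 := h.mirrorRep_signObs hψ hP (Function.update (fun _ => s) j t) i
    have h2 := h.mirrorRep_signObs hψ hP (Function.update (fun _ => s) j t) j
    rw [e1] at h1
    rw [e2] at h2
    rw [← h1, ← h2, ← map_mul, ← map_mul]
    exact congr_arg _ (Subtype.ext ((hP _).signObs_comm i j))

end BellRelations

end BellViolation

/-! ### Words and swap operators under algebra homomorphisms -/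

section MapWords

variable {n : ℕ} {A B : Type*} [Ring A] [Algebra ℂ A] [Ring B] [Algebra ℂ B] (φ : A →ₐ[ℂ] B)

lemma map_chirality (c : Fin 3 → Fin n → A) (i : Fin n) :
    φ (chirality c i) = chirality (fun s k => φ (c s k)) i := by
  simp [chirality]

lemma map_swapOp (z x j : (Fin n → Fin 2) → A) (p q : Fin n → Fin 2) :
    φ (swapOp z x j p q) =
      swapOp (fun r => φ (z r)) (fun r => φ (x r)) (fun r => φ (j r)) p q := by
  simp [swapOp, map_specProj]

lemma map_swapOpRev (z x j : (Fin n → Fin 2) → A) (p q : Fin n → Fin 2) :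
    φ (swapOpRev z x j p q) =
      swapOpRev (fun r => φ (z r)) (fun r => φ (x r)) (fun r => φ (j r)) p q := by
  simp [swapOpRev, map_specProj]

lemma map_wordPow_fun (a : Fin n → A) :
    (fun r => φ (wordPow a r)) = wordPow fun k => φ (a k) :=
  funext fun r => map_wordPow (φ : A →+* B) a r

lemma map_wordPow_chirality (c : Fin 3 → Fin n → A) :
    (fun r => φ (wordPow (chirality c) r)) = wordPow (chirality fun s k => φ (c s k)) := by
  rw [map_wordPow_fun]
  congr 1
  exact funext fun i => map_chirality φ c i

end MapWords

/-! ### Words in unitaries -/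

section UnitaryWords

variable {n : ℕ} {H : Type*} [NormedAddCommGroup H] [InnerProductSpace ℂ H] [CompleteSpace H]

lemma wordPow_mem_unitary {a : Fin n → H →L[ℂ] H} (ha : ∀ i, a i ∈ unitary (H →L[ℂ] H))
    (r : Fin n → Fin 2) : wordPow a r ∈ unitary (H →L[ℂ] H) := by
  refine list_prod_mem fun y hy => ?_
  obtain ⟨i, _, rfl⟩ := List.mem_map.1 hy
  exact pow_mem (ha i) _

lemma wordPowRev_mem_unitary {a : Fin n → H →L[ℂ] H} (ha : ∀ i, a i ∈ unitary (H →L[ℂ] H))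
    (r : Fin n → Fin 2) : wordPowRev a r ∈ unitary (H →L[ℂ] H) := by
  refine list_prod_mem fun y hy => ?_
  obtain ⟨i, _, rfl⟩ := List.mem_map.1 (List.mem_reverse.1 hy)
  exact pow_mem (ha i) _

lemma I_smul_mem_unitary {a : H →L[ℂ] H} (ha : a ∈ unitary (H →L[ℂ] H)) :
    Complex.I • a ∈ unitary (H →L[ℂ] H) := by
  rw [Unitary.mem_iff, star_smul, smul_mul_smul_comm, smul_mul_smul_comm,
    Unitary.star_mul_self_of_mem ha, Unitary.mul_star_self_of_mem ha]
  simp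

end UnitaryWords

/-! ### Registers on both sides and the maximally entangled state -/

section TensorRegisters

variable {n : ℕ} {E F E' F' : Type*}
  [NormedAddCommGroup E] [InnerProductSpace ℂ E] [NormedAddCommGroup F] [InnerProductSpace ℂ F]
  [NormedAddCommGroup E'] [InnerProductSpace ℂ E'] [NormedAddCommGroup F'] [InnerProductSpace ℂ F']

lemma onLeft_hmap (T : E' →L[ℂ] E') (A : E →L[ℂ] E') (B : F →L[ℂ] F') (w : HTensor E F) :
    onLeft T (hmap A B w) = hmap (T ∘L A) B w := by
  rw [onLeft, ← hmap_comp_apply]; rfl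

lemma hmap_onLeft (T : E →L[ℂ] E) (A : E →L[ℂ] E') (B : F →L[ℂ] F') (w : HTensor E F) :
    hmap A B (onLeft T w) = hmap (A ∘L T) B w := by
  rw [onLeft, ← hmap_comp_apply]; rfl

lemma withPhi_onLeft (T : E →L[ℂ] E) (ξ : HTensor E F) :
    (withPhi (onLeft T ξ) : HTensor (Reg n E) (Reg n F)) = onLeft (regLift T) (withPhi ξ) := by
  rw [withPhi, withPhi, map_smul, map_sum]
  congr 1
  refine Finset.sum_congr rfl fun p _ => ?_
  rw [onLeft_hmap, hmap_onLeft]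
  congr 2
  ext1 v
  exact (regLift_ket T p v).symm

lemma hmap_bra_withPhi (ξ : HTensor E F) :
    hmap (bra (0 : Fin n → Fin 2)) (bra 0) (withPhi ξ) = (((√2 : ℝ) : ℂ) ^ n)⁻¹ • ξ := by
  rw [withPhi, map_smul, map_sum, Finset.sum_eq_single 0]
  · rw [← hmap_comp_apply, bra_comp_ket, bra_comp_ket, if_pos rfl, if_pos rfl, hmap_one_one,
      one_apply_eq_self]
  · intro p _ hp
    rw [← hmap_comp_apply, bra_comp_ket, if_neg hp.symm, hmap_zero_left, zero_apply]
  · simp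

lemma sqrt_two_pow_ne_zero (n : ℕ) : (((√2 : ℝ) : ℂ) ^ n) ≠ 0 :=
  pow_ne_zero _ (Complex.ofReal_ne_zero.2 (by positivity))

/-- Lets identities for `ξ ⊗ Φ` be pulled back to the junk state: projecting both extraction
registers on `0` returns `ξ` up to a nonzero scalar. -/
lemma withPhi_injective : Function.Injective
    (withPhi : HTensor E F → HTensor (Reg n E) (Reg n F)) := fun ξ η h => by
  have := congr_arg (hmap (bra (0 : Fin n → Fin 2)) (bra 0)) h
  rw [hmap_bra_withPhi, hmap_bra_withPhi] at this
  exact smul_right_injective _ (inv_ne_zero (sqrt_two_pow_ne_zero n)) this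

variable [CompleteSpace E] [CompleteSpace F]

lemma inner_hmap_ket (p q : Fin n → Fin 2) (x y : HTensor E F) :
    inner ℂ (hmap (ket p) (ket p) x) (hmap (ket q) (ket q) y) = if p = q then inner ℂ x y else 0 := by
  rw [inner_hmap_left, adjoint_ket, adjoint_ket, ← hmap_comp_apply, bra_comp_ket, bra_comp_ket]
  split_ifs
  · rw [hmap_one_one, one_apply_eq_self]
  · rw [hmap_zero_left, zero_apply, inner_zero_right]

lemma norm_withPhi (ξ : HTensor E F) :
    ‖(withPhi ξ : HTensor (Reg n E) (Reg n F))‖ = ‖ξ‖ := by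
  have h : inner ℂ (withPhi ξ : HTensor (Reg n E) (Reg n F)) (withPhi ξ) = inner ℂ ξ ξ := by
    rw [withPhi, inner_smul_left, inner_smul_right, sum_inner]
    simp only [inner_sum, inner_hmap_ket, Finset.sum_ite_eq, Finset.mem_univ, if_true]
    rw [← mul_assoc, map_inv₀, map_pow, Complex.conj_ofReal, sqrt_two_pow_mul_self]
    simp
  rw [@norm_eq_sqrt_re_inner ℂ, h, ← @norm_eq_sqrt_re_inner ℂ]

lemma ket_adjoint_comp_ket : (ket (0 : Fin n → Fin 2) : E →L[ℂ] Reg n E).adjoint ∘L ket 0 = 1 := by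
  rw [adjoint_ket, bra_comp_ket, if_pos rfl]

lemma norm_withAncillas (ψ : HTensor E F) : ‖withAncillas n ψ‖ = ‖ψ‖ := by
  rw [withAncillas, hmap_comp_apply, norm_hmap_of_isometry ket_adjoint_comp_ket ket_adjoint_comp_ket,
    norm_hmap_of_isometry ket_adjoint_comp_ket ket_adjoint_comp_ket]

lemma norm_localUnitary (UC : E ≃ₗᵢ[ℂ] E) (UA : F ≃ₗᵢ[ℂ] F) (x : HTensor E F) :
    ‖localUnitary UC UA x‖ = ‖x‖ := by
  refine norm_hmap_of_isometry ?_ ?_ x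
  · ext1 v; simp [LinearIsometryEquiv.adjoint_eq_symm]
  · ext1 v; simp [LinearIsometryEquiv.adjoint_eq_symm]

end TensorRegisters

/-! ### Swap unitaries built from the Bell relations -/

section Existence

variable {HC HA : Type*} [NormedAddCommGroup HC] [InnerProductSpace ℂ HC] [CompleteSpace HC]
  [NormedAddCommGroup HA] [InnerProductSpace ℂ HA] [CompleteSpace HA] {ψ : HTensor HC HA}
  {n : ℕ} {P : (Fin n → Fin 3) → (Fin n → ℤˣ) → HC →L[ℂ] HC}

/-- The averaged observables can be replaced by unitaries, on both sides. -/
lemma BellRelations.exists_unitaries (h : BellRelations ψ P) (hψ : ‖ψ‖ = 1)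
    (hP : ∀ z, IsProjMeasurement (P z)) :
    ∃ (u : Fin 3 → Fin n → HC →L[ℂ] HC) (b : Fin 3 → Fin n → HA →L[ℂ] HA),
      (∀ s i, u s i ∈ unitary (HC →L[ℂ] HC)) ∧ (∀ s i, b s i ∈ unitary (HA →L[ℂ] HA)) ∧
      (∀ s i, leftHom HC HA (u s i) ψ = leftHom HC HA (avgObs P s i) ψ) ∧
      ∀ s i, Mirror ψ (u s i) (b s i) := by
  have hu := fun s i => exists_unitary_apply_eq (leftHom HC HA) (star_avgObs hP s i)
    (h.avgObs_apply_apply hψ hP s i)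
  have hb : ∀ s i, ∃ w ∈ unitary (HA →L[ℂ] HA),
      rightHom HC HA w ψ = leftHom HC HA (avgObs P s i) ψ := fun s i => by
    obtain ⟨T, sT, hT⟩ := h.exists_mirror s i
    -- Alice's `T` squares to the identity on `ψ` because Charlie's observable does: each `T` can be
    -- traded for it.
    obtain ⟨w, hw, hw'⟩ := exists_unitary_apply_eq (rightHom HC HA) sT (v := ψ) (by
      rw [← hT, ← leftHom_rightHom_comm, ← hT, h.avgObs_apply_apply hψ hP])
    exact ⟨w, hw, hw'.trans hT.symm⟩
  choose u hu hu' using hu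
  choose b hb hb' using hb
  exact ⟨u, b, hu, hb, hu', fun s i => (hu' s i).trans (hb' s i).symm⟩

/-- The swap unitaries of both parties, described by Kraus operators `F`, `G`: those of Charlie act
on the reachable vectors as the swap operators of the Pauli relations, and those of Alice act on
`ψ` as the reversed ones. -/
lemma BellRelations.exists_swapUnitaries (h : BellRelations ψ P) (hψ : ‖ψ‖ = 1)
    (hP : ∀ z, IsProjMeasurement (P z)) :
    ∃ (UC : Reg n (Reg n HC) ≃ₗᵢ[ℂ] Reg n (Reg n HC)) (UA : Reg n (Reg n HA) ≃ₗᵢ[ℂ] Reg n (Reg n HA))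
      (F : (Fin n → Fin 2) × (Fin n → Fin 2) → HC →L[ℂ] HC)
      (G : (Fin n → Fin 2) × (Fin n → Fin 2) → HA →L[ℂ] HA),
      (UC : Reg n (Reg n HC) →L[ℂ] Reg n (Reg n HC)) ∘L (ket 0 ∘L ket 0) =
        ∑ s : (Fin n → Fin 2) × (Fin n → Fin 2), (ket s.1 ∘L ket s.2) ∘L F s ∧
      (UA : Reg n (Reg n HA) →L[ℂ] Reg n (Reg n HA)) ∘L (ket 0 ∘L ket 0) =
        ∑ s : (Fin n → Fin 2) × (Fin n → Fin 2), (ket s.1 ∘L ket s.2) ∘L G s ∧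
      (∀ s (v : reachable ψ), leftHom HC HA (F s) v =
        ((h.pauliRelations hψ hP).swap s.1 s.2 v : HTensor HC HA)) ∧
      ∀ s, rightHom HC HA (G s) ψ = (swapOpRev (wordPow (h.obs 0)) (wordPow (h.obs 1))
        (wordPow (chirality h.obs)) s.1 s.2 ⟨ψ, self_mem_reachable⟩ : HTensor HC HA) := by
  obtain ⟨u, b, hu, hb, hu', hm⟩ := h.exists_unitaries hψ hP
  -- Alice's counterpart of `iXZY`: the factors are reversed by mirroring, while the scalar `i` is
  -- kept, not conjugated.
  set jA : Fin n → HA →L[ℂ] HA := fun i => Complex.I • (b 2 i * (b 0 i * b 1 i)) with hjA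
  have hjC : ∀ i, chirality u i ∈ unitary (HC →L[ℂ] HC) := fun i =>
    I_smul_mem_unitary (mul_mem (mul_mem (hu _ _) (hu _ _)) (hu _ _))
  have hjA' : ∀ i, jA i ∈ unitary (HA →L[ℂ] HA) := fun i =>
    I_smul_mem_unitary (mul_mem (hb _ _) (mul_mem (hb _ _) (hb _ _)))
  have hjm : ∀ i, Mirror ψ (chirality u i) (jA i) := fun i =>
    (((hm 1 i).mul (hm 0 i)).mul (hm 2 i)).smul _
  obtain ⟨UC, hUC⟩ := exists_swapUnitary (wordPow_mem_unitary (hu 0)) (wordPow_mem_unitary (hu 1))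
    (wordPow_mem_unitary hjC)
  obtain ⟨UA, hUA⟩ := exists_swapUnitary (wordPowRev_mem_unitary (hb 0))
    (wordPowRev_mem_unitary (hb 1)) (wordPowRev_mem_unitary hjA')
  -- The unitaries are lifted to the mirrored algebra. Inclusion sends a swap operator in `c` to the
  -- circuit's Kraus operator, and `mirrorRep` sends it to the one in `h.obs`; comparing the two
  -- images gives both claims.
  let c : Fin 3 → Fin n → mirrored ψ := fun s i => ⟨u s i, _, hm s i⟩
  have hc : (fun s i => mirrorRep ψ (c s i)) = h.obs := by
    ext1 s
    ext1 i
    exact mirrorRep_eq (hu' s i)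
  have hc' : (fun s i => (mirrored ψ).val (c s i)) = u := rfl
  have hz : ∀ s, (fun k => mirrorRep ψ (c s k)) = h.obs s := fun s => congr_fun hc s
  refine ⟨UC, UA, _, _, hUC, hUA, fun s v => ?_, fun s => ?_⟩
  · have e1 := map_swapOp (mirrored ψ).val (wordPow (c 0)) (wordPow (c 1)) (wordPow (chirality c))
      s.1 s.2
    rw [map_wordPow_fun, map_wordPow_fun, map_wordPow_chirality, hc'] at e1
    have e2 := map_swapOp (mirrorRep ψ) (wordPow (c 0)) (wordPow (c 1)) (wordPow (chirality c))
      s.1 s.2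
    rw [map_wordPow_fun, map_wordPow_fun, map_wordPow_chirality, hc, hz, hz] at e2
    rw [PauliRelations.swap, ← e2, mirrorRep_apply]
    exact congr_arg (fun T => leftHom HC HA T v) e1.symm
  · have e1 := map_swapOpRev (mirrored ψ).val (wordPow (c 0)) (wordPow (c 1))
      (wordPow (chirality c)) s.1 s.2
    rw [map_wordPow_fun, map_wordPow_fun, map_wordPow_chirality, hc'] at e1
    have e2 := map_swapOpRev (mirrorRep ψ) (wordPow (c 0)) (wordPow (c 1)) (wordPow (chirality c))
      s.1 s.2
    rw [map_wordPow_fun, map_wordPow_fun, map_wordPow_chirality, hc, hz, hz] at e2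
    rw [← e2, mirrorRep_apply]
    refine Eq.trans ?_ (congr_arg (fun T => leftHom HC HA T ψ) e1.symm)
    exact (Mirror.swapOpRev (Mirror.wordPow (hm 0)) (Mirror.wordPow (hm 1)) (Mirror.wordPow hjm)
      s.1 s.2).symm

end Existence

/-! ### Ancillas and local unitary as one linear map -/

section Ancillas

variable {HC HA : Type*} [NormedAddCommGroup HC] [InnerProductSpace ℂ HC]
  [NormedAddCommGroup HA] [InnerProductSpace ℂ HA] {n : ℕ}

lemma localUnitary_withAncillas (UC : Reg n (Reg n HC) ≃ₗᵢ[ℂ] Reg n (Reg n HC))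
    (UA : Reg n (Reg n HA) ≃ₗᵢ[ℂ] Reg n (Reg n HA)) (w : HTensor HC HA) :
    localUnitary UC UA (withAncillas n w) =
      hmap ((UC : Reg n (Reg n HC) →L[ℂ] Reg n (Reg n HC)) ∘L (ket 0 ∘L ket 0))
        ((UA : Reg n (Reg n HA) →L[ℂ] Reg n (Reg n HA)) ∘L (ket 0 ∘L ket 0)) w := by
  rw [localUnitary, withAncillas, ← hmap_comp_apply]

/-- Adding ancillas and applying a local unitary, as a linear map. -/
def ancillaMap (UC : Reg n (Reg n HC) ≃ₗᵢ[ℂ] Reg n (Reg n HC))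
    (UA : Reg n (Reg n HA) ≃ₗᵢ[ℂ] Reg n (Reg n HA)) :
    HTensor HC HA →L[ℂ] HTensor (Reg n (Reg n HC)) (Reg n (Reg n HA)) :=
  hmap ((UC : Reg n (Reg n HC) →L[ℂ] Reg n (Reg n HC)) ∘L (ket 0 ∘L ket 0))
    ((UA : Reg n (Reg n HA) →L[ℂ] Reg n (Reg n HA)) ∘L (ket 0 ∘L ket 0))

lemma ancillaMap_apply (UC : Reg n (Reg n HC) ≃ₗᵢ[ℂ] Reg n (Reg n HC))
    (UA : Reg n (Reg n HA) ≃ₗᵢ[ℂ] Reg n (Reg n HA)) (w : HTensor HC HA) :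
    ancillaMap UC UA w = localUnitary UC UA (withAncillas n w) :=
  (localUnitary_withAncillas UC UA w).symm

end Ancillas

/-! ### Pauli matrices on basis kets of two registers -/

section KetComp

variable {n : ℕ} {E : Type*} [NormedAddCommGroup E] [InnerProductSpace ℂ E]

lemma regOp_site_pauli_zero_comp_ket (k : Fin n) (p q : Fin n → Fin 2) :
    (regOp (site k (pauli 0)) : Reg n (Reg n E) →L[ℂ] Reg n (Reg n E)) ∘L (ket p ∘L ket q) =
      (-1 : ℂ) ^ (p k : ℕ) • (ket p ∘L ket q) := by
  ext1 w
  exact regOp_site_pauli_zero_ket k p (ket q w)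

lemma regOp_site_pauli_one_comp_ket (k : Fin n) (p q : Fin n → Fin 2) :
    (regOp (site k (pauli 1)) : Reg n (Reg n E) →L[ℂ] Reg n (Reg n E)) ∘L
      (ket (p + Pi.single k 1) ∘L ket q) = ket p ∘L ket q := by
  ext1 w
  exact (regOp_site_pauli_one_ket k _ (ket q w)).trans (by rw [Fin2Fun.add_add_cancel]; rfl)

lemma regLift_site_pauli_zero_comp_ket (k : Fin n) (p q : Fin n → Fin 2) :
    (regLift (regOp (site k (pauli 0))) : Reg n (Reg n E) →L[ℂ] Reg n (Reg n E)) ∘L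
      (ket p ∘L ket q) = (-1 : ℂ) ^ (q k : ℕ) • (ket p ∘L ket q) := by
  ext1 w
  rw [ContinuousLinearMap.comp_apply, ContinuousLinearMap.comp_apply, regLift_ket,
    regOp_site_pauli_zero_ket, map_smul, smul_apply, ContinuousLinearMap.comp_apply]

end KetComp

/-! ### Existence of a Pauli self-test -/

section Existence

variable {HC HA : Type*} [NormedAddCommGroup HC] [InnerProductSpace ℂ HC] [CompleteSpace HC]
  [NormedAddCommGroup HA] [InnerProductSpace ℂ HA] [CompleteSpace HA] {ψ : HTensor HC HA}
  {n : ℕ} {P : (Fin n → Fin 3) → (Fin n → ℤˣ) → HC →L[ℂ] HC}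

lemma hmap_sum_comp_left {ι : Type*} [Fintype ι] {E F E' F' : Type*}
    [NormedAddCommGroup E] [InnerProductSpace ℂ E] [CompleteSpace E]
    [NormedAddCommGroup F] [InnerProductSpace ℂ F] [CompleteSpace F]
    [NormedAddCommGroup E'] [InnerProductSpace ℂ E'] [NormedAddCommGroup F'] [InnerProductSpace ℂ F']
    (K : ι → E →L[ℂ] E') (A : ι → E →L[ℂ] E) (B : F →L[ℂ] F') (w : HTensor E F) :
    hmap (∑ s, K s ∘L A s) B w = ∑ s, hmap (K s) B (leftHom E F (A s) w) := by
  rw [hmap_sum_left, sum_apply]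
  refine Finset.sum_congr rfl fun s _ => ?_
  rw [leftHom_apply, ← hmap_comp_apply]
  rfl

lemma hmap_sum_comp_right {ι : Type*} [Fintype ι] {E F E' F' : Type*}
    [NormedAddCommGroup E] [InnerProductSpace ℂ E] [CompleteSpace E]
    [NormedAddCommGroup F] [InnerProductSpace ℂ F] [CompleteSpace F]
    [NormedAddCommGroup E'] [InnerProductSpace ℂ E'] [NormedAddCommGroup F'] [InnerProductSpace ℂ F']
    (K : ι → F →L[ℂ] F') (A : ι → F →L[ℂ] F) (B : E →L[ℂ] E') (w : HTensor E F) :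
    hmap B (∑ s, K s ∘L A s) w = ∑ s, hmap B (K s) (rightHom E F (A s) w) := by
  rw [hmap_sum_right, sum_apply]
  refine Finset.sum_congr rfl fun s _ => ?_
  rw [rightHom_apply, ← hmap_comp_apply]
  rfl

/-- The action of the Pauli operators on the output of the swap isometry. -/
lemma swap_intertwine (h : BellRelations ψ P) (hc : PauliRelations h.obs) {F' : Type*}
    [NormedAddCommGroup F'] [InnerProductSpace ℂ F']
    {V : HTensor HC HA → HTensor (Reg n (Reg n HC)) F'} {B : HA →L[ℂ] F'}
    (hV : ∀ v : reachable ψ, V v = ∑ s : (Fin n → Fin 2) × (Fin n → Fin 2),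
      hmap (ket s.1 ∘L ket s.2) B (hc.swap s.1 s.2 v)) (v : reachable ψ) (k : Fin n) :
    V (h.obs 0 k v) = onLeft (regOp (site k (pauli 0))) (V v) ∧
    V (h.obs 1 k v) = onLeft (regOp (site k (pauli 1))) (V v) ∧
    V (chirality h.obs k v) = onLeft (regLift (regOp (site k (pauli 0)))) (V v) := by
  refine ⟨?_, ?_, ?_⟩
  · rw [hV, hV, map_sum]
    refine Finset.sum_congr rfl fun s _ => ?_
    rw [← Module.End.mul_apply, hc.swap_mul_zero, LinearMap.smul_apply, onLeft_hmap]
    rw [regOp_site_pauli_zero_comp_ket, hmap_smul_left, Submodule.coe_smul, map_smul]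
    rfl
  · rw [hV, hV, map_sum]
    -- Multiplication by `X_k` shifts the extraction label; reindexing the sum by this shift moves
    -- the flip onto the kets, where it is `σ_x`.
    refine Fintype.sum_equiv (Equiv.addRight ((Pi.single k 1, 0) : (Fin n → Fin 2) × (Fin n → Fin 2)))
      _ _ fun s => ?_
    rw [← Module.End.mul_apply, hc.swap_mul_one, onLeft_hmap, Equiv.coe_addRight]
    rw [Prod.fst_add, Prod.snd_add, add_zero, regOp_site_pauli_one_comp_ket]
  · rw [hV, hV, map_sum]
    refine Finset.sum_congr rfl fun s _ => ?_
    rw [← Module.End.mul_apply, hc.swap_mul_chirality, LinearMap.smul_apply, onLeft_hmap]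
    rw [regLift_site_pauli_zero_comp_ket, hmap_smul_left, Submodule.coe_smul, map_smul]
    rfl

lemma regOp_site_pauli_two {E : Type*} [NormedAddCommGroup E] [InnerProductSpace ℂ E] (k : Fin n) :
    (regOp (site k (pauli 2)) : Reg n E →L[ℂ] Reg n E) =
      Complex.I • (regOp (site k (pauli 1)) * regOp (site k (pauli 0))) := by
  rw [pauli_two, site_smul, site_mul, regOp_smul, regOp_mul]

lemma BellRelations.coe_obs_apply (h : BellRelations ψ P) (s : Fin 3) (j : Fin n)
    (v : reachable ψ) : (h.obs s j v : HTensor HC HA) = onLeft (avgObs P s j) v := rfl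

lemma BellRelations.avgObs_two_apply (h : BellRelations ψ P) (hc : PauliRelations h.obs)
    (j : Fin n) (v : reachable ψ) : onLeft (avgObs P 2 j) (v : HTensor HC HA) = Complex.I •
      ((h.obs 1 j (h.obs 0 j (chirality h.obs j v)) : reachable ψ) : HTensor HC HA) := by
  rw [← h.coe_obs_apply, hc.eq_smul_chirality j, LinearMap.smul_apply, Submodule.coe_smul,
    Module.End.mul_apply, Module.End.mul_apply]

lemma avgObs_two_intertwine (h : BellRelations ψ P) (hc : PauliRelations h.obs) {F' : Type*}
    [NormedAddCommGroup F'] [InnerProductSpace ℂ F'] [CompleteSpace F']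
    {V : HTensor HC HA →L[ℂ] HTensor (Reg n (Reg n HC)) F'} {B : HA →L[ℂ] F'}
    (hV : ∀ v : reachable ψ, V v = ∑ s : (Fin n → Fin 2) × (Fin n → Fin 2),
      hmap (ket s.1 ∘L ket s.2) B (hc.swap s.1 s.2 v)) (v : reachable ψ) (k : Fin n) :
    V (onLeft (avgObs P 2 k) (v : HTensor HC HA)) =
      onLeft (regOp (site k (pauli 2))) (onLeft (regLift (regOp (site k (pauli 0)))) (V v)) := by
  have hint := swap_intertwine (V := V) h hc hV
  rw [h.avgObs_two_apply hc, map_smul, (hint _ k).2.1, (hint _ k).1, (hint _ k).2.2,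
    regOp_site_pauli_two]
  simp only [onLeft_eq_leftHom, map_smul, map_mul, smul_apply, mul_apply_eq_comp]

/-- The output of the swap unitaries on reachable vectors and on `ψ`. -/
lemma BellRelations.exists_swap_output (h : BellRelations ψ P) (hψ : ‖ψ‖ = 1)
    (hP : ∀ z, IsProjMeasurement (P z)) :
    ∃ (UC : Reg n (Reg n HC) ≃ₗᵢ[ℂ] Reg n (Reg n HC)) (UA : Reg n (Reg n HA) ≃ₗᵢ[ℂ] Reg n (Reg n HA))
      (B : HA →L[ℂ] Reg n (Reg n HA)) (η : (Fin n → Fin 2) → HTensor HC HA),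
      (∀ v : reachable ψ, localUnitary UC UA (withAncillas n v) =
        ∑ s : (Fin n → Fin 2) × (Fin n → Fin 2),
          hmap (ket s.1 ∘L ket s.2) B ((h.pauliRelations hψ hP).swap s.1 s.2 v)) ∧
      localUnitary UC UA (withAncillas n ψ) = ∑ s : (Fin n → Fin 2) × (Fin n → Fin 2),
        hmap (ket s.1 ∘L ket s.2) (ket s.1 ∘L ket s.2) (η s.2) := by
  have hc := h.pauliRelations hψ hP
  obtain ⟨UC, UA, F, G, hUC, hUA, hF, hG⟩ := h.exists_swapUnitaries hψ hP
  refine ⟨UC, UA, (UA : Reg n (Reg n HA) →L[ℂ] Reg n (Reg n HA)) ∘L (ket 0 ∘L ket 0), fun q =>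
    ((specProj (wordPow (chirality h.obs)) q * specProj (wordPow (h.obs 0)) 0)
      ⟨ψ, self_mem_reachable⟩ : reachable ψ), fun v => ?_, ?_⟩
  · rw [localUnitary_withAncillas, hUC, hmap_sum_comp_left]
    simp only [hF]
  · rw [localUnitary_withAncillas, hUC, hUA, hmap_sum_comp_left]
    refine Finset.sum_congr rfl fun s _ => ?_
    -- Alice's Kraus operator acts on `ψ` as a reversed one of Charlie, so the double sum collapses
    -- to its diagonal, and the surviving vector depends on `s.2` alone.
    have key : ∀ t, rightHom HC HA (G t) (leftHom HC HA (F s) ψ) =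
        (if s.1 = t.1 ∧ s.2 = t.2 then specProj (wordPow (chirality h.obs)) s.2 *
          specProj (wordPow (h.obs 0)) 0 else 0 : Module.End ℂ (reachable ψ))
            ⟨ψ, self_mem_reachable⟩ := fun t => by
      rw [← leftHom_rightHom_comm, hG, hF, ← Module.End.mul_apply, hc.swap_mul_rev]
    rw [hmap_sum_comp_right, Finset.sum_eq_single s]
    · rw [key, if_pos ⟨rfl, rfl⟩]
    · intro t _ ht
      rw [key, if_neg fun hst => ht (Prod.ext hst.1 hst.2).symm, LinearMap.zero_apply,
        Submodule.coe_zero, map_zero]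
    · simp

/-- The vectors `η` do not see the extraction label, so its sum splits off as `Φ`; the factor `√2ⁿ`
offsets the normalization of `Φ`. -/
lemma sum_hmap_ket_eq_withPhi {E F : Type*} [NormedAddCommGroup E] [InnerProductSpace ℂ E]
    [NormedAddCommGroup F] [InnerProductSpace ℂ F] (η : (Fin n → Fin 2) → HTensor E F) :
    ∑ s : (Fin n → Fin 2) × (Fin n → Fin 2),
        hmap (ket s.1 ∘L ket s.2) (ket s.1 ∘L ket s.2) (η s.2) =
      withPhi (∑ q, hmap (ket q) (ket q) ((((√2 : ℝ) : ℂ) ^ n) • η q)) := by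
  rw [withPhi, Fintype.sum_prod_type, Finset.smul_sum]
  refine Finset.sum_congr rfl fun p _ => ?_
  rw [map_sum, Finset.smul_sum]
  refine Finset.sum_congr rfl fun q _ => ?_
  rw [hmap_comp_apply, map_smul, map_smul, smul_smul, inv_mul_cancel₀ (sqrt_two_pow_ne_zero n),
    one_smul]

lemma exists_pauliSelfTest (h : BellRelations ψ P) (hψ : ‖ψ‖ = 1)
    (hP : ∀ z, IsProjMeasurement (P z)) : ∃ UC UA ξ, PauliSelfTest ψ P UC UA ξ := by
  have hc := h.pauliRelations hψ hP
  obtain ⟨UC, UA, B, η, hV, hΓ⟩ := h.exists_swap_output hψ hP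
  rw [sum_hmap_ket_eq_withPhi] at hΓ
  have hint := swap_intertwine (V := fun w => localUnitary UC UA (withAncillas n w)) h hc hV
  beta_reduce at hint
  set ξ : HTensor (Reg n HC) (Reg n HA) := ∑ q, hmap (ket q) (ket q)
    ((((√2 : ℝ) : ℂ) ^ n) • η q) with hξ
  set ψ' : reachable ψ := ⟨ψ, self_mem_reachable⟩ with hψ'
  have hcoe : (ψ' : HTensor HC HA) = ψ := rfl
  refine ⟨UC, UA, ξ, ?_⟩
  constructor
  -- The norm is not computed from the `η q`: every map from `ψ` to `ξ ⊗ Φ` is isometric.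
  · rw [← norm_withPhi (n := n) ξ, ← hΓ, norm_localUnitary, norm_withAncillas, hψ]
  · exact ⟨fun q => (((√2 : ℝ) : ℂ) ^ n) • η q, hξ⟩
  · exact hΓ
  · intro j
    have := (hint ψ' j).1
    rwa [h.coe_obs_apply, hcoe, hΓ] at this
  · intro j
    have := (hint ψ' j).2.1
    rwa [h.coe_obs_apply, hcoe, hΓ] at this
  · intro j
    have e1 := avgObs_two_intertwine h hc (V := ancillaMap UC UA)
      (fun v => (ancillaMap_apply UC UA _).trans (hV v)) ψ' j
    have e2 : ancillaMap UC UA ψ = withPhi ξ := (ancillaMap_apply UC UA ψ).trans hΓ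
    exact (ancillaMap_apply UC UA _).symm.trans (e1.trans
      (congrArg (onLeft _) ((congrArg (onLeft _) e2).trans (withPhi_onLeft _ ξ).symm)))

end Existence

/-! ### Intertwining relations -/

section Intertwines

variable {G G' : Type*} [NormedAddCommGroup G] [NormedSpace ℂ G] [NormedAddCommGroup G']
  [NormedSpace ℂ G'] {K : Submodule ℂ G}

/-- The operator `S` of a subspace corresponds to `T` under the map `Γ`. -/
def Intertwines (Γ : G →L[ℂ] G') (S : Module.End ℂ K) (T : G' →L[ℂ] G') : Prop :=
  ∀ v : K, Γ (S v : G) = T (Γ v)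

variable {Γ : G →L[ℂ] G'} {S S' : Module.End ℂ K} {T T' : G' →L[ℂ] G'}

lemma Intertwines.one : Intertwines Γ (1 : Module.End ℂ K) 1 := fun _ => rfl

lemma Intertwines.mul (h : Intertwines Γ S T) (h' : Intertwines Γ S' T') :
    Intertwines Γ (S * S') (T * T') := fun v => by
  rw [Module.End.mul_apply, h, h', mul_apply_eq_comp]

lemma Intertwines.add (h : Intertwines Γ S T) (h' : Intertwines Γ S' T') :
    Intertwines Γ (S + S') (T + T') := fun v => by
  rw [LinearMap.add_apply, Submodule.coe_add, map_add, h, h', add_apply]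

lemma Intertwines.smul (c : ℂ) (h : Intertwines Γ S T) : Intertwines Γ (c • S) (c • T) := fun v => by
  rw [LinearMap.smul_apply, Submodule.coe_smul, map_smul, h, smul_apply]

lemma Intertwines.list_prod {ι : Type*} {S : ι → Module.End ℂ K} {T : ι → G' →L[ℂ] G'}
    (h : ∀ i, Intertwines Γ (S i) (T i)) (l : List ι) :
    Intertwines Γ (l.map S).prod (l.map T).prod := by
  induction l with
  | nil => exact Intertwines.one
  | cons i l ih => simpa using (h i).mul ih

end Intertwines

/-! ### Bell-state measurements and equality of chiralities -/

section BellStateMeasurement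

variable {H : Type*} [NormedAddCommGroup H] [InnerProductSpace ℂ H] [CompleteSpace H] {m : ℕ}
  {R : (Fin m → Fin 4) → H →L[ℂ] H}

lemma IsProjMeasurement.marginalProj_eq (hR : IsProjMeasurement R) (l : Fin m) (b : Fin 4) :
    marginalProj R l b = hR.functional fun a => if a l = b then 1 else 0 :=
  (hR.functional_indicator _).symm

lemma IsProjMeasurement.isStarProjection_marginalProj (hR : IsProjMeasurement R) (l : Fin m)
    (b : Fin 4) : IsStarProjection (marginalProj R l b) := by
  constructor
  · rw [IsIdempotentElem, hR.marginalProj_eq, ← map_mul]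
    congr 1
    ext a
    simp
  · rw [IsSelfAdjoint, hR.marginalProj_eq, hR.star_functional]
    congr 1
    ext a
    simp [apply_ite]

lemma IsProjMeasurement.sum_marginalProj (hR : IsProjMeasurement R) (l : Fin m) :
    ∑ b, marginalProj R l b = 1 := by
  simp only [hR.marginalProj_eq, ← map_sum]
  rw [← map_one hR.functional]
  congr 1
  ext a
  simp

lemma bellSign_eq (b : Fin 4) (s : Fin 3) : bellSign b s = 1 ∨ bellSign b s = -1 := by
  fin_cases b <;> fin_cases s <;> simp [bellSign]

lemma bellSign_prod (b : Fin 4) : bellSign b 1 * (bellSign b 0 * bellSign b 2) = -1 := by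
  fin_cases b <;> simp [bellSign]

variable {HC HA : Type*} [NormedAddCommGroup HC] [InnerProductSpace ℂ HC] [CompleteSpace HC]
  [NormedAddCommGroup HA] [InnerProductSpace ℂ HA] [CompleteSpace HA] {ψ : HTensor HC HA}
  {n : ℕ} {P : (Fin n → Fin 3) → (Fin n → ℤˣ) → HC →L[ℂ] HC}

/-- Perfect correlation with an outcome projector of Alice determines the action of a contraction
of Charlie on the corresponding post-measurement state. -/
lemma leftHom_apply_rightHom_of_inner {M : HA →L[ℂ] HA} (hM : IsStarProjection M)
    {A : HC →L[ℂ] HC} (hA : ∀ v, ‖leftHom HC HA A v‖ ≤ ‖v‖) {ε : ℂ} (hε : ε = 1 ∨ ε = -1)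
    (h1 : inner ℂ ψ (hmap (1 : HC →L[ℂ] HC) M ψ) = 1 / 4) (h2 : inner ℂ ψ (hmap A M ψ) = ε / 4) :
    leftHom HC HA A (rightHom HC HA M ψ) = ε • rightHom HC HA M ψ := by
  have hMM : ∀ v, rightHom HC HA M (rightHom HC HA M v) = rightHom HC HA M v := fun v => by
    rw [← mul_apply_eq_comp, ← map_mul, hM.1]
  have hin : ∀ v, inner ℂ ψ (rightHom HC HA M v) = inner ℂ (rightHom HC HA M ψ) v := fun v => by
    rw [← ContinuousLinearMap.adjoint_inner_left, ← ContinuousLinearMap.star_eq_adjoint, ← map_star,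
      hM.2]
  rw [← rightHom_apply, ← hMM, hin] at h1
  rw [hmap_eq_rightHom_leftHom, ← hMM, hin, ← leftHom_rightHom_comm] at h2
  set w := rightHom HC HA M ψ with hw
  have hε2 : (starRingEnd ℂ) ε * ε = 1 := by rcases hε with rfl | rfl <;> simp
  have hεn : ‖ε‖ = 1 := by rcases hε with rfl | rfl <;> simp
  have hnw : ‖(2 : ℂ) • w‖ = 1 := by
    have h3 : ((‖w‖ ^ 2 : ℝ) : ℂ) = ((1 / 4 : ℝ) : ℂ) := by
      rw [inner_self_eq_norm_sq_to_K] at h1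
      push_cast
      exact h1
    have h4 : ‖w‖ ^ 2 = (1 / 2) ^ 2 := by rw [Complex.ofReal_inj.1 h3]; norm_num
    rw [norm_smul, (pow_left_inj₀ (norm_nonneg _) (by norm_num) two_ne_zero).1 h4]
    norm_num
  -- The vector `w` has norm `1/2`, so `2w` is a unit vector, and the correlation `ε/4` becomes the
  -- equality case of Cauchy–Schwarz for `ε(2w)` and `A(2w)`.
  have h5 : ε • (2 : ℂ) • w = leftHom HC HA A ((2 : ℂ) • w) := by
    refine eq_of_re_inner_eq_one (by rw [norm_smul, hεn, hnw, one_mul]) ((hA _).trans hnw.le) ?_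
    rw [map_smul, inner_smul_left, inner_smul_left, inner_smul_right, h2]
    have : (starRingEnd ℂ) ε * ((starRingEnd ℂ) 2 * (2 * (ε / 4))) = 1 := by
      rw [← hε2, Complex.conj_ofNat]; ring
    rw [this]
    simp
  rw [map_smul, smul_comm] at h5
  exact (smul_right_injective _ (two_ne_zero (α := ℂ)) h5).symm

lemma PauliRelations.chirality_mul_chirality {A : Type*} [Ring A] [Algebra ℂ A]
    {c : Fin 3 → Fin n → A} (hc : PauliRelations c) {i j : Fin n} (hij : i ≠ j) :
    chirality c i * chirality c j =
      -((c 1 i * c 1 j) * ((c 0 i * c 0 j) * (c 2 i * c 2 j))) := by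
  have hcomm : ∀ s t w, c s i * (c t j * w) = c t j * (c s i * w) := fun s t w => by
    rw [← mul_assoc, hc.comm s t i j hij, mul_assoc]
  rw [chirality, chirality, smul_mul_smul_comm, Complex.I_mul_I, neg_one_smul, neg_inj]
  simp only [mul_assoc, hcomm]

/-- The correlations of a Bell-state measurement force the chiralities of the two subsystems to
agree. -/
lemma BellRelations.chirality_of_bellTable (h : BellRelations ψ P) (hψ : ‖ψ‖ = 1)
    (hP : ∀ z, IsProjMeasurement (P z)) {R : Fin 4 → HA →L[ℂ] HA}
    (hR : ∀ b, IsStarProjection (R b)) (hR1 : ∑ b, R b = 1) {i j : Fin n} (hij : i ≠ j)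
    (ht : BellTable ψ P R i j) :
    (chirality h.obs i * chirality h.obs j) ⟨ψ, self_mem_reachable⟩ =
      (⟨ψ, self_mem_reachable⟩ : reachable ψ) := by
  have hc := h.pauliRelations hψ hP
  -- The unnormalized post-measurement states. They are reachable, so the relations among the
  -- `h.obs` apply to them, and they sum to `ψ`.
  let w : Fin 4 → reachable ψ := fun b => ⟨rightHom HC HA (R b) ψ, R b, rfl⟩
  have hw : ∀ b s, (h.obs s i * h.obs s j) (w b) = bellSign b s • w b := fun b s => by
    refine Subtype.ext ?_
    have := leftHom_apply_rightHom_of_inner (A := avgObs P s i * avgObs P s j) (hR b)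
      (fun v => by
        rw [map_mul, mul_apply_eq_comp]
        exact (norm_map_avgObs_le _ hP s i _).trans (norm_map_avgObs_le _ hP s j _))
      (bellSign_eq b s) (ht b).1 ((ht b).2 s)
    rw [map_mul] at this
    exact this
  have hsum : (⟨ψ, self_mem_reachable⟩ : reachable ψ) = ∑ b, w b := by
    refine Subtype.ext ?_
    rw [Submodule.coe_sum]
    change ψ = ∑ b, rightHom HC HA (R b) ψ
    rw [← sum_apply, ← map_sum, hR1, map_one, one_apply_eq_self]
  rw [hsum, map_sum]
  refine Finset.sum_congr rfl fun b _ => ?_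
  -- This `-1` cancels the sign `i² = -1` in `chirality_mul_chirality`, for every outcome `b` alike.
  have e : bellSign b 2 * bellSign b 0 * bellSign b 1 = -1 := by rw [← bellSign_prod b]; ring
  rw [hc.chirality_mul_chirality hij, LinearMap.neg_apply,
    Module.End.mul_apply (h.obs 1 i * h.obs 1 j), Module.End.mul_apply (h.obs 0 i * h.obs 0 j)]
  simp only [hw, map_smul, smul_smul, e, neg_one_smul, neg_neg]

end BellStateMeasurement

/-! ### Target observables -/

section Targets

variable {n : ℕ} {E : Type*} [NormedAddCommGroup E] [InnerProductSpace ℂ E]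

/-- The target observables on Charlie's registers: `σ_z`, `σ_x`, and `σ_y` with a `σ_z` on the
control qubit. -/
def targetObs (s : Fin 3) (j : Fin n) : Reg n (Reg n E) →L[ℂ] Reg n (Reg n E) :=
  regOp (site j (pauli s)) * if s = 2 then regLift (regOp (site j (pauli 0))) else 1

lemma targetObs_zero (j : Fin n) : targetObs (E := E) 0 j = regOp (site j (pauli 0)) := by
  rw [targetObs, if_neg (by decide), mul_one]

lemma targetObs_one (j : Fin n) : targetObs (E := E) 1 j = regOp (site j (pauli 1)) := by
  rw [targetObs, if_neg (by decide), mul_one]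

lemma targetObs_two (j : Fin n) : targetObs (E := E) 2 j =
    regOp (site j (pauli 2)) * regLift (regOp (site j (pauli 0))) := by
  rw [targetObs, if_pos rfl]

/-- Since `iσ_xσ_zσ_y = 1`, the extraction register drops out and only the control `σ_z` attached to
`σ_y` remains. -/
lemma chirality_targetObs (j : Fin n) :
    chirality (targetObs (E := E)) j = regLift (regOp (site j (pauli 0))) := by
  have h : Complex.I • (pauli 1 * pauli 0 * pauli 2) = 1 := by
    ext a b
    fin_cases a <;> fin_cases b <;> simp [pauli]
  have h2 : Complex.I • (regOp (site j (pauli 1)) * regOp (site j (pauli 0)) *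
      regOp (site j (pauli 2)) : Reg n (Reg n E) →L[ℂ] Reg n (Reg n E)) = 1 := by
    rw [← regOp_mul, ← site_mul, ← regOp_mul, ← site_mul, ← regOp_smul, ← site_smul, h, site_one,
      regOp_one]
  rw [chirality, targetObs_zero, targetObs_one, targetObs_two, ← mul_assoc, ← smul_mul_assoc, h2, one_mul]

lemma bra_comp_regOp_site_pauli_zero (j : Fin n) (q : Fin n → Fin 2) :
    bra q ∘L (regOp (site j (pauli 0)) : Reg n E →L[ℂ] Reg n E) =
      (-1 : ℂ) ^ (q j : ℕ) • bra q := by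
  ext1 x
  rw [ContinuousLinearMap.comp_apply, bra_regOp, smul_apply, Finset.sum_eq_single q]
  · rw [site_pauli_zero, if_pos rfl]
  · intro r _ hr
    rw [site_pauli_zero, if_neg hr.symm, zero_smul]
  · simp

end Targets

/-! ### Support of the junk state on constant strings -/

section JunkState

variable {n : ℕ} {E F : Type*} [NormedAddCommGroup E] [InnerProductSpace ℂ E]
  [NormedAddCommGroup F] [InnerProductSpace ℂ F]

lemma hmap_bra_sum_ket (ξq : (Fin n → Fin 2) → HTensor E F) (q : Fin n → Fin 2) :
    hmap (bra q) (bra q) (∑ r, hmap (ket r) (ket r) (ξq r)) = ξq q := by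
  rw [map_sum, Finset.sum_eq_single q]
  · rw [← hmap_comp_apply, bra_comp_ket, bra_comp_ket, if_pos rfl, if_pos rfl, hmap_one_one,
      one_apply_eq_self]
  · intro r _ hr
    rw [← hmap_comp_apply, bra_comp_ket, if_neg hr.symm, hmap_zero_left, zero_apply]
  · simp

/-- A control state fixed by `σ_z σ_z` has no component on which the two bits differ. -/
lemma component_eq_zero_of_fixed {ξq : (Fin n → Fin 2) → HTensor E F} {i j : Fin n}
    (h : onLeft (regOp (site i (pauli 0))) (onLeft (regOp (site j (pauli 0)))
      (∑ r, hmap (ket r) (ket r) (ξq r))) = ∑ r, hmap (ket r) (ket r) (ξq r))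
    {q : Fin n → Fin 2} (hq : q i ≠ q j) : ξq q = 0 := by
  have h1 := congrArg (hmap (bra q) (bra q)) h
  rw [hmap_onLeft, bra_comp_regOp_site_pauli_zero, hmap_smul_left, smul_apply, hmap_onLeft,
    bra_comp_regOp_site_pauli_zero, hmap_smul_left, smul_apply, hmap_bra_sum_ket, smul_smul] at h1
  have h2 : (-1 : ℂ) ^ (q i : ℕ) * (-1) ^ (q j : ℕ) = -1 := by
    generalize q i = a at *; generalize q j = b at *
    fin_cases a <;> fin_cases b <;> simp_all
  rw [h2, neg_one_smul] at h1
  have h3 : (2 : ℂ) • ξq q = 0 := by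
    rw [two_smul]
    nth_rewrite 1 [← h1]
    exact neg_add_cancel _
  exact (smul_eq_zero.1 h3).resolve_left two_ne_zero

lemma eq_zero_or_eq_one_of_consecutive {q : Fin n → Fin 2}
    (h : ∀ m (hm : m + 1 < n), q ⟨m, by omega⟩ = q ⟨m + 1, hm⟩) : q = 0 ∨ q = 1 := by
  rcases n with _ | n
  · exact Or.inl (Subsingleton.elim _ _)
  have hc : ∀ m (hm : m < n + 1), q ⟨m, hm⟩ = q 0 := by
    intro m
    induction m with
    | zero => exact fun _ => rfl
    | succ m ih => exact fun hm => (h m hm).symm.trans (ih (by omega))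
  have h01 : q 0 = 0 ∨ q 0 = 1 := by
    generalize q 0 = a
    fin_cases a <;> simp
  exact h01.imp (fun h => funext fun m => (hc m m.2).trans h) fun h => funext fun m => (hc m m.2).trans h

lemma zero_ne_one_of_pos (hn : 1 ≤ n) : (0 : Fin n → Fin 2) ≠ 1 := fun h => by
  have := congrFun h ⟨0, hn⟩
  simp at this

end JunkState

/-! ### The self-test relations in uniform notation -/

section Relations

variable {HC HA : Type*} [NormedAddCommGroup HC] [InnerProductSpace ℂ HC]
  [NormedAddCommGroup HA] [InnerProductSpace ℂ HA] {ψ : HTensor HC HA}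
  {n : ℕ} {P : (Fin n → Fin 3) → (Fin n → ℤˣ) → HC →L[ℂ] HC}
  {UC : Reg n (Reg n HC) ≃ₗᵢ[ℂ] Reg n (Reg n HC)}
  {UA : Reg n (Reg n HA) ≃ₗᵢ[ℂ] Reg n (Reg n HA)} {ξ : HTensor (Reg n HC) (Reg n HA)}

lemma PauliSelfTest.obs_eq (hst : PauliSelfTest ψ P UC UA ξ) (s : Fin 3) (j : Fin n) :
    localUnitary UC UA (withAncillas n (onLeft (avgObs P s j) ψ)) =
      onLeft (targetObs s j) (withPhi ξ) := by
  have hs : s = 0 ∨ s = 1 ∨ s = 2 := by omega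
  rcases hs with rfl | rfl | rfl
  · rw [targetObs_zero]; exact hst.obsZ j
  · rw [targetObs_one]; exact hst.obsX j
  · rw [targetObs_two, hst.obsY j, withPhi_onLeft]
    exact (DFunLike.congr_fun (hmap_mul_one _ _) (withPhi ξ)).symm

end Relations

/-! ### The junk state of an arbitrary Pauli self-test -/

section Uniqueness

variable {HC HA : Type*} [NormedAddCommGroup HC] [InnerProductSpace ℂ HC] [CompleteSpace HC]
  [NormedAddCommGroup HA] [InnerProductSpace ℂ HA] [CompleteSpace HA] {ψ : HTensor HC HA}
  {n : ℕ} {P : (Fin n → Fin 3) → (Fin n → ℤˣ) → HC →L[ℂ] HC}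
  {UC : Reg n (Reg n HC) ≃ₗᵢ[ℂ] Reg n (Reg n HC)}
  {UA : Reg n (Reg n HA) ≃ₗᵢ[ℂ] Reg n (Reg n HA)} {ξ : HTensor (Reg n HC) (Reg n HA)}

/-- Conjugating `T ⊗ 1` by `UA` gives the required operator of Alice, which does not touch Charlie's
factor. -/
lemma ancillaMap_rightHom (T : HA →L[ℂ] HA) :
    ∃ T' : Reg n (Reg n HA) →L[ℂ] Reg n (Reg n HA), ∀ v : HTensor HC HA,
      ancillaMap UC UA (rightHom HC HA T v) =
        rightHom (Reg n (Reg n HC)) (Reg n (Reg n HA)) T' (ancillaMap UC UA v) := by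
  refine ⟨(UA : Reg n (Reg n HA) →L[ℂ] Reg n (Reg n HA)) ∘L regLift (regLift T) ∘L
    (UA.symm : Reg n (Reg n HA) →L[ℂ] Reg n (Reg n HA)), fun v => ?_⟩
  rw [ancillaMap, rightHom_apply, rightHom_apply, ← hmap_comp_apply, ← hmap_comp_apply]
  congr 2
  ext1 w
  simp [regLift_ket]

/-- A relation known on `ψ` spreads to all reachable vectors, because Alice's operators pass through
`Γ` and commute with Charlie's on both sides. Products of observables can then be transported. -/
lemma intertwines_of_apply {E F : Type*} [NormedAddCommGroup E] [InnerProductSpace ℂ E]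
    [CompleteSpace E] [NormedAddCommGroup F] [InnerProductSpace ℂ F] [CompleteSpace F]
    {Γ : HTensor HC HA →L[ℂ] HTensor E F}
    (hΓ : ∀ T, ∃ T', ∀ v, Γ (rightHom HC HA T v) = rightHom E F T' (Γ v))
    {S : mirrored ψ} {T : E →L[ℂ] E}
    (h : Γ (leftHom HC HA (S : HC →L[ℂ] HC) ψ) = leftHom E F T (Γ ψ)) :
    Intertwines Γ (mirrorRep ψ S) (leftHom E F T) := by
  rintro ⟨_, B, rfl⟩
  obtain ⟨B', hB'⟩ := hΓ B
  rw [mirrorRep_apply, leftHom_rightHom_comm, hB', h, ← leftHom_rightHom_comm, ← hB']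

/-- In any Pauli self-test, Charlie's averaged observables correspond to the target observables on
all reachable vectors. -/
lemma PauliSelfTest.intertwines (hst : PauliSelfTest ψ P UC UA ξ) (h : BellRelations ψ P)
    (s : Fin 3) (j : Fin n) :
    Intertwines (ancillaMap UC UA) (h.obs s j)
      (leftHom (Reg n (Reg n HC)) (Reg n (Reg n HA)) (targetObs s j)) := by
  have hΓ : ancillaMap UC UA ψ = withPhi ξ := (ancillaMap_apply UC UA ψ).trans hst.state
  have hψ : ancillaMap UC UA (leftHom HC HA (avgObs P s j) ψ) =
      leftHom (Reg n (Reg n HC)) (Reg n (Reg n HA)) (targetObs s j) (ancillaMap UC UA ψ) :=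
    (ancillaMap_apply UC UA _).trans ((hst.obs_eq s j).trans (congrArg (onLeft _) hΓ.symm))
  exact intertwines_of_apply ancillaMap_rightHom hψ

lemma PauliSelfTest.intertwines_chirality (hst : PauliSelfTest ψ P UC UA ξ)
    (h : BellRelations ψ P) (j : Fin n) :
    Intertwines (ancillaMap UC UA) (chirality h.obs j)
      (leftHom (Reg n (Reg n HC)) (Reg n (Reg n HA)) (regLift (regOp (site j (pauli 0))))) := by
  have := (((hst.intertwines h 1 j).mul (hst.intertwines h 0 j)).mul
    (hst.intertwines h 2 j)).smul Complex.I
  rwa [← map_mul, ← map_mul, ← map_smul, ← chirality.eq_def, ← chirality.eq_def,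
    chirality_targetObs] at this

lemma PauliSelfTest.fixed (hst : PauliSelfTest ψ P UC UA ξ) (h : BellRelations ψ P) {i j : Fin n}
    (hij : (chirality h.obs i * chirality h.obs j) ⟨ψ, self_mem_reachable⟩ =
      (⟨ψ, self_mem_reachable⟩ : reachable ψ)) :
    onLeft (regOp (site i (pauli 0))) (onLeft (regOp (site j (pauli 0))) ξ) = ξ := by
  have h1 := ((hst.intertwines_chirality h i).mul (hst.intertwines_chirality h j))
    ⟨ψ, self_mem_reachable⟩
  have hΓ : ancillaMap UC UA ψ = withPhi ξ := (ancillaMap_apply UC UA ψ).trans hst.state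
  rw [hij, hΓ, mul_apply_eq_comp] at h1
  refine withPhi_injective (n := n) ?_
  rw [withPhi_onLeft, withPhi_onLeft]
  exact h1.symm

/-- The junk state of a Pauli self-test, when adjacent chiralities agree. -/
lemma PauliSelfTest.junk_eq (hst : PauliSelfTest ψ P UC UA ξ) (h : BellRelations ψ P) (hn : 1 ≤ n)
    (hadj : ∀ m (hm : m + 1 < n),
      (chirality h.obs ⟨m, by omega⟩ * chirality h.obs ⟨m + 1, hm⟩) ⟨ψ, self_mem_reachable⟩ =
        (⟨ψ, self_mem_reachable⟩ : reachable ψ)) :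
    ∃ ξ₀ ξ₁ : HTensor HC HA, inner ℂ ξ₀ ξ₀ + inner ℂ ξ₁ ξ₁ = (1 : ℂ) ∧
      ξ = hmap (ket 0) (ket 0) ξ₀ + hmap (ket 1) (ket 1) ξ₁ := by
  obtain ⟨ξq, hξ⟩ := hst.junk_form
  have h01 := zero_ne_one_of_pos hn
  have hzero : ∀ q, q ≠ 0 ∧ q ≠ 1 → hmap (ket q) (ket q) (ξq q) = 0 := by
    rintro q ⟨hq0, hq1⟩
    -- A nonconstant string changes between some neighbours `m`, `m + 1`, and there `σ_z σ_z` has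
    -- eigenvalue `-1`.
    have : ¬ ∀ m (hm : m + 1 < n), q ⟨m, by omega⟩ = q ⟨m + 1, hm⟩ := fun hall =>
      (eq_zero_or_eq_one_of_consecutive hall).elim hq0 hq1
    push Not at this
    obtain ⟨m, hm, hne⟩ := this
    have hfix := hst.fixed h (hadj m hm)
    rw [hξ] at hfix
    rw [component_eq_zero_of_fixed hfix hne, map_zero]
  have hξ' : ξ = hmap (ket 0) (ket 0) (ξq 0) + hmap (ket 1) (ket 1) (ξq 1) :=
    hξ.trans (Fintype.sum_eq_add 0 1 h01 hzero)
  refine ⟨ξq 0, ξq 1, ?_, hξ'⟩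
  have hnorm : inner ℂ ξ ξ = (1 : ℂ) := by
    rw [inner_self_eq_norm_sq_to_K, hst.norm_junk]; simp
  rw [← hnorm, hξ', inner_add_left, inner_add_right, inner_add_right, inner_hmap_ket,
    inner_hmap_ket, inner_hmap_ket, inner_hmap_ket, if_pos rfl, if_neg h01, if_neg h01.symm,
    if_pos rfl, add_zero, zero_add]

end Uniqueness

/-! ### Target projectors and the controlled transposition -/

section TargetProjectors

variable {n : ℕ} {E F : Type*} [NormedAddCommGroup E] [InnerProductSpace ℂ E]
  [NormedAddCommGroup F] [InnerProductSpace ℂ F]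

/-- The target operator of a joint outcome: a product of spectral projectors of target
observables. -/
def targetProj (z : Fin n → Fin 3) (c : Fin n → ℤˣ) : Reg n (Reg n E) →L[ℂ] Reg n (Reg n E) :=
  ((List.finRange n).map fun k =>
    (1 / 2 : ℂ) • (1 + (((c k : ℤˣ) : ℤ) : ℂ) • targetObs (z k) k)).prod

lemma smul_one_add_smul_apply {G : Type*} [NormedAddCommGroup G] [NormedSpace ℂ G] (a c : ℂ)
    (T : G →L[ℂ] G) (y : G) : (a • (1 + c • T)) y = a • (y + c • T y) := rfl

lemma regOp_smul_one_add_smul_mul (a c : ℂ) (S M : Matrix (Fin n → Fin 2) (Fin n → Fin 2) ℂ)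
    (x : Reg n E) :
    regOp (a • (1 + c • S) * M) x = a • (regOp M x + c • regOp (S * M) x) := by
  rw [smul_mul_assoc, add_mul, one_mul, smul_mul_assoc, regOp_smul, regOp_add, regOp_smul]
  rfl

/-- On a vector on which the target observables act as single-qubit matrices `N s`, the target
operator of a joint outcome acts as a tensor product. -/
lemma targetProj_apply {N : Fin 3 → Matrix (Fin 2) (Fin 2) ℂ} {x : Reg n (Reg n E)}
    (hN : ∀ s k M, targetObs s k (regOp M x) = regOp (site k (N s) * M) x)
    (z : Fin n → Fin 3) (c : Fin n → ℤˣ) : targetProj z c x =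
      regOp (tensorMat fun k => (1 / 2 : ℂ) • (1 + (((c k : ℤˣ) : ℤ) : ℂ) • N (z k))) x := by
  rw [targetProj, tensorMat_eq_list_prod]
  induction List.finRange n with
  | nil => rw [List.map_nil, List.prod_nil, List.map_nil, List.prod_nil, regOp_one]
  | cons k l ih =>
    rw [List.map_cons, List.prod_cons, List.map_cons, List.prod_cons, mul_apply_eq_comp, ih,
      site_smul, site_add, site_one, site_smul, regOp_smul_one_add_smul_mul,
      smul_one_add_smul_apply, hN]

/-- The control `σ_z` commutes with matrices on the extraction register, so on its eigenvector it
merely rescales `σ_y` by `ε`. -/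
lemma targetObs_apply_regOp {x : Reg n (Reg n E)} {ε : ℂ}
    (hx : ∀ k, regLift (regOp (site k (pauli 0))) x = ε • x) (s : Fin 3) (k : Fin n)
    (M : Matrix (Fin n → Fin 2) (Fin n → Fin 2) ℂ) : targetObs s k (regOp M x) =
      regOp (site k ((if s = 2 then ε else 1) • pauli s) * M) x := by
  rw [targetObs, site_smul, smul_mul_assoc, regOp_smul, regOp_mul, smul_apply, mul_apply_eq_comp,
    mul_apply_eq_comp]
  split_ifs with h
  · rw [← mul_apply_eq_comp (regLift _), ← regOp_regLift_comm, mul_apply_eq_comp, hx, map_smul,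
      map_smul]
  · rw [one_apply_eq_self, one_smul]

/-- Among the three Pauli matrices only `σ_y` is antisymmetric, so changing its sign alone is the
transposition. -/
lemma neg_one_smul_pauli (s : Fin 3) :
    (if s = 2 then (-1 : ℂ) else 1) • pauli s = (pauli s)ᵀ := by
  ext a b
  fin_cases s <;> fin_cases a <;> fin_cases b <;> simp [pauli]

lemma one_smul_pauli (s : Fin 3) : (if s = 2 then (1 : ℂ) else 1) • pauli s = pauli s := by
  rw [ite_self, one_smul]

lemma pauliProj_transpose (z : Fin n → Fin 3) (c : Fin n → ℤˣ) : (pauliProj z c)ᵀ =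
    tensorMat fun k => (1 / 2 : ℂ) • (1 + (((c k : ℤˣ) : ℤ) : ℂ) • (pauli (z k))ᵀ) := by
  rw [pauliProj, tensorMat_transpose]
  simp only [Matrix.transpose_smul, Matrix.transpose_add, Matrix.transpose_one]

lemma targetProj_ket_zero (z : Fin n → Fin 3) (c : Fin n → ℤˣ) (p : Fin n → Fin 2) (w : E) :
    targetProj z c (ket p (ket 0 w)) = regOp (pauliProj z c) (ket p (ket 0 w)) := by
  rw [pauliProj]
  refine targetProj_apply (N := pauli) (fun s k M => ?_) z c
  rw [targetObs_apply_regOp (ε := 1), one_smul_pauli]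
  intro k
  rw [regLift_ket, regOp_site_pauli_zero_ket]
  simp

lemma targetProj_ket_one (z : Fin n → Fin 3) (c : Fin n → ℤˣ) (p : Fin n → Fin 2) (w : E) :
    targetProj z c (ket p (ket 1 w)) = regOp (pauliProj z c)ᵀ (ket p (ket 1 w)) := by
  rw [pauliProj_transpose]
  refine targetProj_apply (N := fun s => (pauli s)ᵀ) (fun s k M => ?_) z c
  rw [targetObs_apply_regOp (ε := -1), neg_one_smul_pauli]
  intro k
  rw [regLift_ket, regOp_site_pauli_zero_ket]
  simp

lemma regOp_diagonal_ket (d : (Fin n → Fin 2) → ℂ) (s : Fin n → Fin 2) (v : E) :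
    regOp (Matrix.diagonal d) (ket s v) = d s • ket s v := by
  rw [regOp_ket, Finset.sum_eq_single s]
  · rw [Matrix.diagonal_apply_eq]
  · intro r _ hr
    rw [Matrix.diagonal_apply_ne _ hr, zero_smul]
  · simp

lemma ctrlTranspose_diagonal_ket (d e : (Fin n → Fin 2) → ℂ)
    (M : Matrix (Fin n → Fin 2) (Fin n → Fin 2) ℂ) (p q : Fin n → Fin 2) (w : E) :
    ctrlTranspose (Matrix.diagonal d) (Matrix.diagonal e) M (ket p (ket q w)) =
      d q • regOp M (ket p (ket q w)) + e q • regOp Mᵀ (ket p (ket q w)) := by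
  rw [ctrlTranspose, add_apply, ContinuousLinearMap.comp_apply, ContinuousLinearMap.comp_apply,
    regLift_ket, regLift_ket, regOp_diagonal_ket, regOp_diagonal_ket]
  simp only [map_smul]

lemma withPhi_add (ξ η : HTensor E F) :
    (withPhi (ξ + η) : HTensor (Reg n E) (Reg n F)) = withPhi ξ + withPhi η := by
  simp only [withPhi, map_add, Finset.sum_add_distrib, smul_add]

lemma onLeft_withPhi_congr {A B : Reg n (Reg n E) →L[ℂ] Reg n (Reg n E)} {q : Fin n → Fin 2}
    (h : ∀ p w, A (ket p (ket q w)) = B (ket p (ket q w))) (η : HTensor E F) :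
    onLeft A (withPhi (hmap (ket q) (ket q) η) : HTensor (Reg n (Reg n E)) (Reg n (Reg n F))) =
      onLeft B (withPhi (hmap (ket q) (ket q) η)) := by
  rw [withPhi, map_smul, map_smul, map_sum, map_sum]
  congr 1
  refine Finset.sum_congr rfl fun p _ => ?_
  rw [← hmap_comp_apply, onLeft_hmap, onLeft_hmap]
  congr 2
  ext1 w
  exact h p w

/-- Only the control strings `0` and `1` occur, and they are distinct as `n ≥ 1`. The values of the
diagonal matrices on other strings therefore play no role in this identity. -/
lemma onLeft_targetProj_withPhi (hn : 1 ≤ n) (ξ₀ ξ₁ : HTensor E F) (z : Fin n → Fin 3)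
    (c : Fin n → ℤˣ) :
    onLeft (targetProj z c) (withPhi (hmap (ket 0) (ket 0) ξ₀ + hmap (ket 1) (ket 1) ξ₁) :
        HTensor (Reg n (Reg n E)) (Reg n (Reg n F))) =
      onLeft (ctrlTranspose (Matrix.diagonal (Pi.single 0 1)) (Matrix.diagonal (1 - Pi.single 0 1))
        (pauliProj z c)) (withPhi (hmap (ket 0) (ket 0) ξ₀ + hmap (ket 1) (ket 1) ξ₁)) := by
  have h01 := zero_ne_one_of_pos hn
  rw [withPhi_add, map_add, map_add]
  congr 1
  · refine onLeft_withPhi_congr (fun p w => ?_) ξ₀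
    rw [ctrlTranspose_diagonal_ket, targetProj_ket_zero]
    simp
  · refine onLeft_withPhi_congr (fun p w => ?_) ξ₁
    rw [ctrlTranspose_diagonal_ket, targetProj_ket_one]
    simp [h01.symm]

end TargetProjectors

/-! ### Joint outcome projectors -/

section Measurements

variable {HC HA : Type*} [NormedAddCommGroup HC] [InnerProductSpace ℂ HC] [CompleteSpace HC]
  [NormedAddCommGroup HA] [InnerProductSpace ℂ HA] [CompleteSpace HA] {ψ : HTensor HC HA}
  {n : ℕ} {P : (Fin n → Fin 3) → (Fin n → ℤˣ) → HC →L[ℂ] HC}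
  {UC : Reg n (Reg n HC) ≃ₗᵢ[ℂ] Reg n (Reg n HC)}
  {UA : Reg n (Reg n HA) ≃ₗᵢ[ℂ] Reg n (Reg n HA)} {ξ : HTensor (Reg n HC) (Reg n HA)}

/-- A joint projector is a polynomial in the sign observables of one measurement, and `mirrorRep`
identifies each of these with an averaged observable. -/
lemma BellRelations.leftHom_proj_apply (h : BellRelations ψ P) (hψ : ‖ψ‖ = 1)
    (hP : ∀ z, IsProjMeasurement (P z)) (z : Fin n → Fin 3) (c : Fin n → ℤˣ) :
    leftHom HC HA (P z c) ψ = ((((List.finRange n).map fun k =>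
      (1 / 2 : ℂ) • (1 + (((c k : ℤˣ) : ℤ) : ℂ) • h.obs (z k) k)).prod
        ⟨ψ, self_mem_reachable⟩ : reachable ψ) : HTensor HC HA) := by
  let e : Fin n → mirrored ψ := fun k =>
    (1 / 2 : ℂ) • (1 + (((c k : ℤˣ) : ℤ) : ℂ) • ⟨signObs (P z) k, h.signObs_mem hψ hP z k⟩)
  have h1 : (((List.finRange n).map e).prod : HC →L[ℂ] HC) = P z c := by
    rw [(hP z).eq_prod_signObs c]
    change (mirrored ψ).val _ = _
    rw [map_list_prod, List.map_map]
    rfl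
  have h2 : mirrorRep ψ ((List.finRange n).map e).prod = ((List.finRange n).map fun k =>
      (1 / 2 : ℂ) • (1 + (((c k : ℤˣ) : ℤ) : ℂ) • h.obs (z k) k)).prod := by
    rw [map_list_prod, List.map_map]
    congr 2
    ext1 k
    rw [Function.comp_apply, map_smul, map_add, map_one, map_smul, h.mirrorRep_signObs hψ hP]
  rw [← h2, mirrorRep_apply, h1]

lemma BellRelations.intertwine_proj (h : BellRelations ψ P) (hψ : ‖ψ‖ = 1)
    (hP : ∀ z, IsProjMeasurement (P z)) {E F : Type*} [NormedAddCommGroup E]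
    [InnerProductSpace ℂ E] [CompleteSpace E] [NormedAddCommGroup F] [InnerProductSpace ℂ F]
    [CompleteSpace F] {Γ : HTensor HC HA →L[ℂ] HTensor E F} {T : Fin 3 → Fin n → E →L[ℂ] E}
    (hT : ∀ s k, Intertwines Γ (h.obs s k) (leftHom E F (T s k))) (z : Fin n → Fin 3)
    (c : Fin n → ℤˣ) : Γ (leftHom HC HA (P z c) ψ) =
      leftHom E F ((List.finRange n).map fun k =>
        (1 / 2 : ℂ) • (1 + (((c k : ℤˣ) : ℤ) : ℂ) • T (z k) k)).prod (Γ ψ) := by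
  have hk := Intertwines.list_prod (fun k => (Intertwines.one.add
    ((hT (z k) k).smul (((c k : ℤˣ) : ℤ) : ℂ))).smul (1 / 2 : ℂ)) (List.finRange n)
  have h1 := hk ⟨ψ, self_mem_reachable⟩
  have h2 : ((List.finRange n).map fun k => (1 / 2 : ℂ) • (1 + (((c k : ℤˣ) : ℤ) : ℂ) •
      leftHom E F (T (z k) k))).prod = leftHom E F ((List.finRange n).map fun k =>
        (1 / 2 : ℂ) • (1 + (((c k : ℤˣ) : ℤ) : ℂ) • T (z k) k)).prod := by
    rw [map_list_prod, List.map_map]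
    congr 2
    ext1 k
    rw [Function.comp_apply, map_smul, map_add, map_one, map_smul]
  rw [h.leftHom_proj_apply hψ hP]
  exact h1.trans (by rw [h2])

lemma PauliSelfTest.proj_eq (hst : PauliSelfTest ψ P UC UA ξ) (h : BellRelations ψ P)
    (hψ : ‖ψ‖ = 1) (hP : ∀ z, IsProjMeasurement (P z)) (z : Fin n → Fin 3) (c : Fin n → ℤˣ) :
    localUnitary UC UA (withAncillas n (onLeft (P z c) ψ)) =
      onLeft (targetProj z c) (withPhi ξ) := by
  have hΓ : ancillaMap UC UA ψ = withPhi ξ := (ancillaMap_apply UC UA ψ).trans hst.state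
  exact (ancillaMap_apply UC UA _).symm.trans
    ((h.intertwine_proj hψ hP (hst.intertwines h) z c).trans (congrArg (onLeft _) hΓ))

end Measurements

end

theorem lemma3 {HC HA : Type*}
    [NormedAddCommGroup HC] [InnerProductSpace ℂ HC] [CompleteSpace HC]
    [NormedAddCommGroup HA] [InnerProductSpace ℂ HA] [CompleteSpace HA]
    (n : ℕ) (hn : 1 ≤ n)
    -- the shared state
    (ψ : HTensor HC HA) (hψ : ‖ψ‖ = 1)
    -- Charlie's `3ⁿ` measurements and Alice's `6ⁿ` measurements, with outcomes in `{±1}ⁿ`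
    (P : (Fin n → Fin 3) → (Fin n → ℤˣ) → HC →L[ℂ] HC) (hP : ∀ z, IsProjMeasurement (P z))
    (Q : (Fin n → Fin 6) → (Fin n → ℤˣ) → HA →L[ℂ] HA) (hQ : ∀ x, IsProjMeasurement (Q x))
    -- Alice's two additional measurements
    (S : (Fin (n / 2) → Fin 4) → HA →L[ℂ] HA) (hS : IsProjMeasurement S)
    (T : (Fin ((n - 1) / 2) → Fin 4) → HA →L[ℂ] HA) (hT : IsProjMeasurement T)
    -- maximal violation of the triple CHSH inequality for every subsystem
    (hBell : ∀ i, inner ℂ ψ (tripleCHSH P Q i ψ) = ((6 * Real.sqrt 2 : ℝ) : ℂ))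
    -- Bell-state-measurement correlations; subsystems are counted from `0`
    (hST : ∀ l : Fin (n / 2),
      BellTable ψ P (marginalProj S l) ⟨2 * l, by omega⟩ ⟨2 * l + 1, by omega⟩)
    (hTT : ∀ l : Fin ((n - 1) / 2),
      BellTable ψ P (marginalProj T l) ⟨2 * l + 1, by omega⟩ ⟨2 * l + 2, by omega⟩) :
    (∃ UC UA ξ, PauliSelfTest ψ P UC UA ξ) ∧
    ∀ UC UA ξ, PauliSelfTest ψ P UC UA ξ →
      ∃ ξ₀ ξ₁ : HTensor HC HA,
        inner ℂ ξ₀ ξ₀ + inner ℂ ξ₁ ξ₁ = (1 : ℂ) ∧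
        ξ = hmap (ket 0) (ket 0) ξ₀ + hmap (ket 1) (ket 1) ξ₁ ∧
        ∃ M₀ M₁ : Matrix (Fin n → Fin 2) (Fin n → Fin 2) ℂ,
          M₀.PosSemidef ∧ M₁.PosSemidef ∧ M₀ + M₁ = 1 ∧ M₀ 0 0 = 1 ∧ M₁ 1 1 = 1 ∧
          ∀ z c, localUnitary UC UA (withAncillas n (onLeft (P z c) ψ)) =
            onLeft (ctrlTranspose M₀ M₁ (pauliProj z c)) (withPhi ξ) := by
  have h := bellRelations_of_tripleCHSH hψ hP hQ hBell
  refine ⟨exists_pauliSelfTest h hψ hP, fun UC UA ξ hst => ?_⟩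
  have hadj : ∀ m (hm : m + 1 < n),
      (chirality h.obs ⟨m, by omega⟩ * chirality h.obs ⟨m + 1, hm⟩) ⟨ψ, self_mem_reachable⟩ =
        (⟨ψ, self_mem_reachable⟩ : reachable ψ) := by
    intro m hm
    have hne : (⟨m, by omega⟩ : Fin n) ≠ ⟨m + 1, hm⟩ := fun he => by
      simp at he
    -- Counting from `0`, neighbours starting at an even index are tested by `S`, those starting at
    -- an odd index by `T`.
    obtain ⟨l, rfl | rfl⟩ := Nat.even_or_odd' m
    · exact h.chirality_of_bellTable hψ hP (hS.isStarProjection_marginalProj ⟨l, by omega⟩)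
        (hS.sum_marginalProj _) hne (hST ⟨l, by omega⟩)
    · exact h.chirality_of_bellTable hψ hP (hT.isStarProjection_marginalProj ⟨l, by omega⟩)
        (hT.sum_marginalProj _) hne (hTT ⟨l, by omega⟩)
  obtain ⟨ξ₀, ξ₁, hnorm, hξ⟩ := hst.junk_eq h hn hadj
  -- `M₀` is the projector on `0…0` and `M₁` its complement, so that they sum to `1`.
  refine ⟨ξ₀, ξ₁, hnorm, hξ, Matrix.diagonal (Pi.single 0 1), Matrix.diagonal (1 - Pi.single 0 1),
    ?_, ?_, ?_, ?_, ?_, fun z c => ?_⟩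
  · refine Matrix.PosSemidef.diagonal fun q => ?_
    rw [Pi.zero_apply, Pi.single_apply]
    split_ifs <;> simp
  · refine Matrix.PosSemidef.diagonal fun q => ?_
    rw [Pi.zero_apply, Pi.sub_apply, Pi.one_apply, Pi.single_apply]
    split_ifs <;> simp
  · rw [Matrix.diagonal_add, ← Matrix.diagonal_one]
    congr 1
    ext1 q
    simp
  · simp
  · simp [(zero_ne_one_of_pos hn).symm]
  · rw [hst.proj_eq h hψ hP, hξ, onLeft_targetProj_withPhi hn]
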